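/- **Setting.** Let $m\ge 1$, $n\ge 0$, and let $e_1,\dots,e_{m+n}$ be a homogeneous basis of $\mathbb C^{m|n}$, $m$ of the $e_a$ being even and $n$ odd, in any order with $e_1$ even; write $|a|\in\{0,1\}$ for the parity of $e_a$. The Lie superalgebra $\mathfrak{gl}(m|n)$ has basis $E_{ab}$, acting on $\mathbb C^{m|n}$ by $E_{ab}e_c=\delta_{bc}e_a$; $E_{ab}$ with $a<b$ are the raising operators, $F_b=E_{b+1,b}$ has parity $|F_b|=|b|+|b+1|$. A weight $\lambda$ has coordinates $\lambda_a=\lambda(E_{aa})$; $\epsilon_a$ is the basis dual to $E_{aa}$, $(\epsilon_a,\epsilon_b)=(-1)^{|a|}\delta_{ab}$, $\alpha_b=\epsilon_b-\epsilon_{b+1}$. On tensor products $E_{ab}$ acts as $E_{ab}\otimes 1+1\otimes E_{ab}$, where $(1\otimes E_{ab})(x\otimes y)=(-1)^{|E_{ab}||x|}x\otimes E_{ab}y$. A vector is singular if all $E_{ab}$, $a<b$, annihilate it. A module is polynomial if it is the sum of its weight spaces and all its weights have coordinates in $\mathbb Z_{\ge0}$. A hook partition is a partition $\mu$ with $\mu_{m+1}\le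 n$. Let $V(\mu)$ be the irreducible polynomial $\mathfrak{gl}(m|n)$-module with highest weight $\lambda=\lambda(\mu)$ given by $\lambda_a=\max\bigl(\mu_i-\#\{b<a:|b|=1\},0\bigr)$ if $e_a$ is the $i$-th even basis vector, and $\lambda_a=\max\bigl(\mu'_j-\#\{b<a:|b|=0\},0\bigr)$ if $e_a$ is the $j$-th odd one ($\mu'$ is the conjugate partition). Fix a homogeneous highest weight vector $v$ of $V(\mu)$ and distinct $z_1,z_2\in\mathbb C$. For $\boldsymbol l=(l_1,\dots,l_{m+n-1})\in\mathbb Z_{\ge0}^{m+n-1}$ put $l=\sum_b l_b$ and fix a colouring $c:\{1,\dots,l\}\to\{1,\dots,m+n-1\}$ taking each value $b$ exactly $l_b$ times. The Bethe equations for $\boldsymbol t=(t_1,\dots,t_l)\in\mathbb C^l$ are $$-\frac{(\alpha_{c(i)},\epsilon_1)}{t_i-z_1}-\frac{(\alpha_{c(i)},\lambda)}{t_i-z_2}+\sum_{j\ne i}\frac{(\alpha_{c(i)},\alpha_{c(j)})}{t_i-t_j}=0,\qquad i=1,\dots,l,$$ where terms with zero numerator are absent and the other denominators are required to be nonzero.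 When all $t_i,z_1,z_2$ are distinct, put $$w(z_1,z_2,\boldsymbol t)=\sum_{q=0}^{l}\sum_{\sigma\in S_l}(-1)^{|\sigma|}\,\omega_{\sigma(1),\dots,\sigma(q)}(z_1)\,\omega_{\sigma(q+1),\dots,\sigma(l)}(z_2)\;F_{c(\sigma(1))}\cdots F_{c(\sigma(q))}e_1\otimes F_{c(\sigma(q+1))}\cdots F_{c(\sigma(l))}v\in\mathbb C^{m|n}\otimes V(\mu),$$ where $\omega_{n_1,\dots,n_j}(z)=\frac1{(t_{n_1}-t_{n_2})\cdots(t_{n_{j-1}}-t_{n_j})(t_{n_j}-z)}$ (equal to $1$ for $j=0$) and $(-1)^{|\sigma|}=\prod_{i<j,\ \sigma(j)<\sigma(i)}(-1)^{|F_{c(\sigma(i))}||F_{c(\sigma(j))}|}$. **Theorem.** 1. As $(\boldsymbol l,\boldsymbol t)$ runs over all solutions of the Bethe equations at which $w(z_1,z_2,\boldsymbol t)$ is defined (i.e. all $t_i,z_1,z_2$ are distinct) and nonzero, the vectors $w(z_1,z_2,\boldsymbol t)$ form a basis of the space $\left(\mathbb C^{m|n}\otimes V(\mu)\right)^{\mathrm{sing}}$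 of singular vectors, distinct solutions giving distinct basis vectors. 2. For each of the solutions in 1, $\lambda+\epsilon_1-\sum_b l_b\alpha_b$ is the highest weight of a Pieri summand $V(\rho)$, where $\rho$ is a hook partition obtained from $\mu$ by adding one box. 3. Conversely, let $\rho$ be a hook partition obtained from $\mu$ by adding one box. Then $\lambda(\rho)=\lambda+\epsilon_{a+1}$ for some $0\le a\le m+n-1$, and the Bethe equations have exactly one solution $(\boldsymbol l,\boldsymbol t)$ with $\lambda+\epsilon_1-\sum_b l_b\alpha_b=\lambda(\rho)$. It has $l_b=1$ for $b\le a$ and $l_b=0$ for $b>a$, and its root $t^{(s)}$ of colour $s$ is $$t^{(s)}=z_2+(z_1-z_2)\prod_{r=1}^{s}\frac{\tilde\lambda_r}{(-1)^{|r|}+\tilde\lambda_r},\qquad \tilde\lambda_r=(-1)^{|r|}\lambda_r-(-1)^{|a+1|}\lambda_{a+1}+\sum_{q=r+1}^{a}(-1)^{|q|},\qquad 1\le s\le a.$$ This solution is one of those in 1, and $w(z_1,z_2,\boldsymbol t)$ is a highest weight vector of weight $\lambda(\rho)$. -/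

import Mathlib

open scoped TensorProduct

noncomputable section

namespace GaudinGL

/-! ### Signs, weights, roots

`p : Fin (k + 1) → ZMod 2` is the list of parities `|a|` of the homogeneous basis vectors `e_a`
of `ℂ^{m|n}`, where `m + n = k + 1`.  Basis vectors are indexed by `Fin (k + 1)` and simple roots
(colours) by `Fin k`, both counted from `0`. -/

/-- The sign `(-1)^x`. -/
def sgn (x : ZMod 2) : ℂ := (-1) ^ x.val

variable {k : ℕ}

/-- A weight, given by its coordinates `λ_a = λ(E_{aa})` in the basis `ε_a` of `𝔥^*`. -/
abbrev Weight (k : ℕ) : Type := Fin (k + 1) → ℂ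

/-- The weight `ε_a`. -/
def eps (a : Fin (k + 1)) : Weight k := Pi.single a 1

/-- The simple root `α_b = ε_b - ε_{b+1}`. -/
def simpleRoot (b : Fin k) : Weight k := eps b.castSucc - eps b.succ

/-- The bilinear form on weights with `(ε_a, ε_b) = (-1)^{|a|} δ_{ab}`. -/
def form (p : Fin (k + 1) → ZMod 2) (x y : Weight k) : ℂ := ∑ a, sgn (p a) * x a * y a

/-- `α(l) = ∑_b l_b α_b`. -/
def rootSum (l : Fin k → ℕ) : Weight k := ∑ b, (l b : ℂ) • simpleRoot b

/-- The parity of the simple lowering operator `F_b = E_{b+1,b}`. -/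
def parityF (p : Fin (k + 1) → ZMod 2) (b : Fin k) : ZMod 2 := p b.castSucc + p b.succ

/-! ### Modules over the Lie superalgebra `gl(m|n)` -/

/-- A `gl(m|n)`-module structure on the complex vector space `V`.  The `ℤ/2`-grading of `V` is
given by the parity involution `v ↦ (-1)^{|v|} v`: the even and odd parts of `V` are its
eigenspaces for the eigenvalues `1` and `-1`.  The operator `E a b` is homogeneous of parity
`|a| + |b|`, and the supercommutation relations of `gl(m|n)` hold. -/
structure GLModule (p : Fin (k + 1) → ZMod 2) (V : Type*) [AddCommGroup V] [Module ℂ V] where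
  E : Fin (k + 1) → Fin (k + 1) → Module.End ℂ V
  parity : Module.End ℂ V
  parity_sq : parity * parity = 1
  E_parity : ∀ a b, E a b * parity = sgn (p a + p b) • (parity * E a b)
  bracket : ∀ a b c d,
    E a b * E c d - sgn ((p a + p b) * (p c + p d)) • (E c d * E a b) =
      (if b = c then E a d else 0)
        - sgn ((p a + p b) * (p c + p d)) • (if a = d then E c b else 0)

namespace GLModule

variable {p : Fin (k + 1) → ZMod 2} {V : Type*} [AddCommGroup V] [Module ℂ V]

/-- The simple lowering operator `F_b = E_{b+1,b}`. -/
def F (M : GLModule p V) (b : Fin k) : Module.End ℂ V := M.E b.succ b.castSucc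

/-- The weight space of weight `ν`. -/
def weightSpace (M : GLModule p V) (ν : Weight k) : Submodule ℂ V :=
  ⨅ a, LinearMap.ker (M.E a a - ν a • 1)

/-- The space of singular vectors: the vectors killed by `𝔫⁺`. -/
def singular (M : GLModule p V) : Submodule ℂ V :=
  ⨅ (a : Fin (k + 1)) (b : Fin (k + 1)) (_ : a < b), LinearMap.ker (M.E a b)

/-- `v` is a (homogeneous, nonzero) highest weight vector of weight `ν`. -/
def IsHighestWeightVector (M : GLModule p V) (ν : Weight k) (v : V) : Prop :=
  v ≠ 0 ∧ (M.parity v = v ∨ M.parity v = -v) ∧ v ∈ M.weightSpace ν ∧ v ∈ M.singular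

/-- Irreducibility: the module is nonzero and has no graded submodule other than `0` and `V`. -/
def IsIrreducible (M : GLModule p V) : Prop :=
  Nontrivial V ∧ ∀ W : Submodule ℂ V,
    (∀ a b, ∀ w ∈ W, M.E a b w ∈ W) → (∀ w ∈ W, M.parity w ∈ W) → W = ⊥ ∨ W = ⊤

/-- Polynomial modules: the Cartan subalgebra acts semisimply, and the coordinates `ν(E_{aa})` of
every weight `ν` of the module are nonnegative integers. -/
def IsPolynomial (M : GLModule p V) : Prop :=
  (⨆ ν : Weight k, M.weightSpace ν) = ⊤ ∧
    ∀ ν : Weight k, M.weightSpace ν ≠ ⊥ → ∀ a, ∃ d : ℕ, ν a = d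

end GLModule

/-! ### The defining representation and tensor products -/

theorem zmod_two_cases (x : ZMod 2) : x = 0 ∨ x = 1 := by
  revert x; decide

theorem sgn_zero : sgn 0 = 1 := by simp [sgn]

theorem sgn_one : sgn 1 = -1 := by
  have h : (1 : ZMod 2).val = 1 := rfl
  simp [sgn, h]

theorem sgn_add (x y : ZMod 2) : sgn (x + y) = sgn x * sgn y := by
  have h : (1 : ZMod 2) + 1 = 0 := rfl
  rcases zmod_two_cases x with rfl | rfl <;> rcases zmod_two_cases y with rfl | rfl <;>
    simp [sgn_zero, sgn_one, h]

theorem sgn_mul_self (x : ZMod 2) : sgn x * sgn x = 1 := by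
  rcases zmod_two_cases x with rfl | rfl <;> simp [sgn_zero, sgn_one]

/-- The defining representation `ℂ^{m|n}`, in which `E_{ab} e_c = δ_{bc} e_a`. -/
def definingModule (p : Fin (k + 1) → ZMod 2) : GLModule p (Fin (k + 1) → ℂ) where
  E a b := Matrix.toLinAlgEquiv' (Matrix.single a b 1)
  parity := Matrix.toLinAlgEquiv' (Matrix.diagonal fun a => sgn (p a))
  parity_sq := by
    rw [← map_mul, Matrix.diagonal_mul_diagonal]
    simp only [sgn_mul_self]
    rw [Matrix.diagonal_one, map_one]
  E_parity a b := by
    rw [← map_mul, ← map_mul, ← map_smul]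
    congr 1
    ext i j
    rw [Matrix.mul_diagonal, Matrix.smul_apply, Matrix.diagonal_mul, smul_eq_mul, sgn_add]
    by_cases h : a = i ∧ b = j
    · obtain ⟨rfl, rfl⟩ := h
      rw [Matrix.single_apply_same, one_mul, mul_one, mul_right_comm, sgn_mul_self, one_mul]
    · rw [Matrix.single_apply_of_ne _ _ _ _ _ h, zero_mul, mul_zero, mul_zero]
  bracket a b c d := by
    have h : ∀ i j i' j' : Fin (k + 1), Matrix.single i j (1 : ℂ) * Matrix.single i' j' 1
        = if j = i' then Matrix.single i j' 1 else 0 := by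
      intro i j i' j'
      split_ifs with hji
      · subst hji; simp
      · simp [Matrix.single_mul_single_of_ne, hji]
    rw [← map_mul, ← map_mul, h, h, apply_ite Matrix.toLinAlgEquiv',
      apply_ite Matrix.toLinAlgEquiv', map_zero]
    simp only [eq_comm (a := d)]

namespace GLModule

variable {p : Fin (k + 1) → ZMod 2} {V₁ V₂ : Type*} [AddCommGroup V₁] [Module ℂ V₁]
  [AddCommGroup V₂] [Module ℂ V₂]

/-- The tensor product of two modules, with the action given by the coproduct
`E_{ab} ↦ E_{ab} ⊗ 1 + 1 ⊗ E_{ab}` and the sign rule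
`(1 ⊗ E_{ab}) (x ⊗ y) = (-1)^{|E_{ab}| |x|} x ⊗ E_{ab} y`. -/
def tensor (M₁ : GLModule p V₁) (M₂ : GLModule p V₂) : GLModule p (V₁ ⊗[ℂ] V₂) where
  E a b := TensorProduct.map (M₁.E a b) 1 +
    TensorProduct.map (M₁.parity ^ (p a + p b).val) (M₂.E a b)
  parity := TensorProduct.map M₁.parity M₂.parity
  parity_sq := by
    rw [← TensorProduct.map_mul, M₁.parity_sq, M₂.parity_sq, TensorProduct.map_one]
  E_parity a b := by
    have hc : M₁.parity ^ (p a + p b).val * M₁.parity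
        = M₁.parity * M₁.parity ^ (p a + p b).val := by
      rw [← pow_succ, ← pow_succ']
    rw [add_mul, mul_add, ← TensorProduct.map_mul, ← TensorProduct.map_mul,
      ← TensorProduct.map_mul, ← TensorProduct.map_mul, M₁.E_parity, M₂.E_parity, one_mul, mul_one,
      hc, TensorProduct.map_smul_left, TensorProduct.map_smul_right, smul_add]
  bracket a b c d := by
    have hc : ∀ (a b : Fin (k + 1)) (y : ZMod 2), M₁.E a b * M₁.parity ^ y.val
        = sgn ((p a + p b) * y) • (M₁.parity ^ y.val * M₁.E a b) := by
      intro a b y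
      have h1 : (1 : ZMod 2).val = 1 := rfl
      rcases zmod_two_cases y with rfl | rfl
      · simp [sgn_zero]
      · rw [h1, pow_one, M₁.E_parity, mul_one]
    have hp : ∀ x y : ZMod 2, M₁.parity ^ x.val * M₁.parity ^ y.val
        = M₁.parity ^ (x + y).val := by
      intro x y
      have h1 : (1 : ZMod 2).val = 1 := rfl
      have h2 : (1 : ZMod 2) + 1 = 0 := rfl
      rcases zmod_two_cases x with rfl | rfl <;> rcases zmod_two_cases y with rfl | rfl <;>
        simp [h1, h2, M₁.parity_sq]
    set x := p a + p b with hx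
    set y := p c + p d with hy
    have hs : sgn (x * y) * sgn (y * x) = 1 := by rw [mul_comm y x, sgn_mul_self]
    have h1 := M₁.bracket a b c d
    have h2 := M₂.bracket a b c d
    rw [← hx, ← hy] at h1 h2
    have key : (TensorProduct.map (M₁.E a b) 1 + TensorProduct.map (M₁.parity ^ x.val) (M₂.E a b)) *
          (TensorProduct.map (M₁.E c d) 1 + TensorProduct.map (M₁.parity ^ y.val) (M₂.E c d)) -
        sgn (x * y) • ((TensorProduct.map (M₁.E c d) 1 +
            TensorProduct.map (M₁.parity ^ y.val) (M₂.E c d)) *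
          (TensorProduct.map (M₁.E a b) 1 + TensorProduct.map (M₁.parity ^ x.val) (M₂.E a b))) =
        TensorProduct.map (M₁.E a b * M₁.E c d - sgn (x * y) • (M₁.E c d * M₁.E a b)) 1 +
        TensorProduct.map (M₁.parity ^ (x + y).val)
          (M₂.E a b * M₂.E c d - sgn (x * y) • (M₂.E c d * M₂.E a b)) := by
      simp only [add_mul, mul_add, ← TensorProduct.map_mul, one_mul, mul_one, hc a b y, hc c d x,
        hp, ← hx, ← hy, add_comm y x, sub_eq_add_neg, ← neg_smul, TensorProduct.map_add_left,
        TensorProduct.map_add_right, TensorProduct.map_smul_left, TensorProduct.map_smul_right,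
        smul_add, smul_smul, hs]
      module
    rw [key, h1, h2]
    have h3 : ∀ u : ZMod 2, u + u = 0 := by decide
    have e1 : b = c → x + y = p a + p d := by
      rintro rfl
      rw [hx, hy]
      linear_combination h3 (p b)
    have e2 : a = d → x + y = p c + p b := by
      rintro rfl
      rw [hx, hy]
      linear_combination h3 (p a)
    simp only [sub_eq_add_neg, ← neg_smul, TensorProduct.map_add_left,
      TensorProduct.map_add_right, TensorProduct.map_smul_left, TensorProduct.map_smul_right]
    by_cases hbc : b = c <;> by_cases had : a = d
    · rw [if_pos hbc, if_pos had, if_pos hbc, if_pos had, if_pos hbc, if_pos had, ← e1 hbc,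
        ← e2 had]
      module
    · rw [if_pos hbc, if_neg had, if_pos hbc, if_neg had, if_pos hbc, if_neg had, ← e1 hbc]
      simp
    · rw [if_neg hbc, if_pos had, if_neg hbc, if_pos had, if_neg hbc, if_pos had, ← e2 had]
      simp only [TensorProduct.map_zero_left, TensorProduct.map_zero_right]
      module
    · simp [hbc, had]

end GLModule

/-! ### Hook partitions and the modules `V(μ)` -/

/-- The number of even basis vectors before `e_a`. -/
def evensBefore (p : Fin (k + 1) → ZMod 2) (a : Fin (k + 1)) : ℕ :=
  (Finset.univ.filter fun b => b < a ∧ p b = 0).card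

/-- The number of odd basis vectors before `e_a`. -/
def oddsBefore (p : Fin (k + 1) → ZMod 2) (a : Fin (k + 1)) : ℕ :=
  (Finset.univ.filter fun b => b < a ∧ p b = 1).card

/-- A hook diagram for `gl(m|n)`: no box in row `m + 1` and column `n + 1` (in Mathlib, rows and
columns of a Young diagram are counted from `0`). -/
def IsHook (m n : ℕ) (μ : YoungDiagram) : Prop := (m, n) ∉ μ

/-- The highest weight of `V(μ)` with respect to the choice `p` of parities.  If `e_a` is the
`i`-th even basis vector, its coordinate at `ε_a` is the number of boxes in row `i` of `μ` outside
the columns of the odd basis vectors before `e_a`, that is `max (μ_i - #{odd b < a}) 0`; if `e_a`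
is the `j`-th odd basis vector, it is `max (μ'_j - #{even b < a}) 0`.  (Subtraction in `ℕ` is
truncated at `0`.) -/
def hookWeight (p : Fin (k + 1) → ZMod 2) (μ : YoungDiagram) : Weight k := fun a =>
  ((if p a = 0 then μ.rowLen (evensBefore p a) - oddsBefore p a
    else μ.colLen (oddsBefore p a) - evensBefore p a : ℕ) : ℂ)

/-- The diagram `ρ` is obtained from `μ` by adding one box. -/
def AddsBox (μ ρ : YoungDiagram) : Prop := μ ≤ ρ ∧ ρ.card = μ.card + 1

/-! ### Bethe equations -/

/-- `t` solves the Bethe equations for the weights `Λ 1, …, Λ N` at the points `z 1, …, z N`, where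
`c i` is the colour of `t i`.  Terms with zero numerator are absent from the equations; the
denominators of all other terms are required not to vanish. -/
structure IsBetheSolution {N l : ℕ} (p : Fin (k + 1) → ZMod 2) (Λ : Fin N → Weight k)
    (z : Fin N → ℂ) (c : Fin l → Fin k) (t : Fin l → ℂ) : Prop where
  ne_site : ∀ i s, form p (simpleRoot (c i)) (Λ s) ≠ 0 → t i ≠ z s
  ne_root : ∀ i j, i ≠ j → form p (simpleRoot (c i)) (simpleRoot (c j)) ≠ 0 → t i ≠ t j
  equation : ∀ i,
    -(∑ s, form p (simpleRoot (c i)) (Λ s) / (t i - z s))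
      + ∑ j ∈ Finset.univ.erase i,
          form p (simpleRoot (c i)) (simpleRoot (c j)) / (t i - t j) = 0

/-- `t` lies in the domain of the weight function: the points `t 1, …, t l, z 1, …, z N` avoid all
the hyperplanes `t_i = t_j` and `t_i = z_s` along which the weight function has poles. -/
def IsRegular {N l : ℕ} (z : Fin N → ℂ) (t : Fin l → ℂ) : Prop :=
  Function.Injective t ∧ ∀ i s, t i ≠ z s

/-! ### The weight function for two sites -/

/-- `ω(x_1, …, x_j; z) = 1 / ((x_1 - x_2) ⋯ (x_{j-1} - x_j) (x_j - z))`, equal to `1` for the empty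
chain. -/
def chainFactor (z : ℂ) : List ℂ → ℂ
  | [] => 1
  | [x] => 1 / (x - z)
  | x :: y :: L => 1 / (x - y) * chainFactor z (y :: L)

/-- `F_{c(n_1)} ⋯ F_{c(n_j)} v` for the chain `(n_1, …, n_j)`. -/
def chainVector {p : Fin (k + 1) → ZMod 2} {V : Type*} [AddCommGroup V] [Module ℂ V]
    (M : GLModule p V) (v : V) {l : ℕ} (c : Fin l → Fin k) (L : List (Fin l)) : V :=
  (L.map fun i => M.F (c i)).prod v

/-- The sign `(-1)^{|n|}` of the reordering `(n_1, …, n_l) = (σ 1, …, σ l)` of `(1, …, l)`: each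
inverted pair of labels whose lowering operators are both odd contributes `-1`. -/
def reorderSign (p : Fin (k + 1) → ZMod 2) {l : ℕ} (c : Fin l → Fin k)
    (σ : Equiv.Perm (Fin l)) : ℂ :=
  ∏ i, ∏ j ∈ Finset.univ.filter (fun j => i < j ∧ σ j < σ i),
    sgn (parityF p (c (σ i)) * parityF p (c (σ j)))

/-- The weight function `w(z₁, z₂, t)` with values in `V₁ ⊗ V₂`.  An ordered partition of
`{1, …, l}` into two parts is a rearrangement `(σ 1, …, σ l)` together with the length `q` of its
first part. -/
def weightFunction {p : Fin (k + 1) → ZMod 2} {V₁ V₂ : Type*} [AddCommGroup V₁] [Module ℂ V₁]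
    [AddCommGroup V₂] [Module ℂ V₂] (M₁ : GLModule p V₁) (M₂ : GLModule p V₂) (v₁ : V₁) (v₂ : V₂)
    (z₁ z₂ : ℂ) {l : ℕ} (c : Fin l → Fin k) (t : Fin l → ℂ) : V₁ ⊗[ℂ] V₂ :=
  ∑ q : Fin (l + 1), ∑ σ : Equiv.Perm (Fin l),
    (reorderSign p c σ
      * (chainFactor z₁ (((List.ofFn σ).take q).map t)
        * chainFactor z₂ (((List.ofFn σ).drop q).map t))) •
      (chainVector M₁ v₁ c ((List.ofFn σ).take q) ⊗ₜ[ℂ] chainVector M₂ v₂ c ((List.ofFn σ).drop q))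

/-! ### Bethe vectors in `ℂ^{m|n} ⊗ V(μ)` -/

/-- A choice, for every tuple `l` of multiplicities, of the colours of the `∑_b l_b` variables, such
that exactly `l_b` variables have colour `b`. -/
structure Colouring (k : ℕ) where
  colour : (l : Fin k → ℕ) → Fin (∑ b, l b) → Fin k
  card_colour : ∀ l b, (Finset.univ.filter fun i => colour l i = b).card = l b

/-- A tuple `l` of multiplicities together with values of the `∑_b l_b` variables. -/
abbrev BethePoint (k : ℕ) : Type := Σ l : Fin k → ℕ, (Fin (∑ b, l b) → ℂ)

/-- `x = (l, t)` solves the Bethe equations for the weights `ε_1`, `lam` of `ℂ^{m|n}` and `V(μ)` at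
the points `z₁`, `z₂`. -/
def SolvesBethe (p : Fin (k + 1) → ZMod 2) (lam : Weight k) (z₁ z₂ : ℂ) (C : Colouring k)
    (x : BethePoint k) : Prop :=
  IsBetheSolution p ![eps 0, lam] ![z₁, z₂] (C.colour x.1) x.2

/-- The weight `λ^∞ = ε_1 + lam - α(l)`. -/
def weightAtInfinity (lam : Weight k) (x : BethePoint k) : Weight k :=
  eps 0 + lam - rootSum x.1

section BetheVectors

variable {p : Fin (k + 1) → ZMod 2} {V : Type*} [AddCommGroup V] [Module ℂ V]

/-- The vector `w(z₁, z₂, t)` in `ℂ^{m|n} ⊗ V`, where the highest weight vector of `ℂ^{m|n}` is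
`e_1` and that of `V` is `v`. -/
def betheVector (M : GLModule p V) (v : V) (z₁ z₂ : ℂ) (C : Colouring k) (x : BethePoint k) :
    (Fin (k + 1) → ℂ) ⊗[ℂ] V :=
  weightFunction (definingModule p) M (Pi.single 0 1) v z₁ z₂ (C.colour x.1) x.2

/-- The solutions of the Bethe equations at which the weight function is defined and nonzero. -/
def betheSolutions (M : GLModule p V) (lam : Weight k) (v : V) (z₁ z₂ : ℂ) (C : Colouring k) :
    Set (BethePoint k) :=
  {x | SolvesBethe p lam z₁ z₂ C x ∧ IsRegular ![z₁, z₂] x.2 ∧ betheVector M v z₁ z₂ C x ≠ 0}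

end BetheVectors

/-- `(-1)^{|r|} λ_r - (-1)^{|a|} λ_a + ∑_{r < q < a} (-1)^{|q|}`. -/
def shiftedWeight (p : Fin (k + 1) → ZMod 2) (lam : Weight k) (a r : Fin (k + 1)) : ℂ :=
  sgn (p r) * lam r - sgn (p a) * lam a + ∑ q ∈ Finset.Ioo r a, sgn (p q)

/-- The explicit root of colour `b`, for the summand of highest weight `lam + ε_a`. -/
def explicitRoot (p : Fin (k + 1) → ZMod 2) (lam : Weight k) (z₁ z₂ : ℂ) (a : Fin (k + 1))
    (b : Fin k) : ℂ :=
  z₂ + (z₁ - z₂) * ∏ r ∈ Finset.Iic b.castSucc,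
    shiftedWeight p lam a r / (sgn (p r) + shiftedWeight p lam a r)

/-- One variable of each colour `b < a` and none of the other colours. -/
def initialColours (a : Fin (k + 1)) : Fin k → ℕ := fun b => if b.castSucc < a then 1 else 0

/-- The explicit solution for the summand of highest weight `lam + ε_a`. -/
def explicitSolution (p : Fin (k + 1) → ZMod 2) (lam : Weight k) (z₁ z₂ : ℂ) (C : Colouring k)
    (a : Fin (k + 1)) : BethePoint k :=
  ⟨initialColours a, fun i => explicitRoot p lam z₁ z₂ a (C.colour (initialColours a) i)⟩

end GaudinGL

end

open scoped TensorProduct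
open GaudinGL

/-!
# Bethe vectors and the Pieri rule for `gl(m|n)`

The proof compares two descriptions of the singular vectors of `ℂ^{m|n} ⊗ V(μ)`.

*Bethe ansatz.* The weight function is a sum over the orderings of the variables, cut into two chains
(`weightFunction_eq_sum_orderings`). A simple raising operator removes one lowering operator of its
colour from a chain (`E_chainVector`). Collecting the terms in which the variable `i` has been
removed and the other variables are left in a given order, the sum over the position of `i` is a
partial fraction identity (`splitSum_chainFactor`), and its value is the left hand side of the Bethe
equation of `t_i`. Hence values of the weight function at regular solutions are singular
(`E_weightFunction_eq_zero`), for any numbers of variables of the different colours.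

*Upper bound.* In an irreducible module, singular weight vectors are multiples of the highest weight
vector (`GLModule.IsHighestWeightVector.mem_span_of_singular`). The coefficient of a singular vector of
`ℂ^{m|n} ⊗ V` at the last `e_a` which occurs in it is singular in `V`, so singular vectors have
weights `λ + ε_a` and each of these weights occurs at most once (`exists_weight_eq_add_eps`,
`mem_span_of_same_weight`). Which `a` are possible is found by odd reflections: in a polynomial module
these do not kill a vector on which the odd coroot is nonzero, and moving `e_a`, or the nearest vector
of the opposite parity before it, through a run of vectors of the other parity gives inequalities
between the coordinates of the weight (`GLModule.IsPolynomial.weight_dominance`,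
`GLModule.IsPolynomial.weight_hook`). These say precisely that a box can be added to `μ` in the row or
column of `e_a` (`exists_addsBox`).

*Lower bound.* If a box belonging to `e_a` can be added, the weight `λ + ε_a` forces one variable of
each colour `b < a`. The Bethe equations then form a chain, which starts at `z₁` and is solved from
its other end (`chain_equations_iff`, `isBetheSolution_iff_chain`). The ratio
`(t_b - z₂) / (t_{b-1} - z₂)` of consecutive distances to `z₂` has the form `N / (N + 1)` with a
positive integer `N` (`AddsBoxAt.exists_shiftedWeight_eq`), so the unique solution has distinct
coordinates, also different from `z₁` and `z₂`. The Bethe vector is not zero because only one of its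
terms contributes to the coefficient of `e_a ⊗ v` (`betheVector_ne_zero`).

Thus there is exactly one Bethe vector for each weight which occurs in the space of singular vectors.
Vectors of distinct weights are linearly independent, and every singular vector is a sum of singular
weight vectors, so that the Bethe vectors form a basis.
-/


noncomputable section

namespace GaudinGL

/-! ### Sums over the splittings of a list -/

section Splittings

variable {α β : Type*} [AddCommMonoid β]

/-- The sum of `f P Q` over all the ways of writing a list as a concatenation `P ++ Q`. -/
def splitSum : (List α → List α → β) → List α → β
  | f, [] => f [] []
  | f, a :: L => f [] (a :: L) + splitSum (fun P Q => f (a :: P) Q) L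

/-- The sum of `f A i B` over all the ways of writing a list as `A ++ i :: B`. -/
def pickSum : (List α → α → List α → β) → List α → β
  | _, [] => 0
  | f, a :: L => f [] a L + pickSum (fun A i B => f (a :: A) i B) L

theorem splitSum_congr : ∀ {f g : List α → List α → β} {L : List α},
    (∀ P Q, P ++ Q = L → f P Q = g P Q) → splitSum f L = splitSum g L
  | _, _, [], h => h [] [] rfl
  | f, g, a :: L, h => by
    rw [splitSum, splitSum, h [] (a :: L) rfl,
      splitSum_congr (f := fun P Q => f (a :: P) Q) (g := fun P Q => g (a :: P) Q)
        fun P Q hPQ => h _ _ (by rw [List.cons_append, hPQ])]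

theorem pickSum_congr : ∀ {f g : List α → α → List α → β} {L : List α},
    (∀ A i B, A ++ i :: B = L → f A i B = g A i B) → pickSum f L = pickSum g L
  | _, _, [], _ => rfl
  | f, g, a :: L, h => by
    rw [pickSum, pickSum, h [] a L rfl,
      pickSum_congr (f := fun A i B => f (a :: A) i B) (g := fun A i B => g (a :: A) i B)
        fun A i B hL => h _ _ _ (by rw [List.cons_append, hL])]

theorem splitSum_add : ∀ (f g : List α → List α → β) (L : List α),
    splitSum (fun P Q => f P Q + g P Q) L = splitSum f L + splitSum g L
  | _, _, [] => rfl
  | f, g, a :: L => by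
    simp only [splitSum]
    rw [splitSum_add (fun P Q => f (a :: P) Q) (fun P Q => g (a :: P) Q)]
    exact add_add_add_comm _ _ _ _

theorem pickSum_add : ∀ (f g : List α → α → List α → β) (L : List α),
    pickSum (fun A i B => f A i B + g A i B) L = pickSum f L + pickSum g L
  | _, _, [] => (add_zero _).symm
  | f, g, a :: L => by
    simp only [pickSum]
    rw [pickSum_add (fun A i B => f (a :: A) i B) (fun A i B => g (a :: A) i B)]
    exact add_add_add_comm _ _ _ _

theorem splitSum_zero : ∀ L : List α, splitSum (fun _ _ => (0 : β)) L = 0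
  | [] => rfl
  | _ :: L => by rw [splitSum, splitSum_zero L, add_zero]

theorem map_splitSum {γ : Type*} [AddCommMonoid γ] (φ : β →+ γ) :
    ∀ (f : List α → List α → β) (L : List α),
      φ (splitSum f L) = splitSum (fun P Q => φ (f P Q)) L
  | _, [] => rfl
  | f, a :: L => by
    simp only [splitSum, map_add]
    rw [map_splitSum φ (fun P Q => f (a :: P) Q)]

theorem map_pickSum {γ : Type*} [AddCommMonoid γ] (φ : β →+ γ) :
    ∀ (f : List α → α → List α → β) (L : List α),
      φ (pickSum f L) = pickSum (fun A i B => φ (f A i B)) L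
  | _, [] => map_zero φ
  | f, a :: L => by
    simp only [pickSum, map_add]
    rw [map_pickSum φ (fun A i B => f (a :: A) i B)]

section Module

variable {α R W₁ W₂ : Type*} [CommSemiring R] [AddCommMonoid W₁] [Module R W₁] [AddCommMonoid W₂]
  [Module R W₂]

theorem smul_splitSum (r : R) (f : List α → List α → W₁) (L : List α) :
    r • splitSum f L = splitSum (fun P Q => r • f P Q) L :=
  map_splitSum (DistribSMul.toAddMonoidHom W₁ r) f L

theorem splitSum_smul (f : List α → List α → R) (w : W₁) (L : List α) :
    splitSum f L • w = splitSum (fun P Q => f P Q • w) L :=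
  map_splitSum (LinearMap.toSpanSingleton R W₁ w).toAddMonoidHom f L

theorem smul_pickSum (r : R) (f : List α → α → List α → W₁) (L : List α) :
    r • pickSum f L = pickSum (fun A i B => r • f A i B) L :=
  map_pickSum (DistribSMul.toAddMonoidHom W₁ r) f L

theorem pickSum_tmul (f : List α → α → List α → W₁) (w : W₂) (L : List α) :
    pickSum f L ⊗ₜ[R] w = pickSum (fun A i B => f A i B ⊗ₜ[R] w) L :=
  map_pickSum ((TensorProduct.mk R W₁ W₂).flip w).toAddMonoidHom f L

theorem tmul_pickSum (w : W₁) (f : List α → α → List α → W₂) (L : List α) :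
    w ⊗ₜ[R] pickSum f L = pickSum (fun A i B => w ⊗ₜ[R] f A i B) L :=
  map_pickSum (TensorProduct.mk R W₁ W₂ w).toAddMonoidHom f L

end Module

/-- Coassociativity: both sides run over the decompositions of a list into three parts. -/
theorem splitSum_assoc : ∀ (f : List α → List α → List α → β) (L : List α),
    splitSum (fun P Q => splitSum (fun A B => f A B Q) P) L
      = splitSum (fun A R => splitSum (fun B Q => f A B Q) R) L
  | _, [] => rfl
  | f, a :: L => by
    simp only [splitSum]
    rw [splitSum_add, splitSum_assoc (fun A B Q => f (a :: A) B Q), add_assoc]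

/-- Cutting a list in two and then picking an element of one of the parts is the same as picking an
element first and then cutting the list on its right or on its left. -/
theorem splitSum_pickSum : ∀ (g₁ : List α → α → List α → List α → β)
    (g₂ : List α → List α → α → List α → β) (L : List α),
    splitSum (fun P Q => pickSum (fun A i B => g₁ A i B Q) P + pickSum (fun A i B => g₂ P A i B) Q) L
      = pickSum (fun A i B => splitSum (fun B' Q => g₁ A i B' Q) B
          + splitSum (fun P A' => g₂ P A' i B) A) L
  | _, _, [] => by simp [splitSum, pickSum]
  | g₁, g₂, a :: L => by
    have ih := splitSum_pickSum (fun A i B Q => g₁ (a :: A) i B Q) (fun P A i B => g₂ (a :: P) A i B) L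
    simp only [splitSum, pickSum, splitSum_add, pickSum_add, zero_add] at ih ⊢
    rw [add_assoc (splitSum _ L), ih]
    abel

theorem splitSum_eq_sum : ∀ (f : List α → List α → β) (L : List α),
    splitSum f L = ∑ q : Fin (L.length + 1), f (L.take q) (L.drop q)
  | f, [] => by simp [splitSum]
  | f, a :: L => by
    rw [splitSum, splitSum_eq_sum (fun P Q => f (a :: P) Q) L]
    exact (Fin.sum_univ_succ (n := L.length + 1) (fun q : Fin (L.length + 1 + 1) =>
      f ((a :: L).take q) ((a :: L).drop q))).symm

theorem pickSum_eq_sum : ∀ (f : List α → α → List α → β) (L : List α),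
    pickSum f L = ∑ q : Fin L.length, f (L.take q) (L.get q) (L.drop (q + 1))
  | f, [] => by simp [pickSum]
  | f, a :: L => by
    rw [pickSum, pickSum_eq_sum (fun A i B => f (a :: A) i B) L]
    exact (Fin.sum_univ_succ (n := L.length) (fun q : Fin (L.length + 1) =>
      f ((a :: L).take q) ((a :: L).get q) ((a :: L).drop (q + 1)))).symm

theorem insertIdx_eq_take_append (i : α) :
    ∀ (L : List α) (j : ℕ), j ≤ L.length → L.insertIdx j i = L.take j ++ i :: L.drop j
  | _, 0, _ => by simp
  | [], j + 1, h => by simp at h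
  | a :: L, j + 1, h => by
    rw [List.insertIdx_succ_cons, insertIdx_eq_take_append i L j (by simpa using h)]
    simp

/-- A sum over the rearrangements `A ++ i :: B` of a list can be grouped according to the pairs
`(i, A ++ B)`. -/
theorem sum_pickSum_eq_zero [DecidableEq α] (S : Finset (List α))
    (hS : ∀ L ∈ S, ∀ L', L'.Perm L → L' ∈ S) (f : List α → α → List α → β)
    (hf : ∀ i L', i :: L' ∈ S → splitSum (fun A B => f A i B) L' = 0) :
    ∑ L ∈ S, pickSum f L = 0 := by
  simp_rw [pickSum_eq_sum]
  rw [Finset.sum_sigma']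
  set T := S.sigma fun L => (Finset.univ : Finset (Fin L.length)) with hT
  let φ : (Σ L : List α, Fin L.length) → α × List α := fun x => (x.1.get x.2, x.1.eraseIdx x.2)
  rw [← Finset.sum_fiberwise_of_maps_to (s := T) (t := T.image φ) (g := φ)
    (fun x hx => Finset.mem_image_of_mem _ hx)]
  refine Finset.sum_eq_zero fun y hy => ?_
  obtain ⟨i, L'⟩ := y
  obtain ⟨⟨L, q⟩, hL, hφ⟩ := Finset.mem_image.1 hy
  have hLS : L ∈ S := by simpa [hT] using hL
  simp only [φ, Prod.mk.injEq] at hφ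
  have hperm : (i :: L').Perm L := by
    rw [← hφ.1, ← hφ.2]
    exact List.getElem_cons_eraseIdx_perm q.2
  have hmem := hS L hLS _ hperm
  rw [← hf i L' hmem, splitSum_eq_sum]
  symm
  refine Finset.sum_bij (fun (j : Fin (L'.length + 1)) _ =>
    (⟨L'.insertIdx j i, ⟨j, by rw [List.length_insertIdx_of_le_length (by omega)]; exact j.2⟩⟩ :
      Σ L : List α, Fin L.length)) ?_ ?_ ?_ ?_
  · intro j _
    simp only [Finset.mem_filter, φ, hT, Finset.mem_sigma, Finset.mem_univ, and_true]
    refine ⟨hS _ hmem _ (List.perm_insertIdx _ _ (by omega)), ?_⟩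
    simp
  · intro j₁ _ j₂ _ h
    rw [Sigma.mk.injEq] at h
    have h2 := h.2
    have h1 := h.1
    apply Fin.ext
    have : ∀ (A B : List α) (x : Fin A.length) (y : Fin B.length), A = B → HEq x y →
        (x : ℕ) = y := by
      rintro A B x y rfl h
      rw [eq_of_heq h]
    exact this _ _ _ _ h1 h2
  · rintro ⟨L₁, q₁⟩ h₁
    simp only [Finset.mem_filter, φ, Prod.mk.injEq] at h₁
    obtain ⟨-, h₁, h₂⟩ := h₁
    have hlen : L'.length + 1 = L₁.length := by
      rw [← h₂, List.length_eraseIdx_of_lt q₁.2]; have := q₁.2; omega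
    refine ⟨⟨q₁, by rw [hlen]; exact q₁.2⟩, Finset.mem_univ _, ?_⟩
    subst h₁ h₂
    have : (L₁.eraseIdx q₁).insertIdx q₁ (L₁.get q₁) = L₁ := by
      rw [List.insertIdx_eraseIdx_self (by have := q₁.2; omega), List.get_eq_getElem,
        List.set_getElem_self]
    apply Sigma.ext this
    rw [Fin.heq_ext_iff]
    exact congrArg List.length this
  · intro j _
    have hj : (j : ℕ) ≤ L'.length := by omega
    have e : L'.insertIdx j i = L'.take j ++ i :: L'.drop j := by
      exact insertIdx_eq_take_append _ _ _ hj
    simp only [e]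
    congr 1
    · rw [List.take_left' (by simpa using hj)]
    · simp
    · rw [List.drop_append]
      simp [hj]

end Splittings

variable {k : ℕ}

/-! ### Signs of reorderings -/

theorem sgn_ne_zero (x : ZMod 2) : sgn x ≠ 0 := by
  intro h
  have := sgn_mul_self x
  rw [h, zero_mul] at this
  exact zero_ne_one this

/-- The sign of the reordering of `(1, …, l)` given by a list, when the operator labelled `x` has
parity `q x`. -/
def listSign {l : ℕ} (q : Fin l → ZMod 2) : List (Fin l) → ℂ
  | [] => 1
  | x :: L => (L.map fun y => if y < x then sgn (q x * q y) else 1).prod * listSign q L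

theorem listSign_ofFn {l : ℕ} (q : Fin l → ZMod 2) :
    ∀ (n : ℕ) (f : Fin n → Fin l), listSign q (List.ofFn f)
      = ∏ i, ∏ j ∈ Finset.univ.filter (fun j => i < j ∧ f j < f i), sgn (q (f i) * q (f j))
  | 0, f => by simp [listSign]
  | n + 1, f => by
    rw [List.ofFn_succ, listSign, listSign_ofFn q n, Fin.prod_univ_succ]
    congr 1
    · rw [Finset.prod_filter, Fin.prod_univ_succ, List.map_ofFn, List.prod_ofFn]
      simp
    · refine Finset.prod_congr rfl fun i _ => ?_
      rw [Finset.prod_filter, Finset.prod_filter, Fin.prod_univ_succ]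
      simp

theorem reorderSign_eq_listSign (p : Fin (k + 1) → ZMod 2) {l : ℕ} (c : Fin l → Fin k)
    (σ : Equiv.Perm (Fin l)) :
    reorderSign p c σ = listSign (fun i => parityF p (c i)) (List.ofFn σ) := by
  rw [listSign_ofFn]
  rfl

/-- Moving the operator `x` to the front of a product of operators costs a sign which compensates
the dependence of `listSign` on the position of `x`. -/
theorem listSign_insert {l : ℕ} (q : Fin l → ZMod 2) (x : Fin l) (B : List (Fin l)) :
    ∀ A : List (Fin l), x ∉ A →
      listSign q (A ++ x :: B) * sgn (q x * (A.map q).sum) =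
        listSign q (A ++ B) * ((A ++ B).map fun y => if y < x then sgn (q x * q y) else 1).prod
  | [], _ => by simp [listSign, sgn_zero, mul_comm]
  | a :: A, h => by
    rw [List.mem_cons, not_or] at h
    have ih := listSign_insert q x B A h.2
    have key : (if x < a then sgn (q a * q x) else 1) * sgn (q x * q a)
        = if a < x then sgn (q x * q a) else 1 := by
      rcases lt_or_gt_of_ne h.1 with hlt | hlt
      · rw [if_pos hlt, if_neg hlt.asymm, mul_comm (q a), sgn_mul_self]
      · rw [if_neg hlt.asymm, if_pos hlt, one_mul]
    simp only [List.cons_append, listSign, List.map_append, List.map_cons, List.prod_append,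
      List.prod_cons, List.sum_cons, mul_add, sgn_add] at ih ⊢
    rw [← key]
    linear_combination ((A.map fun y => if y < a then sgn (q a * q y) else 1).prod
      * (B.map fun y => if y < a then sgn (q a * q y) else 1).prod
      * (if x < a then sgn (q a * q x) else 1) * sgn (q x * q a)) * ih

/-! ### Partial fractions -/

/-- Summation over the position at which a variable is inserted into a chain. -/
theorem splitSum_chainFactor {α : Type*} (t a : α → ℂ) (z H : ℂ) (i : α) (hz : t i ≠ z) :
    ∀ L : List α, (∀ j ∈ L, t i ≠ t j) → (L.map t).Nodup → (∀ j ∈ L, t j ≠ z) →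
      splitSum (fun A B => (H - (B.map a).sum) * chainFactor z ((A ++ i :: B).map t)) L
        = chainFactor z (L.map t) * (H / (t i - z) - (L.map fun j => a j / (t i - t j)).sum)
  | [], _, _, _ => by simp [splitSum, chainFactor, div_eq_mul_inv]
  | [j], h, _, hz' => by
    have h1 : t i - t j ≠ 0 := sub_ne_zero.2 (h j (by simp))
    have h1' : t j - t i ≠ 0 := sub_ne_zero.2 (h j (by simp)).symm
    have h2 : t j - z ≠ 0 := sub_ne_zero.2 (hz' j (by simp))
    have h3 : t i - z ≠ 0 := sub_ne_zero.2 hz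
    have h4 : t j - t i = -(t i - t j) := by ring
    simp only [splitSum, List.map_cons, List.map_nil, List.sum_cons, List.sum_nil, List.nil_append,
      List.cons_append, chainFactor, h4]
    field_simp
    ring
  | j :: j' :: L, h, hn, hz' => by
    have ih := splitSum_chainFactor t a z H i hz (j' :: L) (fun x hx => h x (by simp_all))
      (by simp only [List.map_cons, List.nodup_cons] at hn ⊢; exact hn.2)
      (fun x hx => hz' x (by simp_all))
    have h1 : t i - t j ≠ 0 := sub_ne_zero.2 (h j (by simp))
    have h2 : t i - t j' ≠ 0 := sub_ne_zero.2 (h j' (by simp))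
    have h3 : t j - t j' ≠ 0 := by
      intro h0
      rw [sub_eq_zero] at h0
      simp [h0] at hn
    have h4 : t j - t i = -(t i - t j) := by ring
    -- The chains beginning with `j, j'` are proportional to those beginning with `j'`.
    have hR : splitSum (fun A B => (H - (B.map a).sum)
          * chainFactor z ((j :: j' :: A ++ i :: B).map t)) L
        = (t j - t j')⁻¹ * splitSum (fun A B => (H - (B.map a).sum)
          * chainFactor z ((j' :: A ++ i :: B).map t)) L := by
      have := map_splitSum (AddMonoidHom.mulLeft (t j - t j')⁻¹)
        (fun A B => (H - (B.map a).sum) * chainFactor z ((j' :: A ++ i :: B).map t)) L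
      simp only [AddMonoidHom.coe_mulLeft] at this
      rw [this]
      refine splitSum_congr fun A B _ => ?_
      simp only [List.cons_append, List.map_cons, chainFactor]
      ring
    simp only [splitSum] at ih ⊢
    rw [hR]
    rw [← eq_sub_iff_add_eq'] at ih
    rw [ih]
    simp only [List.map_cons, List.sum_cons, List.nil_append, List.cons_append, chainFactor, h4]
    have e : t j - t j' = (t i - t j') - (t i - t j) := by ring
    generalize t i - t j = u at *
    generalize t i - t j' = w at *
    generalize t i - z = s at *
    generalize chainFactor z (t j' :: List.map t L) = X
    generalize (List.map a L).sum = Y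
    generalize (List.map (fun j => a j / (t i - t j)) L).sum = Z
    generalize H / s = H'
    rw [e] at h3 ⊢
    field_simp
    ring

/-! ### The raising operators on the vectors `F_{c(1)} ⋯ F_{c(j)} v` -/

/-- The value of the weight `ν` on the coroot `[E_{b,b+1}, E_{b+1,b}]`. -/
def coroot (p : Fin (k + 1) → ZMod 2) (b : Fin k) : Weight k →ₗ[ℂ] ℂ :=
  LinearMap.proj b.castSucc - sgn (parityF p b) • LinearMap.proj b.succ

theorem coroot_apply (p : Fin (k + 1) → ZMod 2) (b : Fin k) (ν : Weight k) :
    coroot p b ν = ν b.castSucc - sgn (parityF p b) * ν b.succ := by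
  simp [coroot]

theorem form_simpleRoot (p : Fin (k + 1) → ZMod 2) (b : Fin k) (ν : Weight k) :
    form p (simpleRoot b) ν = sgn (p b.castSucc) * ν b.castSucc - sgn (p b.succ) * ν b.succ := by
  simp only [form, simpleRoot, eps, Pi.sub_apply, mul_sub, sub_mul, Finset.sum_sub_distrib,
    Pi.single_apply]
  simp

theorem form_simpleRoot_eq_coroot (p : Fin (k + 1) → ZMod 2) (b : Fin k) (ν : Weight k) :
    form p (simpleRoot b) ν = sgn (p b.castSucc) * coroot p b ν := by
  rw [form_simpleRoot, coroot_apply, parityF, sgn_add]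
  linear_combination (sgn (p b.succ) * ν b.succ) * sgn_mul_self (p b.castSucc)

namespace GLModule

variable {p : Fin (k + 1) → ZMod 2} {V : Type*} [AddCommGroup V] [Module ℂ V]

theorem mem_weightSpace {M : GLModule p V} {ν : Weight k} {x : V} :
    x ∈ M.weightSpace ν ↔ ∀ a, M.E a a x = ν a • x := by
  simp [weightSpace, Submodule.mem_iInf, sub_eq_zero]

theorem mem_singular {M : GLModule p V} {x : V} :
    x ∈ M.singular ↔ ∀ a b, a < b → M.E a b x = 0 := by
  simp [singular, Submodule.mem_iInf]

theorem bracket_apply (M : GLModule p V) (a b c d : Fin (k + 1)) (x : V) :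
    M.E a b (M.E c d x) = sgn ((p a + p b) * (p c + p d)) • M.E c d (M.E a b x)
      + ((if b = c then M.E a d x else 0)
        - sgn ((p a + p b) * (p c + p d)) • (if a = d then M.E c b x else 0)) := by
  have h := congrArg (fun f => f x) (M.bracket a b c d)
  simp only [LinearMap.sub_apply, LinearMap.smul_apply, Module.End.mul_apply] at h
  rw [← sub_eq_iff_eq_add', h]
  split_ifs <;> simp

theorem E_mem_weightSpace (M : GLModule p V) {ν : Weight k} {x : V} (hx : x ∈ M.weightSpace ν)
    (a b : Fin (k + 1)) : M.E a b x ∈ M.weightSpace (ν + eps a - eps b) := by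
  rw [mem_weightSpace] at hx ⊢
  intro c
  have h0 : p c + p c = 0 := CharTwo.add_self_eq_zero _
  rw [M.bracket_apply, h0, zero_mul, sgn_zero, hx, map_smul]
  simp only [eps, Pi.add_apply, Pi.sub_apply, Pi.single_apply]
  by_cases h1 : c = a <;> by_cases h2 : c = b
  · subst h1 h2; simp
  · subst h1; simp [h2]; module
  · subst h2; simp [h1]; module
  · simp [h1, h2]

theorem parity_E (M : GLModule p V) (a b : Fin (k + 1)) (x : V) :
    M.parity (M.E a b x) = sgn (p a + p b) • M.E a b (M.parity x) := by
  have h := congrArg (fun f => f x) (M.E_parity a b)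
  simp only [LinearMap.smul_apply, Module.End.mul_apply] at h
  rw [h, smul_smul, sgn_mul_self, one_smul]

end GLModule

section ChainVector

variable {p : Fin (k + 1) → ZMod 2} {V : Type*} [AddCommGroup V] [Module ℂ V]

theorem chainVector_cons (M : GLModule p V) (v : V) {l : ℕ} (c : Fin l → Fin k) (i : Fin l)
    (L : List (Fin l)) : chainVector M v c (i :: L) = M.F (c i) (chainVector M v c L) := by
  simp [chainVector]

theorem chainVector_mem_weightSpace (M : GLModule p V) {v : V} {ν : Weight k}
    (hv : v ∈ M.weightSpace ν) {l : ℕ} (c : Fin l → Fin k) : ∀ L : List (Fin l),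
      chainVector M v c L ∈ M.weightSpace (ν - (L.map fun i => simpleRoot (c i)).sum)
  | [] => by simpa [chainVector] using hv
  | i :: L => by
    have := M.E_mem_weightSpace (chainVector_mem_weightSpace M hv c L) (c i).succ (c i).castSucc
    rw [chainVector_cons, List.map_cons, List.sum_cons, simpleRoot, GLModule.F]
    convert this using 2
    abel

theorem parity_chainVector (M : GLModule p V) {v : V} {s : ℂ} (hv : M.parity v = s • v)
    {l : ℕ} (c : Fin l → Fin k) : ∀ L : List (Fin l),
      M.parity (chainVector M v c L)
        = (sgn (L.map fun i => parityF p (c i)).sum * s) • chainVector M v c L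
  | [] => by simpa [chainVector, sgn_zero] using hv
  | i :: L => by
    rw [chainVector_cons, GLModule.F, M.parity_E, parity_chainVector M hv c L, map_smul, smul_smul,
      List.map_cons, List.sum_cons, sgn_add (parityF p (c i)), parityF, add_comm (p (c i).succ)]
    ring_nf

/-- A simple raising operator removes, in turn, each of the lowering operators of its colour. -/
theorem E_chainVector (M : GLModule p V) {v : V} {ν : Weight k} (hv : v ∈ M.weightSpace ν)
    (hs : v ∈ M.singular) {l : ℕ} (c : Fin l → Fin k) (b : Fin k) : ∀ L : List (Fin l),
      M.E b.castSucc b.succ (chainVector M v c L) = pickSum (fun A i B =>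
        ((if c i = b then sgn (parityF p b * (A.map fun j => parityF p (c j)).sum) else 0)
          * (coroot p b ν - (B.map fun j => coroot p b (simpleRoot (c j))).sum))
            • chainVector M v c (A ++ B)) L
  | [] => by
    simpa [pickSum, chainVector] using GLModule.mem_singular.1 hs _ _ (Fin.castSucc_lt_succ)
  | i :: L => by
    rw [chainVector_cons, GLModule.F, M.bracket_apply, E_chainVector M hv hs c b L, pickSum, add_comm]
    have hp1 : p b.castSucc + p b.succ = parityF p b := rfl
    have hp2 : p (c i).succ + p (c i).castSucc = parityF p (c i) := by rw [add_comm, parityF]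
    rw [hp1, hp2]
    congr 1
    · have hw := chainVector_mem_weightSpace M hv c L
      rw [GLModule.mem_weightSpace] at hw
      by_cases hb : c i = b
      · subst hb
        have hsq : parityF p (c i) * parityF p (c i) = parityF p (c i) := by
          rcases zmod_two_cases (parityF p (c i)) with h | h <;> simp [h]
        have hsum : ∀ a, (L.map fun i => simpleRoot (c i)).sum a
            = (L.map fun i => simpleRoot (c i) a).sum := by
          intro a
          have := map_list_sum (Pi.evalAddMonoidHom (fun _ : Fin (k + 1) => ℂ) a)
            (L.map fun i => simpleRoot (c i))
          simpa [Function.comp_def] using this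
        have hco : (L.map fun j => coroot p (c i) (simpleRoot (c j))).sum
            = coroot p (c i) (L.map fun j => simpleRoot (c j)).sum := by
          rw [map_list_sum, List.map_map]; rfl
        simp only [if_true, hw, hsq, List.map_nil, List.sum_nil, mul_zero, sgn_zero, one_mul,
          List.nil_append]
        rw [hco, ← map_sub, coroot_apply, smul_smul, sub_smul]
      · have hb' : ¬ b = c i := fun h => hb h.symm
        simp [hb, hb', Fin.succ_inj, Fin.castSucc_inj]
    · rw [← LinearMap.smul_apply]
      have := map_pickSum
        ((sgn (parityF p b * parityF p (c i)) • M.E (c i).succ (c i).castSucc).toAddMonoidHom)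
        (fun A i B =>
        ((if c i = b then sgn (parityF p b * (A.map fun j => parityF p (c j)).sum) else 0)
          * (coroot p b ν - (B.map fun j => coroot p b (simpleRoot (c j))).sum))
            • chainVector M v c (A ++ B)) L
      refine Eq.trans this (pickSum_congr fun A j B _ => ?_)
      simp only [LinearMap.toAddMonoidHom_coe, LinearMap.smul_apply, map_smul, List.cons_append,
        chainVector_cons, List.map_cons, List.sum_cons, mul_add, sgn_add, smul_smul]
      congr 1
      split_ifs <;> ring

end ChainVector

/-! ### The Bethe ansatz -/

section Bethe

variable {p : Fin (k + 1) → ZMod 2} {V₁ V₂ : Type*} [AddCommGroup V₁] [Module ℂ V₁]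
    [AddCommGroup V₂] [Module ℂ V₂]

/-- The lists without repetitions which enumerate `Fin l`. -/
def orderings (l : ℕ) : Finset (List (Fin l)) :=
  Finset.univ.image fun σ : Equiv.Perm (Fin l) => List.ofFn σ

theorem mem_orderings {l : ℕ} {L : List (Fin l)} :
    L ∈ orderings l ↔ L.Perm (List.finRange l) := by
  rw [orderings, Finset.mem_image]
  constructor
  · rintro ⟨σ, -, rfl⟩
    refine (List.perm_ext_iff_of_nodup (List.nodup_ofFn.2 σ.injective) (List.nodup_finRange l)).2
      fun a => ?_
    simpa [List.mem_ofFn] using σ.surjective a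
  · intro h
    have hlen : L.length = l := by simpa using h.length_eq
    have hn : L.Nodup := h.nodup_iff.2 (List.nodup_finRange l)
    let f : Fin l → Fin l := fun i => L.get (Fin.cast hlen.symm i)
    have hf : Function.Injective f :=
      (List.nodup_iff_injective_get.1 hn).comp (Fin.cast_injective _)
    refine ⟨Equiv.ofBijective f (Finite.injective_iff_bijective.1 hf), Finset.mem_univ _, ?_⟩
    refine List.ext_get (by simpa using hlen.symm) fun n h1 h2 => ?_
    simp [f]

/-- The contribution of one reordering of the variables to the weight function, up to sign. -/
def orderingVector (M₁ : GLModule p V₁) (M₂ : GLModule p V₂) (v₁ : V₁) (v₂ : V₂) (z₁ z₂ : ℂ) {l : ℕ}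
    (c : Fin l → Fin k) (t : Fin l → ℂ) : List (Fin l) → V₁ ⊗[ℂ] V₂ :=
  splitSum fun P Q => (chainFactor z₁ (P.map t) * chainFactor z₂ (Q.map t)) •
    (chainVector M₁ v₁ c P ⊗ₜ[ℂ] chainVector M₂ v₂ c Q)

theorem weightFunction_eq_sum_orderings (M₁ : GLModule p V₁) (M₂ : GLModule p V₂) (v₁ : V₁) (v₂ : V₂)
    (z₁ z₂ : ℂ) {l : ℕ} (c : Fin l → Fin k) (t : Fin l → ℂ) :
    weightFunction M₁ M₂ v₁ v₂ z₁ z₂ c t = ∑ L ∈ orderings l,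
      listSign (fun i => parityF p (c i)) L • orderingVector M₁ M₂ v₁ v₂ z₁ z₂ c t L := by
  rw [orderings, Finset.sum_image fun σ _ τ _ h => Equiv.ext (congrFun (List.ofFn_injective h)),
    weightFunction, Finset.sum_comm]
  refine Finset.sum_congr rfl fun σ _ => ?_
  rw [orderingVector, splitSum_eq_sum, Finset.smul_sum, ← reorderSign_eq_listSign]
  have hlen : (List.ofFn σ).length + 1 = l + 1 := by simp
  refine (Fintype.sum_equiv (finCongr hlen) _ _ fun q => ?_).symm
  rw [smul_smul]
  rfl

theorem tensor_E_apply (M₁ : GLModule p V₁) (M₂ : GLModule p V₂) (a b : Fin (k + 1)) (x : V₁)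
    (y : V₂) : (M₁.tensor M₂).E a b (x ⊗ₜ y)
      = M₁.E a b x ⊗ₜ y + (M₁.parity ^ (p a + p b).val) x ⊗ₜ M₂.E a b y := by
  simp [GLModule.tensor]

theorem parity_pow_chainVector (M : GLModule p V₁) {v : V₁} (hv : M.parity v = v) {l : ℕ}
    (c : Fin l → Fin k) (x : ZMod 2) (L : List (Fin l)) :
    (M.parity ^ x.val) (chainVector M v c L)
      = sgn (x * (L.map fun i => parityF p (c i)).sum) • chainVector M v c L := by
  rcases zmod_two_cases x with rfl | rfl
  · simp [sgn_zero]
  · have h1 : (1 : ZMod 2).val = 1 := rfl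
    rw [h1, pow_one, parity_chainVector M (s := 1) (by rwa [one_smul]), mul_one, one_mul]

/-- The action of a simple raising operator on the term of an ordering, arranged by the lowering
operator `i` which it removes: `i` lies either in the first chain `A ++ i :: B'` or in the second
chain `A' ++ i :: B`. -/
theorem E_orderingVector (M₁ : GLModule p V₁) (M₂ : GLModule p V₂) {v₁ : V₁} {v₂ : V₂}
    {ν₁ ν₂ : Weight k} (hw₁ : v₁ ∈ M₁.weightSpace ν₁) (hs₁ : v₁ ∈ M₁.singular)
    (hp₁ : M₁.parity v₁ = v₁) (hw₂ : v₂ ∈ M₂.weightSpace ν₂) (hs₂ : v₂ ∈ M₂.singular)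
    (z₁ z₂ : ℂ) {l : ℕ} (c : Fin l → Fin k) (t : Fin l → ℂ) (b : Fin k) (L : List (Fin l)) :
    (M₁.tensor M₂).E b.castSucc b.succ (orderingVector M₁ M₂ v₁ v₂ z₁ z₂ c t L) =
      pickSum (fun A i B =>
        (if c i = b then sgn (parityF p b * (A.map fun j => parityF p (c j)).sum) else 0) •
        (splitSum (fun B' Q =>
          (chainFactor z₂ (Q.map t) *
            ((coroot p b ν₁ - (B'.map fun j => coroot p b (simpleRoot (c j))).sum)
              * chainFactor z₁ ((A ++ i :: B').map t)))
            • (chainVector M₁ v₁ c (A ++ B') ⊗ₜ[ℂ] chainVector M₂ v₂ c Q)) B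
        + splitSum (fun P A' =>
          (chainFactor z₁ (P.map t) *
            ((coroot p b ν₂ - (B.map fun j => coroot p b (simpleRoot (c j))).sum)
              * chainFactor z₂ ((A' ++ i :: B).map t)))
            • (chainVector M₁ v₁ c P ⊗ₜ[ℂ] chainVector M₂ v₂ c (A' ++ B))) A)) L := by
  set par : List (Fin l) → ZMod 2 := fun A => (A.map fun j => parityF p (c j)).sum with hpar
  set G₁ : List (Fin l) → Fin l → List (Fin l) → List (Fin l) → V₁ ⊗[ℂ] V₂ := fun A i B Q =>
    ((if c i = b then sgn (parityF p b * par A) else 0) * (chainFactor z₂ (Q.map t) *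
      ((coroot p b ν₁ - (B.map fun j => coroot p b (simpleRoot (c j))).sum)
        * chainFactor z₁ ((A ++ i :: B).map t))))
      • (chainVector M₁ v₁ c (A ++ B) ⊗ₜ[ℂ] chainVector M₂ v₂ c Q) with hG₁
  set G₂ : List (Fin l) → List (Fin l) → Fin l → List (Fin l) → V₁ ⊗[ℂ] V₂ := fun P A i B =>
    ((if c i = b then sgn (parityF p b * par (P ++ A)) else 0) * (chainFactor z₁ (P.map t) *
      ((coroot p b ν₂ - (B.map fun j => coroot p b (simpleRoot (c j))).sum)
        * chainFactor z₂ ((A ++ i :: B).map t))))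
      • (chainVector M₁ v₁ c P ⊗ₜ[ℂ] chainVector M₂ v₂ c (A ++ B)) with hG₂
  have h := map_splitSum ((M₁.tensor M₂).E b.castSucc b.succ).toAddMonoidHom
    (fun P Q => (chainFactor z₁ (P.map t) * chainFactor z₂ (Q.map t)) •
      (chainVector M₁ v₁ c P ⊗ₜ[ℂ] chainVector M₂ v₂ c Q)) L
  rw [orderingVector]
  refine Eq.trans h ?_
  have h2 : splitSum (fun P Q => ((M₁.tensor M₂).E b.castSucc b.succ).toAddMonoidHom
      ((chainFactor z₁ (P.map t) * chainFactor z₂ (Q.map t)) •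
      (chainVector M₁ v₁ c P ⊗ₜ[ℂ] chainVector M₂ v₂ c Q))) L
      = splitSum (fun P Q => pickSum (fun A i B => G₁ A i B Q) P
          + pickSum (fun A i B => G₂ P A i B) Q) L := by
    refine splitSum_congr fun P Q _ => ?_
    rw [LinearMap.toAddMonoidHom_coe, map_smul, tensor_E_apply, smul_add,
      E_chainVector M₁ hw₁ hs₁, E_chainVector M₂ hw₂ hs₂, parity_pow_chainVector M₁ hp₁]
    congr 1
    · rw [pickSum_tmul, smul_pickSum]
      refine pickSum_congr fun A i B hP => ?_
      simp only [hG₁, hpar, TensorProduct.smul_tmul', smul_smul, hP]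
      congr 2
      ring
    · rw [tmul_pickSum, smul_pickSum]
      refine pickSum_congr fun A i B hQ => ?_
      have hb : p b.castSucc + p b.succ = parityF p b := rfl
      have hPA : sgn (parityF p b * par (P ++ A))
          = sgn (parityF p b * par P) * sgn (parityF p b * par A) := by
        rw [← sgn_add, ← mul_add]
        simp [hpar]
      simp only [hG₂]
      rw [hQ, hPA, hb]
      simp only [hpar, TensorProduct.smul_tmul', TensorProduct.tmul_smul, smul_smul]
      congr 2
      split_ifs <;> ring
  rw [h2, splitSum_pickSum]
  refine pickSum_congr fun A i B _ => ?_
  rw [smul_add]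
  congr 1
  · rw [smul_splitSum]
    refine splitSum_congr fun P Q _ => ?_
    rw [smul_smul]
  · rw [smul_splitSum]
    refine splitSum_congr fun P Q hPQ => ?_
    rw [smul_smul, ← hPQ]

/-- The Bethe ansatz: at a solution of the Bethe equations the weight function takes a value which
is annihilated by the simple raising operators. -/
theorem E_weightFunction_eq_zero (M₁ : GLModule p V₁) (M₂ : GLModule p V₂) {v₁ : V₁} {v₂ : V₂}
    {ν₁ ν₂ : Weight k} (hw₁ : v₁ ∈ M₁.weightSpace ν₁) (hs₁ : v₁ ∈ M₁.singular)
    (hp₁ : M₁.parity v₁ = v₁) (hw₂ : v₂ ∈ M₂.weightSpace ν₂) (hs₂ : v₂ ∈ M₂.singular)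
    {z₁ z₂ : ℂ} {l : ℕ} {c : Fin l → Fin k} {t : Fin l → ℂ}
    (ht : IsBetheSolution p ![ν₁, ν₂] ![z₁, z₂] c t) (hreg : IsRegular ![z₁, z₂] t) (b : Fin k) :
    (M₁.tensor M₂).E b.castSucc b.succ (weightFunction M₁ M₂ v₁ v₂ z₁ z₂ c t) = 0 := by
  have hz₁ : ∀ i, t i ≠ z₁ := fun i => by simpa using hreg.2 i 0
  have hz₂ : ∀ i, t i ≠ z₂ := fun i => by simpa using hreg.2 i 1
  rw [weightFunction_eq_sum_orderings, map_sum]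
  simp only [map_smul, E_orderingVector M₁ M₂ hw₁ hs₁ hp₁ hw₂ hs₂, smul_pickSum]
  have hmove : ∀ (f : List (Fin l) → Fin l → List (Fin l) → V₁ ⊗[ℂ] V₂) (L : List (Fin l)),
      pickSum (fun A i B => listSign (fun i => parityF p (c i)) L • f A i B) L
        = pickSum (fun A i B => listSign (fun i => parityF p (c i)) (A ++ i :: B) • f A i B) L :=
    fun f L => pickSum_congr fun A i B hL => by rw [hL]
  simp only [hmove]
  apply sum_pickSum_eq_zero
  · intro L hL L' h
    rw [mem_orderings] at hL ⊢
    exact h.trans hL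
  intro i L' hL'
  rw [mem_orderings] at hL'
  have hnd : (i :: L').Nodup := hL'.nodup_iff.2 (List.nodup_finRange l)
  have hne : ∀ j ∈ L', t i ≠ t j := fun j hj h => by
    rw [List.nodup_cons] at hnd
    rw [hreg.1 h] at hnd
    exact hnd.1 hj
  -- The coefficient of each rearrangement of the remaining variables is a Bethe equation.
  by_cases hb : c i = b
  swap
  · simp only [if_neg hb, zero_smul, smul_zero]
    exact splitSum_zero L'
  set q : Fin l → ZMod 2 := fun j => parityF p (c j) with hq
  have hbq : parityF p b = q i := by rw [hq, ← hb]
  set a : Fin l → ℂ := fun j => coroot p b (simpleRoot (c j)) with ha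
  have hsign := fun (A B : List (Fin l)) (hAB : A ++ B = L') =>
    listSign_insert q i B A fun hi => by
      rw [List.nodup_cons, ← hAB] at hnd
      exact hnd.1 (List.mem_append_left _ hi)
  set X : List (Fin l) → List (Fin l) → List (Fin l) → V₁ ⊗[ℂ] V₂ := fun A B Q =>
    (chainFactor z₂ (Q.map t) *
      ((coroot p b ν₁ - (B.map a).sum) * chainFactor z₁ ((A ++ i :: B).map t)))
      • (chainVector M₁ v₁ c (A ++ B) ⊗ₜ[ℂ] chainVector M₂ v₂ c Q) with hX
  set Y : List (Fin l) → List (Fin l) → List (Fin l) → V₁ ⊗[ℂ] V₂ := fun P A B =>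
    (chainFactor z₁ (P.map t) *
      ((coroot p b ν₂ - (B.map a).sum) * chainFactor z₂ ((A ++ i :: B).map t)))
      • (chainVector M₁ v₁ c P ⊗ₜ[ℂ] chainVector M₂ v₂ c (A ++ B)) with hY
  have hcongr : splitSum (fun A B => listSign q (A ++ i :: B) •
      (if c i = b then sgn (parityF p b * (A.map q).sum) else 0) •
        (splitSum (fun B' Q => X A B' Q) B + splitSum (fun P A' => Y P A' B) A)) L'
      = splitSum (fun A B =>
        (listSign q L' * (L'.map fun y => if y < i then sgn (q i * q y) else 1).prod) •
        (splitSum (fun B' Q => X A B' Q) B + splitSum (fun P A' => Y P A' B) A)) L' := by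
    refine splitSum_congr fun A B hAB => ?_
    rw [if_pos hb, smul_smul, hbq, hsign A B hAB, hAB]
  refine hcongr.trans ?_
  rw [← smul_splitSum, splitSum_add, ← splitSum_assoc X, splitSum_assoc Y, ← splitSum_add]
  have hterm : ∀ P Q, P ++ Q = L' →
      splitSum (fun A B => X A B Q) P + splitSum (fun A B => Y P A B) Q = 0 := by
    intro P Q hPQ
    have hndL : L'.Nodup := (List.nodup_cons.1 hnd).2
    have hndP : P.Nodup := by
      rw [← hPQ] at hndL
      exact hndL.of_append_left
    have hndQ : Q.Nodup := by
      rw [← hPQ] at hndL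
      exact hndL.of_append_right
    have h₁ := splitSum_chainFactor t a z₁ (coroot p b ν₁) i (hz₁ i) P
      (fun j hj => hne j (hPQ ▸ List.mem_append_left _ hj)) (hndP.map hreg.1) (fun j _ => hz₁ j)
    have h₂ := splitSum_chainFactor t a z₂ (coroot p b ν₂) i (hz₂ i) Q
      (fun j hj => hne j (hPQ ▸ List.mem_append_right _ hj)) (hndQ.map hreg.1) (fun j _ => hz₂ j)
    have hX' : splitSum (fun A B => X A B Q) P = (chainFactor z₂ (Q.map t) *
        splitSum (fun A B => (coroot p b ν₁ - (B.map a).sum)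
          * chainFactor z₁ ((A ++ i :: B).map t)) P)
        • (chainVector M₁ v₁ c P ⊗ₜ[ℂ] chainVector M₂ v₂ c Q) := by
      rw [← smul_eq_mul, smul_splitSum, splitSum_smul]
      refine splitSum_congr fun A B hAB => ?_
      rw [hX, ← hAB, smul_eq_mul]
    have hY' : splitSum (fun A B => Y P A B) Q = (chainFactor z₁ (P.map t) *
        splitSum (fun A B => (coroot p b ν₂ - (B.map a).sum)
          * chainFactor z₂ ((A ++ i :: B).map t)) Q)
        • (chainVector M₁ v₁ c P ⊗ₜ[ℂ] chainVector M₂ v₂ c Q) := by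
      rw [← smul_eq_mul, smul_splitSum, splitSum_smul]
      refine splitSum_congr fun A B hAB => ?_
      rw [hY, ← hAB, smul_eq_mul]
    have hsum : (P.map fun j => a j / (t i - t j)).sum + (Q.map fun j => a j / (t i - t j)).sum
        = ∑ j ∈ Finset.univ.erase i, a j / (t i - t j) := by
      rw [← List.sum_append, ← List.map_append, hPQ]
      have hS : (L'.map fun j => a j / (t i - t j)).sum
          = ∑ j ∈ L'.toFinset, a j / (t i - t j) := (List.sum_toFinset _ hndL).symm
      rw [hS]
      congr 1
      ext j
      have hmem : j ∈ i :: L' := hL'.mem_iff.2 (List.mem_finRange j)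
      rw [List.mem_toFinset, Finset.mem_erase]
      constructor
      · intro hj
        exact ⟨fun h => hne j hj (by rw [h]), Finset.mem_univ _⟩
      · rintro ⟨hj, -⟩
        exact (List.mem_cons.1 hmem).resolve_left hj
    have hbethe := ht.equation i
    rw [Fin.sum_univ_two] at hbethe
    simp only [Matrix.cons_val_zero, Matrix.cons_val_one, form_simpleRoot_eq_coroot, hb,
      mul_div_assoc, ← mul_add, ← Finset.mul_sum] at hbethe
    have hbethe' : coroot p b ν₁ / (t i - z₁) + coroot p b ν₂ / (t i - z₂)
        - ∑ j ∈ Finset.univ.erase i, a j / (t i - t j) = 0 := by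
      refine (mul_eq_zero.1 ?_).resolve_left (sgn_ne_zero (p b.castSucc))
      simp only [ha]
      linear_combination -hbethe
    rw [hX', hY', h₁, h₂, ← add_smul]
    rw [← hsum] at hbethe'
    have : chainFactor z₂ (Q.map t) * (chainFactor z₁ (P.map t) * (coroot p b ν₁ / (t i - z₁)
        - (P.map fun j => a j / (t i - t j)).sum)) + chainFactor z₁ (P.map t) *
        (chainFactor z₂ (Q.map t) * (coroot p b ν₂ / (t i - z₂)
        - (Q.map fun j => a j / (t i - t j)).sum)) = 0 := by
      linear_combination (chainFactor z₂ (Q.map t) * chainFactor z₁ (P.map t)) * hbethe'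
    rw [this, zero_smul]
  rw [splitSum_congr hterm, splitSum_zero, smul_zero]

theorem weightFunction_mem_weightSpace (M₁ : GLModule p V₁) (M₂ : GLModule p V₂) {v₁ : V₁} {v₂ : V₂}
    {ν₁ ν₂ : Weight k} (hw₁ : v₁ ∈ M₁.weightSpace ν₁) (hw₂ : v₂ ∈ M₂.weightSpace ν₂)
    (z₁ z₂ : ℂ) {l : ℕ} (c : Fin l → Fin k) (t : Fin l → ℂ) :
    weightFunction M₁ M₂ v₁ v₂ z₁ z₂ c t
      ∈ (M₁.tensor M₂).weightSpace (ν₁ + ν₂ - ∑ i, simpleRoot (c i)) := by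
  refine Submodule.sum_mem _ fun q _ => Submodule.sum_mem _ fun σ _ => Submodule.smul_mem _ _ ?_
  have h₁ := GLModule.mem_weightSpace.1
    (chainVector_mem_weightSpace M₁ hw₁ c ((List.ofFn σ).take q))
  have h₂ := GLModule.mem_weightSpace.1
    (chainVector_mem_weightSpace M₂ hw₂ c ((List.ofFn σ).drop q))
  rw [GLModule.mem_weightSpace]
  intro a
  have h0 : p a + p a = 0 := CharTwo.add_self_eq_zero _
  have hsum : ∑ i, simpleRoot (c i) = (((List.ofFn σ).take q).map fun i => simpleRoot (c i)).sum
      + (((List.ofFn σ).drop q).map fun i => simpleRoot (c i)).sum := by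
    rw [← List.sum_append, ← List.map_append, List.take_append_drop, List.map_ofFn, List.sum_ofFn]
    exact (Equiv.sum_comp σ fun i => simpleRoot (c i)).symm
  rw [tensor_E_apply, h₁, h₂, h0, hsum]
  simp only [ZMod.val_zero, pow_zero, Module.End.one_apply, TensorProduct.tmul_smul,
    ← TensorProduct.smul_tmul', ← add_smul]
  congr 1
  simp only [Pi.sub_apply, Pi.add_apply]
  ring

theorem parity_weightFunction (M₁ : GLModule p V₁) (M₂ : GLModule p V₂) {v₁ : V₁} {v₂ : V₂}
    {s₁ s₂ : ℂ} (hp₁ : M₁.parity v₁ = s₁ • v₁) (hp₂ : M₂.parity v₂ = s₂ • v₂)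
    (z₁ z₂ : ℂ) {l : ℕ} (c : Fin l → Fin k) (t : Fin l → ℂ) :
    (M₁.tensor M₂).parity (weightFunction M₁ M₂ v₁ v₂ z₁ z₂ c t)
      = (sgn (∑ i, parityF p (c i)) * (s₁ * s₂)) • weightFunction M₁ M₂ v₁ v₂ z₁ z₂ c t := by
  simp only [weightFunction, map_sum, Finset.smul_sum, map_smul]
  refine Finset.sum_congr rfl fun q _ => Finset.sum_congr rfl fun σ _ => ?_
  have hsum : ∑ i, parityF p (c i) = (((List.ofFn σ).take q).map fun i => parityF p (c i)).sum
      + (((List.ofFn σ).drop q).map fun i => parityF p (c i)).sum := by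
    rw [← List.sum_append, ← List.map_append, List.take_append_drop, List.map_ofFn, List.sum_ofFn]
    exact (Equiv.sum_comp σ fun i => parityF p (c i)).symm
  rw [hsum, sgn_add, smul_comm]
  congr 1
  rw [GLModule.tensor, TensorProduct.map_tmul, parity_chainVector M₁ hp₁,
    parity_chainVector M₂ hp₂, TensorProduct.tmul_smul, ← TensorProduct.smul_tmul', smul_smul]
  congr 1
  ring

end Bethe

theorem eps_injective : Function.Injective (eps : Fin (k + 1) → Weight k) := fun a b h => by
  by_contra hab
  have := congrFun h a
  simp [eps, hab] at this

namespace GLModule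

variable {p : Fin (k + 1) → ZMod 2} {V : Type*} [AddCommGroup V] [Module ℂ V]

/-! ### Weight decomposition -/

theorem mem_singular_of_simple (M : GLModule p V) {x : V}
    (h : ∀ b : Fin k, M.E b.castSucc b.succ x = 0) : x ∈ M.singular := by
  rw [mem_singular]
  intro a b
  induction b using Fin.induction with
  | zero => intro hab; exact absurd hab (Fin.not_lt_zero a)
  | succ b ih =>
    intro hab
    rcases (Fin.le_castSucc_iff.2 hab).eq_or_lt with rfl | hlt
    · exact h b
    · have h1 := M.bracket_apply a b.castSucc b.castSucc b.succ x
      rw [h b, ih hlt, map_zero, map_zero, if_pos rfl, if_neg hab.ne] at h1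
      simpa using h1.symm

/-- Vectors of distinct weights are linearly independent. -/
theorem eq_zero_of_sum_weight_eq_zero (M : GLModule p V) {ι : Type*} (w : ι → Weight k)
    (hw : Function.Injective w) (s : Finset ι) : ∀ (f : ι → V),
      (∀ i ∈ s, f i ∈ M.weightSpace (w i)) → ∑ i ∈ s, f i = 0 → ∀ i ∈ s, f i = 0 := by
  classical
  induction s using Finset.induction_on with
  | empty => simp
  | insert j s hj ih =>
    intro f hf hsum
    rw [Finset.sum_insert hj] at hsum
    have hs : ∀ i ∈ s, f i = 0 := by
      intro i hi
      have hij : w i ≠ w j := fun h => hj (hw h ▸ hi)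
      obtain ⟨a, ha⟩ := Function.ne_iff.1 hij
      have h0 : ∑ i ∈ s, (w i a - w j a) • f i = 0 := by
        have h1 := congrArg (fun x => M.E a a x - w j a • x) hsum
        simp only [map_add, map_sum, smul_add, Finset.smul_sum, map_zero, smul_zero, sub_zero,
          mem_weightSpace.1 (hf j (Finset.mem_insert_self _ _)) a] at h1
        rw [add_sub_add_left_eq_sub, ← Finset.sum_sub_distrib] at h1
        rw [← h1]
        refine Finset.sum_congr rfl fun i hi => ?_
        rw [mem_weightSpace.1 (hf i (Finset.mem_insert_of_mem hi)) a, sub_smul]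
      have := ih (fun i => (w i a - w j a) • f i)
        (fun i hi => Submodule.smul_mem _ _ (hf i (Finset.mem_insert_of_mem hi))) h0 i hi
      exact (smul_eq_zero.1 this).resolve_left (sub_ne_zero.2 ha)
    intro i hi
    rcases Finset.mem_insert.1 hi with rfl | hi
    · rwa [Finset.sum_eq_zero hs, add_zero] at hsum
    · exact hs i hi

theorem weightSpace_unique (M : GLModule p V) {ν ν' : Weight k} {x : V} (hx : x ≠ 0)
    (h : x ∈ M.weightSpace ν) (h' : x ∈ M.weightSpace ν') : ν = ν' := by
  funext a
  have := (mem_weightSpace.1 h a).symm.trans (mem_weightSpace.1 h' a)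
  exact smul_left_injective ℂ hx this

/-- The weight components of a singular vector are singular. -/
theorem exists_singular_weight_decomposition (M : GLModule p V)
    (htop : ⨆ ν : Weight k, M.weightSpace ν = ⊤) {u : V} (hu : u ∈ M.singular) :
    ∃ (s : Finset (Weight k)) (f : Weight k → V),
      (∀ ν ∈ s, f ν ∈ M.weightSpace ν ∧ f ν ∈ M.singular) ∧ u = ∑ ν ∈ s, f ν := by
  obtain ⟨f, hf, hsum⟩ := (Submodule.mem_iSup_iff_exists_finsupp _ u).1
    (htop ▸ Submodule.mem_top : u ∈ ⨆ ν : Weight k, M.weightSpace ν)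
  refine ⟨f.support, f, fun ν hν => ⟨hf ν, ?_⟩, hsum.symm⟩
  rw [mem_singular] at hu ⊢
  intro a b hab
  refine M.eq_zero_of_sum_weight_eq_zero (fun ν => ν + eps a - eps b)
    (fun x y h => by simpa using h) f.support (fun ν => M.E a b (f ν))
    (fun ν _ => M.E_mem_weightSpace (hf ν) a b) ?_ ν hν
  rw [← map_sum, ← hu a b hab, ← hsum]
  rfl

/-! ### Irreducible highest weight modules -/

/-- `IsLoweringWord M x n y` means that `y` is the result of applying a product of lowering
operators `E_{ab}`, `b < a`, to `x`, and that `n` is the sum of the heights `a - b`. -/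
inductive IsLoweringWord (M : GLModule p V) (x : V) : ℕ → V → Prop
  | base : IsLoweringWord M x 0 x
  | step {n : ℕ} {y : V} (a b : Fin (k + 1)) (hab : b < a) (h : IsLoweringWord M x n y) :
      IsLoweringWord M x (n + (a - b : ℕ)) (M.E a b y)

/-- The linear function on weights which takes the value `1` at all the roots `-α_b`. -/
def depth (ν : Weight k) : ℂ := ∑ a : Fin (k + 1), (a : ℂ) * ν a

/-- The grading operator, acting on a vector of weight `ν` by the scalar `depth ν`. -/
def depthOperator (M : GLModule p V) : Module.End ℂ V := ∑ a : Fin (k + 1), (a : ℂ) • M.E a a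

theorem depthOperator_apply (M : GLModule p V) {ν : Weight k} {x : V} (hx : x ∈ M.weightSpace ν) :
    M.depthOperator x = depth ν • x := by
  simp only [depthOperator, LinearMap.sum_apply, LinearMap.smul_apply, mem_weightSpace.1 hx,
    smul_smul, depth, Finset.sum_smul]

theorem depth_add_eps (ν : Weight k) (a : Fin (k + 1)) : depth (ν + eps a) = depth ν + a := by
  simp [depth, mul_add, Finset.sum_add_distrib, eps, Pi.single_apply]

theorem depth_sub_eps (ν : Weight k) (a : Fin (k + 1)) : depth (ν - eps a) = depth ν - a := by
  simp [depth, mul_sub, Finset.sum_sub_distrib, eps, Pi.single_apply]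

namespace IsLoweringWord

variable {M : GLModule p V} {x : V}

theorem eq_of_zero {y : V} (h : IsLoweringWord M x 0 y) : y = x := by
  generalize hn : 0 = n at h
  cases h with
  | base => rfl
  | step a b hab h =>
    have : (b : ℕ) < a := hab
    omega

theorem exists_weight {ν : Weight k} (hx : x ∈ M.weightSpace ν) {n : ℕ} {y : V}
    (h : IsLoweringWord M x n y) :
    ∃ ν', y ∈ M.weightSpace ν' ∧ depth ν' = depth ν + n := by
  induction h with
  | base => exact ⟨ν, hx, by simp⟩
  | step a b hab _ ih =>
    obtain ⟨ν', h1, h2⟩ := ih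
    refine ⟨_, M.E_mem_weightSpace h1 a b, ?_⟩
    rw [depth_sub_eps, depth_add_eps, h2, Nat.cast_add, Nat.cast_sub hab.le]
    ring

theorem parity_eq (hx : M.parity x = x ∨ M.parity x = -x) {n : ℕ} {y : V}
    (h : IsLoweringWord M x n y) : ∃ s : ℂ, M.parity y = s • y := by
  induction h with
  | base =>
    rcases hx with h | h
    · exact ⟨1, by rw [h, one_smul]⟩
    · exact ⟨-1, by rw [h, neg_one_smul]⟩
  | step a b hab _ ih =>
    obtain ⟨s, hs⟩ := ih
    exact ⟨_, by rw [M.parity_E, hs, map_smul, smul_smul]⟩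

/-- The span of the lowering words is invariant under all the operators `E_{cd}`. -/
theorem E_mem_span {ν : Weight k} (hx : x ∈ M.weightSpace ν) (hs : x ∈ M.singular) {n : ℕ} {y : V}
    (h : IsLoweringWord M x n y) : ∀ c d : Fin (k + 1),
      M.E c d y ∈ Submodule.span ℂ {y | ∃ n, IsLoweringWord M x n y} := by
  have hlow : ∀ a b : Fin (k + 1), b < a →
      ∀ y ∈ Submodule.span ℂ {y | ∃ n, IsLoweringWord M x n y},
        M.E a b y ∈ Submodule.span ℂ {y | ∃ n, IsLoweringWord M x n y} := by
    intro a b hab y hy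
    induction hy using Submodule.span_induction with
    | mem y hy => exact Submodule.subset_span ⟨_, hy.choose_spec.step a b hab⟩
    | zero => rw [map_zero]; exact Submodule.zero_mem _
    | add y z _ _ hy hz => rw [map_add]; exact Submodule.add_mem _ hy hz
    | smul r y _ hy => rw [map_smul]; exact Submodule.smul_mem _ _ hy
  induction h with
  | base =>
    intro c d
    rcases lt_trichotomy c d with h | rfl | h
    · rw [mem_singular.1 hs c d h]; exact Submodule.zero_mem _
    · rw [mem_weightSpace.1 hx]
      exact Submodule.smul_mem _ _ (Submodule.subset_span ⟨_, .base⟩)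
    · exact hlow _ _ h _ (Submodule.subset_span ⟨_, .base⟩)
  | step a b hab _ ih =>
    intro c d
    rw [M.bracket_apply]
    refine Submodule.add_mem _ (Submodule.smul_mem _ _ (hlow _ _ hab _ (ih c d)))
      (Submodule.sub_mem _ ?_ (Submodule.smul_mem _ _ ?_))
    · split_ifs
      · exact ih _ _
      · exact Submodule.zero_mem _
    · split_ifs
      · exact ih _ _
      · exact Submodule.zero_mem _

end IsLoweringWord

theorem IsHighestWeightVector.span_eq_top {M : GLModule p V} (hirr : M.IsIrreducible) {ν : Weight k}
    {x : V} (hx : M.IsHighestWeightVector ν x) :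
    Submodule.span ℂ {y | ∃ n, IsLoweringWord M x n y} = ⊤ := by
  obtain ⟨h0, hpar, hw, hs⟩ := hx
  refine (hirr.2 _ (fun a b w hw' => ?_) (fun w hw' => ?_)).resolve_left fun hbot => ?_
  · induction hw' using Submodule.span_induction with
    | mem y hy => exact hy.choose_spec.E_mem_span hw hs a b
    | zero => rw [map_zero]; exact Submodule.zero_mem _
    | add y z _ _ hy hz => rw [map_add]; exact Submodule.add_mem _ hy hz
    | smul r y _ hy => rw [map_smul]; exact Submodule.smul_mem _ _ hy
  · induction hw' using Submodule.span_induction with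
    | mem y hy =>
      obtain ⟨s, hs⟩ := hy.choose_spec.parity_eq hpar
      rw [hs]
      exact Submodule.smul_mem _ _ (Submodule.subset_span hy)
    | zero => rw [map_zero]; exact Submodule.zero_mem _
    | add y z _ _ hy hz => rw [map_add]; exact Submodule.add_mem _ hy hz
    | smul r y _ hy => rw [map_smul]; exact Submodule.smul_mem _ _ hy
  · exact h0 ((Submodule.eq_bot_iff _).1 hbot x (Submodule.subset_span ⟨0, .base⟩))

/-- In an irreducible module generated by a highest weight vector, the grading starts at the
degree of this vector, which spans the lowest degree part. -/
theorem IsHighestWeightVector.depth_ge {M : GLModule p V} (hirr : M.IsIrreducible) {ν : Weight k}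
    {x : V} (hx : M.IsHighestWeightVector ν x) {ν' : Weight k} {y : V} (hy : y ∈ M.weightSpace ν')
    (hy0 : y ≠ 0) :
    ∃ n : ℕ, depth ν' = depth ν + n ∧ (n = 0 → y ∈ Submodule.span ℂ {x}) := by
  set D := M.depthOperator with hD
  have hyD : y ∈ D.eigenspace (depth ν') := by
    rw [Module.End.mem_eigenspace_iff, hD, M.depthOperator_apply hy]
  have hle : (⊤ : Submodule ℂ V)
      ≤ Submodule.span ℂ {x} ⊔ ⨆ n : ℕ, D.eigenspace (depth ν + (n + 1 : ℕ)) := by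
    rw [← hx.span_eq_top hirr, Submodule.span_le]
    rintro z ⟨n, hn⟩
    rcases n with _ | n
    · rw [hn.eq_of_zero]
      exact Submodule.mem_sup_left (Submodule.mem_span_singleton_self x)
    · obtain ⟨ν'', h1, h2⟩ := hn.exists_weight hx.2.2.1
      refine Submodule.mem_sup_right (Submodule.mem_iSup_of_mem n ?_)
      rw [Module.End.mem_eigenspace_iff, hD, M.depthOperator_apply h1, h2]
  obtain ⟨y₁, hy₁, y₂, hy₂, hsum⟩ := Submodule.mem_sup.1 (hle (Submodule.mem_top : y ∈ _))
  have hy₁D : y₁ ∈ D.eigenspace (depth ν) := by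
    obtain ⟨r, rfl⟩ := Submodule.mem_span_singleton.1 hy₁
    refine Submodule.smul_mem _ _ ?_
    rw [Module.End.mem_eigenspace_iff, hD, M.depthOperator_apply hx.2.2.1]
  have hind := D.eigenspaces_iSupIndep
  by_cases hcase : ∃ n : ℕ, depth ν' = depth ν + (n + 1 : ℕ)
  · obtain ⟨n, hn⟩ := hcase
    exact ⟨n + 1, hn, fun h => absurd h (Nat.succ_ne_zero n)⟩
  push Not at hcase
  have hy₂' : y₂ ∈ ⨆ μ ≠ depth ν', D.eigenspace μ := by
    refine (iSup_le fun n => ?_ : ⨆ n : ℕ, D.eigenspace (depth ν + (n + 1 : ℕ)) ≤ _) hy₂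
    exact le_iSup₂_of_le _ (hcase n).symm le_rfl
  by_cases he : depth ν' = depth ν
  · refine ⟨0, by simp [he], fun _ => ?_⟩
    have h2 : y₂ ∈ D.eigenspace (depth ν') := by
      rw [← sub_eq_of_eq_add' hsum.symm, he]
      exact Submodule.sub_mem _ (he ▸ hyD) hy₁D
    have : y₂ = 0 := Submodule.disjoint_def.1 (hind (depth ν')) _ h2 hy₂'
    rwa [← hsum, this, add_zero]
  · refine absurd (Submodule.disjoint_def.1 (hind (depth ν')) _ hyD ?_) hy0
    rw [← hsum]
    exact Submodule.add_mem _ (le_iSup₂_of_le (f := fun μ (_ : μ ≠ depth ν') => D.eigenspace μ) _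
      (Ne.symm he) le_rfl hy₁D) hy₂'

/-- Singular weight vectors of an irreducible highest weight module are multiples of the highest weight
vector: each homogeneous one generates the module, so that the gradings which start at the two
vectors coincide. -/
theorem IsHighestWeightVector.mem_span_of_singular {M : GLModule p V} (hirr : M.IsIrreducible)
    {lam : Weight k} {v : V} (hv : M.IsHighestWeightVector lam v) {ν : Weight k} {x : V}
    (hw : x ∈ M.weightSpace ν) (hs : x ∈ M.singular) : x ∈ Submodule.span ℂ {v} := by
  have hhom : ∀ y : V, y ∈ M.weightSpace ν → y ∈ M.singular →
      (M.parity y = y ∨ M.parity y = -y) → y ∈ Submodule.span ℂ {v} := by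
    intro y h1 h2 h3
    by_cases h0 : y = 0
    · rw [h0]; exact Submodule.zero_mem _
    obtain ⟨n, hn, hspan⟩ := hv.depth_ge hirr h1 h0
    obtain ⟨n', hn', -⟩ := IsHighestWeightVector.depth_ge hirr ⟨h0, h3, h1, h2⟩ hv.2.2.1 hv.1
    apply hspan
    have : ((n + n' : ℕ) : ℂ) = 0 := by
      push_cast
      linear_combination -hn - hn'
    have := Nat.cast_eq_zero.1 this
    omega
  -- The even and odd parts of `x` are again singular of weight `ν`.
  have hpp : M.parity (M.parity x) = x := by
    have := congrArg (fun f => f x) M.parity_sq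
    simpa using this
  have hE : ∀ a b, M.E a b (M.parity x) = sgn (p a + p b) • M.parity (M.E a b x) := fun a b => by
    rw [M.parity_E, smul_smul, sgn_mul_self, one_smul]
  have hPw : M.parity x ∈ M.weightSpace ν := by
    rw [mem_weightSpace] at hw ⊢
    intro a
    have h0 : p a + p a = 0 := CharTwo.add_self_eq_zero _
    rw [hE, hw, h0, sgn_zero, one_smul, map_smul]
  have hPs : M.parity x ∈ M.singular := by
    rw [mem_singular] at hs ⊢
    intro a b hab
    rw [hE, hs a b hab, map_zero, smul_zero]
  have h1 := hhom (x + M.parity x) (Submodule.add_mem _ hw hPw) (Submodule.add_mem _ hs hPs)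
    (Or.inl (by rw [map_add, hpp, add_comm]))
  have h2 := hhom (x - M.parity x) (Submodule.sub_mem _ hw hPw) (Submodule.sub_mem _ hs hPs)
    (Or.inr (by rw [map_sub, hpp, neg_sub]))
  have h3 := Submodule.smul_mem _ (2⁻¹ : ℂ) (Submodule.add_mem _ h1 h2)
  convert h3 using 1
  module

end GLModule

/-! ### The tensor product with the defining representation -/

section Component

variable {p : Fin (k + 1) → ZMod 2} {V : Type*} [AddCommGroup V] [Module ℂ V]

/-- The coefficient of `e_c` of an element of `ℂ^{m|n} ⊗ V`. -/
def component (c : Fin (k + 1)) : (Fin (k + 1) → ℂ) ⊗[ℂ] V →ₗ[ℂ] V :=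
  (TensorProduct.lid ℂ V).toLinearMap ∘ₗ (LinearMap.proj c).rTensor V

theorem component_tmul (c : Fin (k + 1)) (x : Fin (k + 1) → ℂ) (y : V) :
    component c (x ⊗ₜ[ℂ] y) = x c • y := by
  simp [component]

theorem sum_single_tmul_component (u : (Fin (k + 1) → ℂ) ⊗[ℂ] V) :
    ∑ c, (Pi.single c (1 : ℂ) : Fin (k + 1) → ℂ) ⊗ₜ[ℂ] component c u = u := by
  induction u using TensorProduct.induction_on with
  | zero => simp
  | tmul x y =>
    simp only [component_tmul, TensorProduct.tmul_smul, TensorProduct.smul_tmul',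
      ← TensorProduct.sum_tmul]
    congr 1
    funext c
    simp [Finset.sum_apply, Pi.single_apply]
  | add u w hu hw =>
    simp only [map_add, TensorProduct.tmul_add, Finset.sum_add_distrib, hu, hw]

theorem eq_zero_of_component {u : (Fin (k + 1) → ℂ) ⊗[ℂ] V} (h : ∀ c, component c u = 0) :
    u = 0 := by
  rw [← sum_single_tmul_component u]
  simp [h]

theorem definingModule_E_apply (a b : Fin (k + 1)) (x : Fin (k + 1) → ℂ) :
    (definingModule p).E a b x = Pi.single a (x b) := by
  simp [definingModule, Matrix.toLinAlgEquiv'_apply, Matrix.single_mulVec]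
  rfl

theorem definingModule_parity_pow_apply (y : ZMod 2) (x : Fin (k + 1) → ℂ) (c : Fin (k + 1)) :
    ((definingModule p).parity ^ y.val) x c = sgn (y * p c) * x c := by
  rcases zmod_two_cases y with rfl | rfl
  · simp [sgn_zero]
  · have h1 : (1 : ZMod 2).val = 1 := rfl
    rw [h1, pow_one, one_mul]
    simp [definingModule, Matrix.toLinAlgEquiv'_apply, Matrix.mulVec_diagonal]

theorem component_E (M : GLModule p V) (a b c : Fin (k + 1)) (u : (Fin (k + 1) → ℂ) ⊗[ℂ] V) :
    component c (((definingModule p).tensor M).E a b u)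
      = (if c = a then component b u else 0)
        + sgn ((p a + p b) * p c) • M.E a b (component c u) := by
  induction u using TensorProduct.induction_on with
  | zero => simp
  | tmul x y =>
    rw [tensor_E_apply, map_add, component_tmul, component_tmul, component_tmul, component_tmul,
      definingModule_E_apply, definingModule_parity_pow_apply, map_smul, smul_smul,
      Pi.single_apply, ite_smul, zero_smul]
  | add u w hu hw =>
    rw [map_add, map_add, hu, hw, map_add, map_add, map_add, smul_add]
    split_ifs <;> abel

theorem component_mem_weightSpace {M : GLModule p V} {ν : Weight k}
    {u : (Fin (k + 1) → ℂ) ⊗[ℂ] V} (hu : u ∈ ((definingModule p).tensor M).weightSpace ν)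
    (c : Fin (k + 1)) : component c u ∈ M.weightSpace (ν - eps c) := by
  rw [GLModule.mem_weightSpace] at hu ⊢
  intro a
  have h0 : p a + p a = 0 := CharTwo.add_self_eq_zero _
  have h := congrArg (component c) (hu a)
  rw [component_E, h0, zero_mul, sgn_zero, one_smul, map_smul] at h
  rw [Pi.sub_apply, eps, Pi.single_apply, sub_smul, ← h]
  by_cases hca : c = a
  · subst hca; simp
  · simp [hca, Ne.symm hca]

theorem single_tmul_mem_weightSpace {M : GLModule p V} {ν : Weight k} {y : V}
    (hy : y ∈ M.weightSpace ν) (c : Fin (k + 1)) :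
    (Pi.single c (1 : ℂ) : Fin (k + 1) → ℂ) ⊗ₜ[ℂ] y
      ∈ ((definingModule p).tensor M).weightSpace (ν + eps c) := by
  rw [GLModule.mem_weightSpace] at hy ⊢
  intro a
  have h0 : p a + p a = 0 := CharTwo.add_self_eq_zero _
  rw [tensor_E_apply, h0, hy, definingModule_E_apply, ZMod.val_zero, pow_zero,
    Module.End.one_apply, Pi.add_apply, add_smul, TensorProduct.tmul_smul,
    add_comm (ν a • _)]
  congr 1
  by_cases hca : c = a
  · subst hca; simp [eps]
  · simp [eps, Ne.symm hca]

/-- The tensor product of the defining representation and a polynomial module is polynomial. -/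
theorem isPolynomial_tensor {M : GLModule p V} (hpol : M.IsPolynomial) :
    ((definingModule p).tensor M).IsPolynomial := by
  constructor
  · rw [eq_top_iff]
    intro u _
    rw [← sum_single_tmul_component u]
    refine Submodule.sum_mem _ fun c _ => ?_
    obtain ⟨f, hf, hsum⟩ := (Submodule.mem_iSup_iff_exists_finsupp _ (component c u)).1
      (hpol.1 ▸ Submodule.mem_top : component c u ∈ ⨆ ν : Weight k, M.weightSpace ν)
    rw [← hsum, Finsupp.sum, TensorProduct.tmul_sum]
    exact Submodule.sum_mem _ fun ν _ =>
      Submodule.mem_iSup_of_mem _ (single_tmul_mem_weightSpace (hf ν) c)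
  · intro ν hν a
    obtain ⟨u, hu, hu0⟩ := Submodule.exists_mem_ne_zero_of_ne_bot hν
    have : ∃ c, component c u ≠ 0 := by
      by_contra! h
      exact hu0 (eq_zero_of_component h)
    obtain ⟨c, hc⟩ := this
    obtain ⟨d, hd⟩ := hpol.2 (ν - eps c) (fun h => hc ((Submodule.eq_bot_iff _).1 h _
      (component_mem_weightSpace hu c))) a
    rw [Pi.sub_apply, sub_eq_iff_eq_add, eps, Pi.single_apply] at hd
    by_cases hac : a = c
    · exact ⟨d + 1, by rw [hd, if_pos hac]; push_cast; rfl⟩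
    · exact ⟨d, by rw [hd, if_neg hac, add_zero]⟩

/-- The component of a singular vector at the last `e_a` which occurs in it is singular. -/
theorem exists_top_component {M : GLModule p V} {u : (Fin (k + 1) → ℂ) ⊗[ℂ] V} (h0 : u ≠ 0)
    (hs : u ∈ ((definingModule p).tensor M).singular) :
    ∃ a, component a u ≠ 0 ∧ component a u ∈ M.singular := by
  classical
  have : (Finset.univ.filter fun c => component c u ≠ 0).Nonempty := by
    by_contra h
    rw [Finset.not_nonempty_iff_eq_empty, Finset.filter_eq_empty_iff] at h
    exact h0 (eq_zero_of_component fun c => by simpa using h (Finset.mem_univ c))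
  obtain ⟨a, ha, hmax⟩ := Finset.exists_max_image _ (fun c => c) this
  refine ⟨a, (Finset.mem_filter.1 ha).2, ?_⟩
  rw [GLModule.mem_singular] at hs ⊢
  intro i j hij
  have h := congrArg (component a) (hs i j hij)
  rw [component_E, map_zero] at h
  have hif : (if a = i then component j u else 0) = 0 := by
    split_ifs with hai
    · by_contra hj
      exact absurd (hmax j (Finset.mem_filter.2 ⟨Finset.mem_univ _, hj⟩))
        (not_le.2 (hai ▸ hij))
    · rfl
  rw [hif, zero_add] at h
  exact (smul_eq_zero.1 h).resolve_left (sgn_ne_zero _)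

/-- The weight of a singular vector of `ℂ^{m|n} ⊗ V` is the sum of the highest weight of `V` and of
some `ε_a`. -/
theorem exists_weight_eq_add_eps {M : GLModule p V} (hirr : M.IsIrreducible) {lam : Weight k} {v : V}
    (hv : M.IsHighestWeightVector lam v) {ν : Weight k} {u : (Fin (k + 1) → ℂ) ⊗[ℂ] V} (h0 : u ≠ 0)
    (hw : u ∈ ((definingModule p).tensor M).weightSpace ν)
    (hs : u ∈ ((definingModule p).tensor M).singular) :
    ∃ a, ν = lam + eps a ∧ component a u ≠ 0 ∧ component a u ∈ Submodule.span ℂ {v} := by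
  obtain ⟨a, ha0, has⟩ := exists_top_component h0 hs
  have haw := component_mem_weightSpace hw a
  have hspan := hv.mem_span_of_singular hirr haw has
  refine ⟨a, ?_, ha0, hspan⟩
  obtain ⟨r, hr⟩ := Submodule.mem_span_singleton.1 hspan
  have h' : component a u ∈ M.weightSpace lam := hr ▸ Submodule.smul_mem _ _ hv.2.2.1
  rw [← M.weightSpace_unique ha0 haw h', sub_add_cancel]

/-- Singular vectors of `ℂ^{m|n} ⊗ V` of a given weight are unique up to a factor. -/
theorem mem_span_of_same_weight {M : GLModule p V} (hirr : M.IsIrreducible) {lam : Weight k} {v : V}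
    (hv : M.IsHighestWeightVector lam v) {ν : Weight k} {u w : (Fin (k + 1) → ℂ) ⊗[ℂ] V}
    (hw0 : w ≠ 0) (hw : w ∈ ((definingModule p).tensor M).weightSpace ν)
    (hws : w ∈ ((definingModule p).tensor M).singular)
    (hu : u ∈ ((definingModule p).tensor M).weightSpace ν)
    (hus : u ∈ ((definingModule p).tensor M).singular) : u ∈ Submodule.span ℂ {w} := by
  obtain ⟨a, rfl, ha0, haspan⟩ := exists_weight_eq_add_eps hirr hv hw0 hw hws
  have htop : ∀ x : (Fin (k + 1) → ℂ) ⊗[ℂ] V, x ≠ 0 →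
      x ∈ ((definingModule p).tensor M).weightSpace (lam + eps a) →
      x ∈ ((definingModule p).tensor M).singular →
      component a x ≠ 0 ∧ component a x ∈ Submodule.span ℂ {v} := by
    intro x h0 h1 h2
    obtain ⟨b, hb, h3⟩ := exists_weight_eq_add_eps hirr hv h0 h1 h2
    rwa [← eps_injective (add_left_cancel hb)] at h3
  by_cases hu0 : u = 0
  · rw [hu0]; exact Submodule.zero_mem _
  obtain ⟨d, hd⟩ := Submodule.mem_span_singleton.1 (htop u hu0 hu hus).2
  obtain ⟨c, hc⟩ := Submodule.mem_span_singleton.1 haspan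
  have hc0 : c ≠ 0 := by
    rintro rfl
    rw [zero_smul] at hc
    exact ha0 hc.symm
  rw [Submodule.mem_span_singleton]
  refine ⟨d / c, ?_⟩
  by_contra hne
  refine (htop (u - (d / c) • w) (fun h => hne (sub_eq_zero.1 h).symm)
    (Submodule.sub_mem _ hu (Submodule.smul_mem _ _ hw))
    (Submodule.sub_mem _ hus (Submodule.smul_mem _ _ hws))).1 ?_
  rw [map_sub, map_smul, ← hd, ← hc, smul_smul, div_mul_cancel₀ _ hc0, sub_self]

end Component

namespace GLModule

/-! ### Odd reflections in polynomial modules -/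

variable {p : Fin (k + 1) → ZMod 2} {V : Type*} [AddCommGroup V] [Module ℂ V] {M : GLModule p V}

theorem IsPolynomial.exists_nat (hpol : M.IsPolynomial) {ν : Weight k} {x : V}
    (hx : x ∈ M.weightSpace ν) (h0 : x ≠ 0) (a : Fin (k + 1)) : ∃ d : ℕ, ν a = d :=
  hpol.2 ν (fun h => h0 ((Submodule.eq_bot_iff _).1 h x hx)) a

theorem add_eq_one_of_ne {x y : ZMod 2} (h : x ≠ y) : x + y = 1 := by
  revert x y; decide

/-- Dominance for the even subalgebra `gl(2)` spanned by the `E_{cd}` with `c, d ∈ {a, b}`. -/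
theorem IsPolynomial.exists_nat_sub (hpol : M.IsPolynomial) {ν : Weight k} {x : V}
    (hx : x ∈ M.weightSpace ν) (h0 : x ≠ 0) {b a : Fin (k + 1)} (hab : b ≠ a) (hp : p b = p a)
    (hE : M.E b a x = 0) : ∃ n : ℕ, ν b - ν a = n := by
  have hpar : p b + p a = 0 := by rw [hp]; exact CharTwo.add_self_eq_zero _
  have hw : ∀ n : ℕ, (M.E a b ^ n) x ∈ M.weightSpace (ν + (n : ℂ) • (eps a - eps b)) := by
    intro n
    induction n with
    | zero => simpa using hx
    | succ n ih =>
      have := M.E_mem_weightSpace ih a b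
      rw [pow_succ', Module.End.mul_apply]
      convert this using 2
      push_cast
      module
  have hcoord : ∀ n : ℕ, (ν + (n : ℂ) • (eps a - eps b)) b = ν b - n ∧
      (ν + (n : ℂ) • (eps a - eps b)) a = ν a + n := by
    intro n
    constructor
    · simp [eps, hab]; ring
    · simp [eps, hab.symm]
  have hcomm : ∀ n : ℕ, M.E b a ((M.E a b ^ (n + 1)) x)
      = ((n + 1 : ℂ) * (ν b - ν a - n)) • (M.E a b ^ n) x := by
    intro n
    induction n with
    | zero =>
      rw [zero_add, pow_one, M.bracket_apply, hE, map_zero, hpar, zero_mul, sgn_zero, if_pos rfl,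
        if_pos rfl, mem_weightSpace.1 hx, mem_weightSpace.1 hx]
      simp
      module
    | succ n ih =>
      rw [pow_succ', Module.End.mul_apply, M.bracket_apply, ih, map_smul, ← Module.End.mul_apply,
        ← pow_succ', hpar, zero_mul, sgn_zero, if_pos rfl, if_pos rfl, mem_weightSpace.1 (hw _),
        mem_weightSpace.1 (hw _), (hcoord _).1, (hcoord _).2]
      push_cast
      module
  obtain ⟨d, hd⟩ := hpol.exists_nat hx h0 b
  have hex : ∃ n : ℕ, (M.E a b ^ n) x = 0 := by
    refine ⟨d + 1, ?_⟩
    by_contra hne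
    obtain ⟨d', hd'⟩ := hpol.exists_nat (hw (d + 1)) hne b
    rw [(hcoord _).1, hd] at hd'
    have : ((d' + 1 : ℕ) : ℂ) = (0 : ℕ) := by
      push_cast at hd' ⊢
      linear_combination -hd'
    have := Nat.cast_injective this
    omega
  classical
  obtain ⟨n, hn⟩ : ∃ n, Nat.find hex = n + 1 := by
    refine Nat.exists_eq_succ_of_ne_zero fun h => h0 ?_
    have := Nat.find_spec hex
    rw [h] at this
    simpa using this
  have h1 := Nat.find_spec hex
  have h2 : (M.E a b ^ n) x ≠ 0 := Nat.find_min hex (by omega)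
  rw [hn] at h1
  have h3 := hcomm n
  rw [h1, map_zero, eq_comm, smul_eq_zero] at h3
  have h4 := (mul_eq_zero.1 (h3.resolve_right h2)).resolve_left (Nat.cast_add_one_ne_zero n)
  exact ⟨n, sub_eq_zero.1 h4⟩

/-- An odd reflection does not kill a singular vector on which the coroot does not vanish. -/
theorem E_ne_zero_of_odd {ν : Weight k} {y : V} (hy : y ∈ M.weightSpace ν) (h0 : y ≠ 0)
    {c d : Fin (k + 1)} (hp : p c ≠ p d) (hE : M.E c d y = 0) (hν : ν c + ν d ≠ 0) :
    M.E d c y ≠ 0 := by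
  intro h
  have h1 := M.bracket_apply c d d c y
  rw [h, hE, map_zero, map_zero, add_eq_one_of_ne hp, add_eq_one_of_ne hp.symm, one_mul, sgn_one,
    if_pos rfl, if_pos rfl, mem_weightSpace.1 hy, mem_weightSpace.1 hy, smul_zero, zero_add,
    neg_one_smul, sub_neg_eq_add, ← add_smul] at h1
  exact (smul_eq_zero.1 h1.symm).elim hν h0

/-- Dominance across a run of basis vectors of the opposite parity: odd reflections move `e_a`
through the run until it is next to `e_b`. -/
theorem IsPolynomial.weight_dominance (hpol : M.IsPolynomial) {ν : Weight k} {x : V}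
    (hx : x ∈ M.weightSpace ν) (hs : x ∈ M.singular) (h0 : x ≠ 0) {b a : Fin (k + 1)} (hba : b < a)
    (hp : p b = p a) (hrun : ∀ c, b < c → c < a → p c ≠ p a) {na nb : ℕ} (hna : ν a = na)
    (hnb : ν b = nb) (hpos : 0 < na) : na + (a - b - 1 : ℕ) ≤ nb := by
  have hstep : ∀ s : ℕ, s ≤ (a - b - 1 : ℕ) → ∃ (y : V) (ν' : Weight k), y ≠ 0 ∧
      y ∈ M.weightSpace ν' ∧ ν' a = ν a + s ∧ (∀ c : Fin (k + 1), (c : ℕ) + s < a → ν' c = ν c) ∧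
      (∀ c d : Fin (k + 1), c < d → (d : ℕ) + s < a → M.E c d y = 0) ∧
      (∀ c : Fin (k + 1), (c : ℕ) + s < a → M.E c a y = 0) := by
    intro s
    induction s with
    | zero =>
      intro _
      exact ⟨x, ν, h0, hx, by simp, fun _ _ => rfl, fun c d h _ => mem_singular.1 hs c d h,
        fun c h => mem_singular.1 hs c a (by simpa using h)⟩
    | succ s ih =>
      intro hle
      obtain ⟨y, ν', hy0, hy, hνa, hνc, hE, hEa⟩ := ih (by omega)
      have hba' : (b : ℕ) < a := hba
      let j : Fin (k + 1) := ⟨a - s - 1, by omega⟩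
      have hj : (j : ℕ) + s + 1 = a := by simp only [j]; omega
      have hja : j < a := by rw [Fin.lt_def]; omega
      have hpj : p j ≠ p a := hrun j (by rw [Fin.lt_def]; omega) hja
      obtain ⟨nj, hnj⟩ := hpol.exists_nat hx h0 j
      have hsum : ν' j + ν' a ≠ 0 := by
        rw [hνc j (by omega), hνa, hnj, hna]
        norm_cast
        omega
      refine ⟨M.E a j y, ν' + eps a - eps j, E_ne_zero_of_odd hy hy0 hpj (hEa j (by omega)) hsum,
        M.E_mem_weightSpace hy a j, ?_, ?_, ?_, ?_⟩
      · simp [eps, hja.ne, hνa]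
        ring
      · intro c hc
        have h1 : a ≠ c := by rintro rfl; omega
        have h2 : j ≠ c := by rintro rfl; omega
        simp [eps, h1.symm, h2.symm, hνc c (by omega)]
      · intro c d hcd hd
        have h1 : d ≠ a := by rintro rfl; omega
        have h2 : c ≠ j := by rintro rfl; rw [Fin.lt_def] at hcd; omega
        rw [M.bracket_apply, hE c d hcd (by omega), if_neg h1, if_neg h2]
        simp
      · intro c hc
        have h2 : c ≠ j := by rintro rfl; omega
        rw [M.bracket_apply, hEa c (by omega), if_pos rfl, if_neg h2,
          hE c j (by rw [Fin.lt_def]; omega) (by omega)]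
        simp
  have hba' : (b : ℕ) < a := hba
  obtain ⟨y, ν', hy0, hy, hνa, hνc, -, hEa⟩ := hstep _ le_rfl
  obtain ⟨n, hn⟩ := hpol.exists_nat_sub hy hy0 hba.ne hp (hEa b (by omega))
  rw [hνa, hνc b (by omega), hna, hnb] at hn
  have : nb = n + (na + (a - b - 1 : ℕ)) := by
    have h : (nb : ℂ) = ((n + (na + (a - b - 1 : ℕ)) : ℕ) : ℂ) := by
      push_cast
      linear_combination hn
    exact_mod_cast h
  omega

/-- The hook condition: odd reflections move `e_o` through the run of basis vectors of the opposite
parity which follows it, up to and including `e_a`, and lower the weight at `e_o` at each step. -/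
theorem IsPolynomial.weight_hook (hpol : M.IsPolynomial) {ν : Weight k} {x : V}
    (hx : x ∈ M.weightSpace ν) (hs : x ∈ M.singular) (h0 : x ≠ 0) {o a : Fin (k + 1)} (hoa : o < a)
    (hp : p o ≠ p a) (hrun : ∀ c, o < c → c < a → p c = p a) {na no : ℕ} (hna : ν a = na)
    (hno : ν o = no) (hpos : 0 < na) : (a - o : ℕ) ≤ no := by
  have hposc : ∀ c, o < c → c ≤ a → ∃ d : ℕ, ν c = d ∧ 0 < d := by
    intro c hoc hca
    rcases hca.eq_or_lt with rfl | hca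
    · exact ⟨na, hna, hpos⟩
    · obtain ⟨n, hn⟩ := hpol.exists_nat_sub hx h0 hca.ne (hrun c hoc hca)
        (mem_singular.1 hs c a hca)
      refine ⟨n + na, ?_, by omega⟩
      push_cast
      linear_combination hn + hna
  have hstep : ∀ s : ℕ, s ≤ (a - o : ℕ) → ∃ (y : V) (ν' : Weight k), y ≠ 0 ∧
      y ∈ M.weightSpace ν' ∧ ν' o = ν o - s ∧ (∀ c : Fin (k + 1), (o : ℕ) + s < c → ν' c = ν c) ∧
      (∀ c d : Fin (k + 1), c < d → (o : ℕ) + s < c → M.E c d y = 0) ∧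
      (∀ d : Fin (k + 1), (o : ℕ) + s < d → M.E o d y = 0) := by
    intro s
    induction s with
    | zero =>
      intro _
      exact ⟨x, ν, h0, hx, by simp, fun _ _ => rfl, fun c d h _ => mem_singular.1 hs c d h,
        fun c h => mem_singular.1 hs o c (by simpa using h)⟩
    | succ s ih =>
      intro hle
      obtain ⟨y, ν', hy0, hy, hνo, hνc, hE, hEo⟩ := ih (by omega)
      have hoa' : (o : ℕ) < a := hoa
      let j : Fin (k + 1) := ⟨o + s + 1, by omega⟩
      have hj : (j : ℕ) = o + s + 1 := rfl
      have hoj : o < j := by rw [Fin.lt_def]; omega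
      have hja : j ≤ a := by rw [Fin.le_def]; omega
      have hpj : p o ≠ p j := by
        rcases hja.eq_or_lt with h | h
        · rwa [h]
        · rwa [hrun j hoj h]
      obtain ⟨nj, hnj, hnj0⟩ := hposc j hoj hja
      obtain ⟨no', hno'⟩ := hpol.exists_nat hy hy0 o
      have hsum : ν' o + ν' j ≠ 0 := by
        rw [hνc j (by omega), hno', hnj]
        norm_cast
        omega
      refine ⟨M.E j o y, ν' + eps j - eps o, E_ne_zero_of_odd hy hy0 hpj (hEo j (by omega)) hsum,
        M.E_mem_weightSpace hy j o, ?_, ?_, ?_, ?_⟩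
      · simp [eps, hoj.ne, hνo]
        ring
      · intro c hc
        have h1 : c ≠ o := by rintro rfl; omega
        have h2 : c ≠ j := by rintro rfl; omega
        simp [eps, h1, h2, hνc c (by omega)]
      · intro c d hcd hc
        rw [Fin.lt_def] at hcd
        have h1 : d ≠ j := by rintro rfl; omega
        have h2 : c ≠ o := by rintro rfl; omega
        rw [M.bracket_apply, hE c d hcd (by omega), if_neg h1, if_neg h2]
        simp
      · intro d hd
        have h1 : d ≠ j := by rintro rfl; omega
        rw [M.bracket_apply, hEo d (by omega), if_neg h1, if_pos rfl,
          hE j d (by rw [Fin.lt_def]; omega) (by omega)]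
        simp
  obtain ⟨y, ν', hy0, hy, hνo, -, -, -⟩ := hstep _ le_rfl
  obtain ⟨n, hn⟩ := hpol.exists_nat hy hy0 o
  rw [hνo, hno] at hn
  have : no = n + (a - o : ℕ) := by
    have h : (no : ℂ) = ((n + (a - o : ℕ) : ℕ) : ℂ) := by
      push_cast
      linear_combination hn
    exact_mod_cast h
  omega

end GLModule

/-! ### Counting basis vectors of a given parity -/

/-- The opposite parities. Together with the transposition of diagrams, this exchanges the roles of
the even and of the odd basis vectors. -/
def flipParity (p : Fin (k + 1) → ZMod 2) : Fin (k + 1) → ZMod 2 := fun a => p a + 1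

theorem flipParity_eq_zero {p : Fin (k + 1) → ZMod 2} {a : Fin (k + 1)} :
    flipParity p a = 0 ↔ p a = 1 := by
  unfold flipParity
  generalize p a = x
  revert x; decide

theorem flipParity_eq_one {p : Fin (k + 1) → ZMod 2} {a : Fin (k + 1)} :
    flipParity p a = 1 ↔ p a = 0 := by
  unfold flipParity
  generalize p a = x
  revert x; decide

theorem ne_zero_iff_eq_one {x : ZMod 2} : x ≠ 0 ↔ x = 1 := by
  revert x; decide

theorem evensBefore_flipParity (p : Fin (k + 1) → ZMod 2) (a : Fin (k + 1)) :
    evensBefore (flipParity p) a = oddsBefore p a := by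
  simp only [evensBefore, oddsBefore, flipParity_eq_zero]

theorem oddsBefore_flipParity (p : Fin (k + 1) → ZMod 2) (a : Fin (k + 1)) :
    oddsBefore (flipParity p) a = evensBefore p a := by
  simp only [evensBefore, oddsBefore, flipParity_eq_one]

theorem hookWeight_flipParity (p : Fin (k + 1) → ZMod 2) (μ : YoungDiagram) :
    hookWeight (flipParity p) μ.transpose = hookWeight p μ := by
  funext a
  simp only [hookWeight, evensBefore_flipParity, oddsBefore_flipParity, flipParity_eq_zero,
    YoungDiagram.rowLen_transpose, YoungDiagram.colLen_transpose]
  rcases zmod_two_cases (p a) with h | h <;> simp [h]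

theorem sgn_flipParity (p : Fin (k + 1) → ZMod 2) (a : Fin (k + 1)) :
    sgn (flipParity p a) = -sgn (p a) := by
  rw [flipParity, sgn_add, sgn_one, mul_neg_one]

theorem shiftedWeight_flipParity (p : Fin (k + 1) → ZMod 2) (lam : Weight k) (a r : Fin (k + 1)) :
    shiftedWeight (flipParity p) lam a r = -shiftedWeight p lam a r := by
  simp only [shiftedWeight, sgn_flipParity, Finset.sum_neg_distrib]
  ring

theorem evensBefore_mono (p : Fin (k + 1) → ZMod 2) {a b : Fin (k + 1)} (h : b ≤ a) :
    evensBefore p b ≤ evensBefore p a :=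
  Finset.card_le_card fun c hc => by
    simp only [Finset.mem_filter] at hc ⊢
    exact ⟨hc.1, hc.2.1.trans_le h, hc.2.2⟩

theorem evensBefore_lt (p : Fin (k + 1) → ZMod 2) {a b : Fin (k + 1)} (h : b < a) (hb : p b = 0) :
    evensBefore p b < evensBefore p a := by
  refine Finset.card_lt_card ?_
  rw [Finset.ssubset_iff_of_subset fun c hc => by
    simp only [Finset.mem_filter] at hc ⊢
    exact ⟨hc.1, hc.2.1.trans h, hc.2.2⟩]
  exact ⟨b, by simp [h, hb], by simp⟩

theorem oddsBefore_mono (p : Fin (k + 1) → ZMod 2) {a b : Fin (k + 1)} (h : b ≤ a) :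
    oddsBefore p b ≤ oddsBefore p a := by
  rw [← evensBefore_flipParity, ← evensBefore_flipParity]
  exact evensBefore_mono _ h

theorem oddsBefore_lt (p : Fin (k + 1) → ZMod 2) {a b : Fin (k + 1)} (h : b < a) (hb : p b = 1) :
    oddsBefore p b < oddsBefore p a := by
  rw [← evensBefore_flipParity, ← evensBefore_flipParity]
  exact evensBefore_lt _ h (flipParity_eq_zero.2 hb)

theorem eq_of_evensBefore_eq {p : Fin (k + 1) → ZMod 2} {a b : Fin (k + 1)} (ha : p a = 0)
    (hb : p b = 0) (h : evensBefore p a = evensBefore p b) : a = b := by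
  rcases lt_trichotomy a b with hab | hab | hab
  · exact absurd h (evensBefore_lt p hab ha).ne
  · exact hab
  · exact absurd h (evensBefore_lt p hab hb).ne'

theorem exists_evensBefore_eq (p : Fin (k + 1) → ZMod 2) {i : ℕ}
    (hi : i < (Finset.univ.filter fun a => p a = 0).card) : ∃ a, p a = 0 ∧ evensBefore p a = i := by
  set S := Finset.univ.filter fun a => p a = 0 with hS
  have himage : S.image (evensBefore p) = Finset.range S.card := by
    refine Finset.eq_of_subset_of_card_le (fun x hx => ?_) ?_
    · obtain ⟨a, ha, rfl⟩ := Finset.mem_image.1 hx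
      rw [Finset.mem_range]
      refine Finset.card_lt_card ((Finset.ssubset_iff_of_subset fun c hc => ?_).2 ⟨a, ha, ?_⟩)
      · simp only [hS, Finset.mem_filter] at hc ⊢
        exact ⟨hc.1, hc.2.2⟩
      · simp
    · rw [Finset.card_range, Finset.card_image_of_injOn]
      intro a ha b hb hab
      exact eq_of_evensBefore_eq (Finset.mem_filter.1 ha).2 (Finset.mem_filter.1 hb).2 hab
  obtain ⟨a, ha, hai⟩ := Finset.mem_image.1 (himage ▸ Finset.mem_range.2 hi)
  exact ⟨a, (Finset.mem_filter.1 ha).2, hai⟩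

theorem exists_oddsBefore_eq (p : Fin (k + 1) → ZMod 2) {j : ℕ}
    (hj : j < (Finset.univ.filter fun a => p a = 1).card) : ∃ a, p a = 1 ∧ oddsBefore p a = j := by
  obtain ⟨a, h1, h2⟩ := exists_evensBefore_eq (flipParity p) (i := j)
    (by simpa only [flipParity_eq_zero] using hj)
  exact ⟨a, flipParity_eq_zero.1 h1, evensBefore_flipParity p a ▸ h2⟩

theorem evensBefore_add_oddsBefore (p : Fin (k + 1) → ZMod 2) (a : Fin (k + 1)) :
    evensBefore p a + oddsBefore p a = a := by
  rw [evensBefore, oddsBefore, ← Finset.card_union_of_disjoint]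
  · rw [← Finset.filter_or]
    have : (Finset.univ.filter fun b => b < a ∧ p b = 0 ∨ b < a ∧ p b = 1) = Finset.Iio a := by
      ext b
      simp [← and_or_left, zmod_two_cases (p b)]
    rw [this, Fin.card_Iio]
  · rw [Finset.disjoint_filter]
    rintro b - ⟨-, h0⟩ ⟨-, h1⟩
    rw [h0] at h1
    exact absurd h1 (by decide)

theorem evensBefore_lt_card {p : Fin (k + 1) → ZMod 2} {a : Fin (k + 1)} (ha : p a = 0) :
    evensBefore p a < (Finset.univ.filter fun a => p a = 0).card :=
  Finset.card_lt_card ((Finset.ssubset_iff_of_subset fun c hc => by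
    simp only [Finset.mem_filter] at hc ⊢
    exact ⟨hc.1, hc.2.2⟩).2 ⟨a, by simp [ha], by simp⟩)

theorem evensBefore_le_card (p : Fin (k + 1) → ZMod 2) (a : Fin (k + 1)) :
    evensBefore p a ≤ (Finset.univ.filter fun a => p a = 0).card :=
  Finset.card_le_card fun c hc => by
    simp only [Finset.mem_filter] at hc ⊢
    exact ⟨hc.1, hc.2.2⟩

theorem sum_sgn_Iio (p : Fin (k + 1) → ZMod 2) (a : Fin (k + 1)) :
    ∑ q ∈ Finset.Iio a, sgn (p q) = evensBefore p a - oddsBefore p a := by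
  have h : ∀ q, sgn (p q) = (if p q = 0 then 1 else 0) - (if p q = 1 then 1 else 0) := by
    intro q
    rcases zmod_two_cases (p q) with h | h <;> simp [h, sgn_zero, sgn_one]
  simp only [h, Finset.sum_sub_distrib, Finset.sum_boole, evensBefore, oddsBefore]
  congr 3 <;> ext b <;> simp

theorem sum_sgn_Ioo (p : Fin (k + 1) → ZMod 2) {a b : Fin (k + 1)} (h : b < a) :
    ∑ q ∈ Finset.Ioo b a, sgn (p q)
      = evensBefore p a - oddsBefore p a - (evensBefore p b - oddsBefore p b) - sgn (p b) := by
  rw [← sum_sgn_Iio, ← sum_sgn_Iio]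
  have h1 : Finset.Iio a = insert b (Finset.Iio b ∪ Finset.Ioo b a) := by
    ext c
    simp only [Finset.mem_Iio, Finset.mem_insert, Finset.mem_union, Finset.mem_Ioo]
    constructor
    · intro hc
      rcases lt_trichotomy c b with h' | h' | h'
      · exact Or.inr (Or.inl h')
      · exact Or.inl h'
      · exact Or.inr (Or.inr ⟨h', hc⟩)
    · rintro (rfl | h' | h')
      · exact h
      · exact h'.trans h
      · exact h'.2
  rw [h1, Finset.sum_insert (by simp), Finset.sum_union]
  · ring
  · rw [Finset.disjoint_left]
    intro c hc hc'
    exact absurd (Finset.mem_Iio.1 hc) (Finset.mem_Ioo.1 hc').1.asymm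

/-! ### Adding a box to a hook diagram -/

/-- The diagram `ρ` is `μ` together with the new box `(i, j)`. -/
def AddsBoxAt (μ ρ : YoungDiagram) (i j : ℕ) : Prop :=
  (i, j) ∉ μ ∧ ∀ x, x ∈ ρ ↔ x = (i, j) ∨ x ∈ μ

theorem exists_addsBoxAt {μ ρ : YoungDiagram} (h : AddsBox μ ρ) : ∃ i j, AddsBoxAt μ ρ i j := by
  obtain ⟨⟨i, j⟩, hx, hins⟩ := Finset.exists_eq_insert_iff.2
    ⟨YoungDiagram.cells_subset_iff.2 h.1, h.2.symm⟩
  refine ⟨i, j, by simpa using hx, fun x => ?_⟩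
  rw [← YoungDiagram.mem_cells, ← hins, Finset.mem_insert, YoungDiagram.mem_cells]

namespace AddsBoxAt

variable {μ ρ : YoungDiagram} {i j : ℕ}

theorem addsBox (h : AddsBoxAt μ ρ i j) : AddsBox μ ρ := by
  have := Finset.exists_eq_insert_iff.1 ⟨(i, j), (by simpa using h.1 : (i, j) ∉ μ.cells),
    (by ext x; simp [h.2] : insert (i, j) μ.cells = ρ.cells)⟩
  exact ⟨YoungDiagram.cells_subset_iff.1 this.1, this.2.symm⟩

theorem transpose (h : AddsBoxAt μ ρ i j) : AddsBoxAt μ.transpose ρ.transpose j i := by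
  refine ⟨by simpa using h.1, fun x => ?_⟩
  rw [YoungDiagram.mem_transpose, YoungDiagram.mem_transpose, h.2]
  obtain ⟨x₁, x₂⟩ := x
  simp [and_comm]

theorem mem_of_lt (h : AddsBoxAt μ ρ i j) {i' j' : ℕ} (hi : i' ≤ i) (hj : j' ≤ j)
    (hne : i' < i ∨ j' < j) : (i', j') ∈ μ := by
  have h1 : (i', j') ∈ ρ := ρ.up_left_mem hi hj ((h.2 _).2 (Or.inl rfl))
  refine ((h.2 _).1 h1).resolve_left fun h2 => ?_
  rw [Prod.mk.injEq] at h2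
  omega

theorem rowLen_self (h : AddsBoxAt μ ρ i j) : μ.rowLen i = j := by
  apply le_antisymm
  · by_contra! hlt
    exact h.1 (YoungDiagram.mem_iff_lt_rowLen.2 hlt)
  · by_contra! hlt
    exact absurd (YoungDiagram.mem_iff_lt_rowLen.1 (h.mem_of_lt le_rfl hlt.le (Or.inr hlt)))
      (lt_irrefl _)

theorem rowLen_new (h : AddsBoxAt μ ρ i j) (r : ℕ) :
    ρ.rowLen r = if r = i then j + 1 else μ.rowLen r := by
  refine eq_of_forall_lt_iff fun c => ?_
  rw [← YoungDiagram.mem_iff_lt_rowLen, h.2, YoungDiagram.mem_iff_lt_rowLen, Prod.mk.injEq]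
  split_ifs with hr
  · subst hr
    rw [h.rowLen_self]
    omega
  · simp [hr]

theorem colLen_self (h : AddsBoxAt μ ρ i j) : μ.colLen j = i := by
  rw [← YoungDiagram.rowLen_transpose]
  exact h.transpose.rowLen_self

theorem colLen_new (h : AddsBoxAt μ ρ i j) (r : ℕ) :
    ρ.colLen r = if r = j then i + 1 else μ.colLen r := by
  rw [← YoungDiagram.rowLen_transpose, ← YoungDiagram.rowLen_transpose]
  exact h.transpose.rowLen_new r

/-- A new box `(i, j)` which lies outside the columns of the odd vectors before the `i`-th even
vector `e_a` contributes to the weight at `e_a`. -/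
theorem hookWeight_eq (h : AddsBoxAt μ ρ i j) {p : Fin (k + 1) → ZMod 2} {a : Fin (k + 1)}
    (ha : p a = 0) (hi : evensBefore p a = i) (hj : oddsBefore p a ≤ j) :
    hookWeight p ρ = hookWeight p μ + eps a := by
  funext b
  simp only [hookWeight, Pi.add_apply, eps, Pi.single_apply]
  by_cases hba : b = a
  · subst hba
    rw [if_pos ha, if_pos ha, if_pos rfl, h.rowLen_new, if_pos hi, hi, h.rowLen_self,
      Nat.sub_add_comm hj]
    push_cast
    rfl
  rw [if_neg hba, add_zero]
  congr 1
  split_ifs with hb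
  · rw [h.rowLen_new, if_neg]
    intro hbi
    exact hba (eq_of_evensBefore_eq hb ha (hbi.trans hi.symm))
  · rw [h.colLen_new]
    split_ifs with hbj
    · have hb1 := ne_zero_iff_eq_one.1 hb
      have hab : a < b := by
        rcases lt_trichotomy a b with h' | h' | h'
        · exact h'
        · exact absurd h'.symm hba
        · exact absurd (oddsBefore_lt p h' hb1) (by omega)
      have := evensBefore_lt p hab ha
      rw [hbj, h.colLen_self]
      omega
    · rfl

/-- Positivity of the factors in the explicit formula for the Bethe roots. -/
theorem exists_shiftedWeight_eq (h : AddsBoxAt μ ρ i j) {p : Fin (k + 1) → ZMod 2}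
    {a : Fin (k + 1)} (ha : p a = 0) (hi : evensBefore p a = i) (hj : oddsBefore p a ≤ j)
    {b : Fin (k + 1)} (hb : b < a) :
    ∃ N : ℕ, 0 < N ∧ sgn (p b) * shiftedWeight p (hookWeight p μ) a b = N := by
  have hla : hookWeight p μ a = j - oddsBefore p a := by
    rw [hookWeight, if_pos ha, hi, h.rowLen_self, Nat.cast_sub hj]
  have hmono := oddsBefore_mono p hb.le
  rcases zmod_two_cases (p b) with hpb | hpb
  · have hlt := evensBefore_lt p hb hpb
    have hrow : j < μ.rowLen (evensBefore p b) :=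
      YoungDiagram.mem_iff_lt_rowLen.1 (h.mem_of_lt (by omega) le_rfl (Or.inl (by omega)))
    have hlb : hookWeight p μ b = μ.rowLen (evensBefore p b) - oddsBefore p b := by
      rw [hookWeight, if_pos hpb, Nat.cast_sub (by omega)]
    refine ⟨(μ.rowLen (evensBefore p b) - j - 1) + (i - evensBefore p b), by omega, ?_⟩
    rw [shiftedWeight, sum_sgn_Ioo p hb, hla, hlb, ha, hpb, sgn_zero, hi, Nat.cast_add,
      Nat.cast_sub (by omega), Nat.cast_sub (by omega), Nat.cast_sub (by omega)]
    push_cast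
    ring
  · have hlt := oddsBefore_lt p hb hpb
    have hmono' := evensBefore_mono p hb.le
    have hcol : i < μ.colLen (oddsBefore p b) :=
      YoungDiagram.mem_iff_lt_colLen.1 (h.mem_of_lt le_rfl (by omega) (Or.inr (by omega)))
    have hlb : hookWeight p μ b = μ.colLen (oddsBefore p b) - evensBefore p b := by
      rw [hookWeight, if_neg (by rw [hpb]; decide), Nat.cast_sub (by omega)]
    refine ⟨(μ.colLen (oddsBefore p b) - i - 1) + (j - oddsBefore p b), by omega, ?_⟩
    rw [shiftedWeight, sum_sgn_Ioo p hb, hla, hlb, ha, hpb, sgn_zero, sgn_one, hi, Nat.cast_add,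
      Nat.cast_sub (by omega), Nat.cast_sub (by omega), Nat.cast_sub (by omega)]
    push_cast
    ring

end AddsBoxAt

/-- Each box of the hook belongs either to the row of an even vector or to the column of an odd one:
to the one of these two vectors which comes first in the basis. -/
theorem exists_even_or_odd_owner {m n : ℕ} {p : Fin (k + 1) → ZMod 2}
    (hm : (Finset.univ.filter fun a => p a = 0).card = m)
    (hn : (Finset.univ.filter fun a => p a = 1).card = n) {i j : ℕ} (hij : i < m ∨ j < n) :
    (∃ a, p a = 0 ∧ evensBefore p a = i ∧ oddsBefore p a ≤ j) ∨
      ∃ a, p a = 1 ∧ oddsBefore p a = j ∧ evensBefore p a ≤ i := by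
  have hodd : ∀ {j : ℕ}, j < n → ∃ a, p a = 1 ∧ oddsBefore p a = j := fun h =>
    exists_oddsBefore_eq p (by rwa [hn])
  by_cases hi : i < m
  · obtain ⟨a, ha, hai⟩ := exists_evensBefore_eq p (i := i) (by rwa [hm])
    by_cases hj : oddsBefore p a ≤ j
    · exact Or.inl ⟨a, ha, hai, hj⟩
    · push Not at hj
      have hle : oddsBefore p a ≤ n := by
        have := evensBefore_le_card (flipParity p) a
        simpa only [flipParity_eq_zero, evensBefore_flipParity, hn] using this
      obtain ⟨b, hb, hbj⟩ := hodd (hj.trans_le hle)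
      refine Or.inr ⟨b, hb, hbj, ?_⟩
      rw [← hai]
      refine evensBefore_mono p (le_of_not_gt fun h => ?_)
      have := oddsBefore_mono p h.le
      omega
  · obtain ⟨b, hb, hbj⟩ := hodd (hij.resolve_left hi)
    refine Or.inr ⟨b, hb, hbj, ?_⟩
    have := evensBefore_le_card p b
    omega

/-- Adding a box to a hook diagram adds some `ε_a` to the highest weight. -/
theorem exists_hookWeight_eq_add_eps {m n : ℕ} {p : Fin (k + 1) → ZMod 2}
    (hm : (Finset.univ.filter fun a => p a = 0).card = m)
    (hn : (Finset.univ.filter fun a => p a = 1).card = n) {μ ρ : YoungDiagram}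
    (hρ : IsHook m n ρ) (hadd : AddsBox μ ρ) :
    ∃ a, hookWeight p ρ = hookWeight p μ + eps a ∧ ∀ b < a, ∃ N : ℕ, 0 < N ∧
      sgn (p b) * shiftedWeight p (hookWeight p μ) a b = N := by
  obtain ⟨i, j, h⟩ := exists_addsBoxAt hadd
  have hij : i < m ∨ j < n := by
    by_contra! hij
    exact hρ (ρ.up_left_mem hij.1 hij.2 ((h.2 _).2 (Or.inl rfl)))
  rcases exists_even_or_odd_owner hm hn hij with ⟨a, h1, h2, h3⟩ | ⟨a, h1, h2, h3⟩
  · exact ⟨a, h.hookWeight_eq h1 h2 h3, fun b hb => h.exists_shiftedWeight_eq h1 h2 h3 hb⟩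
  · rw [← evensBefore_flipParity] at h2
    rw [← oddsBefore_flipParity] at h3
    rw [← flipParity_eq_zero] at h1
    refine ⟨a, ?_, fun b hb => ?_⟩
    · have := h.transpose.hookWeight_eq h1 h2 h3
      rwa [hookWeight_flipParity, hookWeight_flipParity] at this
    · have := h.transpose.exists_shiftedWeight_eq h1 h2 h3 hb
      rwa [hookWeight_flipParity, shiftedWeight_flipParity, sgn_flipParity, neg_mul_neg] at this

/-- If `e_a` is even and `λ(μ) + ε_a` satisfies the dominance and hook conditions at `e_a`, a box
can be added to the row of `e_a`. -/
theorem exists_addsBox_of_even {m n : ℕ} {p : Fin (k + 1) → ZMod 2}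
    (hm : (Finset.univ.filter fun a => p a = 0).card = m) {μ : YoungDiagram} (hμ : IsHook m n μ)
    {a : Fin (k + 1)} (ha : p a = 0) {N : Fin (k + 1) → ℕ} (hN : ∀ b, hookWeight p μ b = N b)
    (h1 : ∀ b < a, p b = p a → (∀ c, b < c → c < a → p c ≠ p a) → N a + 1 + (a - b - 1 : ℕ) ≤ N b)
    (h2 : ∀ o < a, p o ≠ p a → (∀ c, o < c → c < a → p c = p a) → (a - o : ℕ) ≤ N o) :
    ∃ ρ, IsHook m n ρ ∧ AddsBox μ ρ ∧ hookWeight p ρ = hookWeight p μ + eps a := by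
  have hNeven : ∀ b, p b = 0 → N b = μ.rowLen (evensBefore p b) - oddsBefore p b := by
    intro b hb
    have := hN b
    rw [hookWeight, if_pos hb] at this
    exact_mod_cast this.symm
  have hNodd : ∀ b, p b = 1 → N b = μ.colLen (oddsBefore p b) - evensBefore p b := by
    intro b hb
    have := hN b
    rw [hookWeight, if_neg (by rw [hb]; decide)] at this
    exact_mod_cast this.symm
  set i := evensBefore p a with hi
  set d := oddsBefore p a with hd
  have hia : i + d = a := evensBefore_add_oddsBefore p a
  have hNa := hNeven a ha
  rw [← hi, ← hd] at hNa
  set j := d + N a with hj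
  have hup : 0 < i → (i - 1, j) ∈ μ := by
    intro hi0
    obtain ⟨b, hb, hbi⟩ := exists_evensBefore_eq p (i := i - 1)
      (by have := evensBefore_lt_card ha; omega)
    have hba : b < a := by
      by_contra! h
      have := evensBefore_mono p h
      omega
    have := h1 b hba (hb.trans ha.symm) fun c hbc hca hc => by
      have h3 := evensBefore_lt p hbc hb
      have h4 := evensBefore_lt p hca (hc.trans ha)
      omega
    have hsum := evensBefore_add_oddsBefore p b
    have hba' : (b : ℕ) < a := hba
    rw [hNeven b hb, hbi] at this
    rw [YoungDiagram.mem_iff_lt_rowLen]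
    omega
  have hleft : 0 < j → (i, j - 1) ∈ μ := by
    intro hj0
    rcases Nat.eq_zero_or_pos (N a) with h0 | h0
    · obtain ⟨o, ho, hod⟩ := exists_oddsBefore_eq p (j := d - 1) (by
        have := evensBefore_le_card (flipParity p) a
        simp only [flipParity_eq_zero, evensBefore_flipParity] at this
        omega)
      have hoa : o < a := by
        by_contra! h
        have := oddsBefore_mono p h
        omega
      have := h2 o hoa (by rw [ho, ha]; decide) fun c hoc hca => by
        rcases zmod_two_cases (p c) with hc | hc
        · exact hc.trans ha.symm
        · have h3 := oddsBefore_lt p hoc ho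
          have h4 := oddsBefore_lt p hca hc
          omega
      have hsum := evensBefore_add_oddsBefore p o
      have hoa' : (o : ℕ) < a := hoa
      rw [hNodd o ho, hod] at this
      have hjd : j - 1 = d - 1 := by omega
      rw [hjd, YoungDiagram.mem_iff_lt_colLen]
      omega
    · rw [YoungDiagram.mem_iff_lt_rowLen]
      omega
  have hnot : (i, j) ∉ μ := by
    rw [YoungDiagram.mem_iff_lt_rowLen]
    omega
  let ρ : YoungDiagram :=
    { cells := insert (i, j) μ.cells
      isLowerSet := by
        rintro ⟨x₁, x₂⟩ ⟨y₁, y₂⟩ hyx hx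
        rw [Finset.mem_coe, Finset.mem_insert] at hx ⊢
        have hy1 : y₁ ≤ x₁ := hyx.1
        have hy2 : y₂ ≤ x₂ := hyx.2
        rcases hx with hx | hx
        · rw [Prod.mk.injEq] at hx
          by_cases hc1 : y₁ < i
          · exact Or.inr (μ.up_left_mem (by omega) (by omega) (hup (by omega)))
          · by_cases hc2 : y₂ < j
            · exact Or.inr (μ.up_left_mem (by omega) (by omega) (hleft (by omega)))
            · left
              rw [Prod.mk.injEq]
              omega
        · exact Or.inr (μ.up_left_mem hy1 hy2 hx) }
  have hbox : AddsBoxAt μ ρ i j := by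
    refine ⟨hnot, fun x => ?_⟩
    rw [← YoungDiagram.mem_cells, Finset.mem_insert, YoungDiagram.mem_cells]
  refine ⟨ρ, fun h => ?_, hbox.addsBox, hbox.hookWeight_eq ha hi.symm (by omega)⟩
  rcases (hbox.2 _).1 h with h | h
  · have := evensBefore_lt_card ha
    rw [Prod.mk.injEq] at h
    omega
  · exact hμ h

theorem exists_addsBox {m n : ℕ} {p : Fin (k + 1) → ZMod 2}
    (hm : (Finset.univ.filter fun a => p a = 0).card = m)
    (hn : (Finset.univ.filter fun a => p a = 1).card = n) {μ : YoungDiagram} (hμ : IsHook m n μ)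
    {a : Fin (k + 1)} {N : Fin (k + 1) → ℕ} (hN : ∀ b, hookWeight p μ b = N b)
    (h1 : ∀ b < a, p b = p a → (∀ c, b < c → c < a → p c ≠ p a) → N a + 1 + (a - b - 1 : ℕ) ≤ N b)
    (h2 : ∀ o < a, p o ≠ p a → (∀ c, o < c → c < a → p c = p a) → (a - o : ℕ) ≤ N o) :
    ∃ ρ, IsHook m n ρ ∧ AddsBox μ ρ ∧ hookWeight p ρ = hookWeight p μ + eps a := by
  rcases zmod_two_cases (p a) with ha | ha
  · exact exists_addsBox_of_even hm hμ ha hN h1 h2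
  · have hflip : ∀ b, flipParity p b = flipParity p a ↔ p b = p a := fun b => by
      simp [flipParity]
    obtain ⟨ρ, hρ, hadd, hw⟩ := exists_addsBox_of_even (p := flipParity p) (m := n) (n := m)
      (μ := μ.transpose) (a := a) (N := N) (by simpa only [flipParity_eq_zero] using hn)
      (by simpa [IsHook] using hμ) (flipParity_eq_zero.2 ha)
      (by simpa only [hookWeight_flipParity] using hN)
      (by simpa only [hflip, ne_eq] using h1) (by simpa only [hflip, ne_eq] using h2)
    refine ⟨ρ.transpose, by simpa [IsHook] using hρ, ?_, ?_⟩
    · obtain ⟨i, j, h⟩ := exists_addsBoxAt hadd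
      have := h.transpose.addsBox
      rwa [YoungDiagram.transpose_transpose] at this
    · rw [← hookWeight_flipParity p μ, ← hw, ← hookWeight_flipParity p,
        YoungDiagram.transpose_transpose]

/-! ### The chain form of the Bethe equations -/

/-- The equations of a chain `y 0, …, y A` with nearest neighbour interaction, solved from the end
of the chain. -/
theorem chain_equations_iff {A : ℕ} {s κ lt y : ℕ → ℂ}
    (hκ : ∀ b < A, lt b = κ b + if b + 1 < A then s (b + 1) + lt (b + 1) else 0)
    (hs : ∀ b < A, s b ≠ 0) (hlt : ∀ b < A, lt b ≠ 0) (hden : ∀ b < A, lt b + s b ≠ 0)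
    (hy0 : y 0 ≠ 0) :
    (∀ b < A, y (b + 1) ≠ y b ∧ (κ b ≠ 0 → y (b + 1) ≠ 0) ∧
      κ b / y (b + 1) + s b / (y (b + 1) - y b)
        + (if b + 1 < A then s (b + 1) / (y (b + 1) - y (b + 2)) else 0) = 0) ↔
    ∀ b < A, y (b + 1) = lt b / (lt b + s b) * y b := by
  -- The interaction with the next variable, once that variable is known.
  have hnext : ∀ b, b + 1 < A → y (b + 2) = lt (b + 1) / (lt (b + 1) + s (b + 1)) * y (b + 1) →
      y (b + 1) ≠ 0 → s (b + 1) / (y (b + 1) - y (b + 2)) = (s (b + 1) + lt (b + 1)) / y (b + 1) := by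
    intro b hb h h0
    have h1 := hs _ hb
    have h2 := hden _ hb
    have h3 : y (b + 1) - y (b + 2) = s (b + 1) * y (b + 1) / (lt (b + 1) + s (b + 1)) := by
      rw [h]
      field_simp
      ring
    rw [h3]
    field_simp
    ring
  constructor
  · intro h
    suffices ∀ n b, b + n + 1 = A → y (b + 1) = lt b / (lt b + s b) * y b from
      fun b hb => this (A - b - 1) b (by omega)
    intro n
    induction n with
    | zero =>
      intro b hb
      have hbA : b < A := by omega
      obtain ⟨h1, h2, h3⟩ := h b hbA
      have hk := hκ b hbA
      rw [if_neg (by omega), add_zero] at hk h3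
      have h4 := h2 (hk ▸ hlt b hbA)
      have h5 := sub_ne_zero.2 h1
      have h6 := hden b hbA
      rw [← hk] at h3
      field_simp at h3 ⊢
      linear_combination h3
    | succ n ih =>
      intro b hb
      have hbA : b < A := by omega
      have hbA' : b + 1 < A := by omega
      obtain ⟨h1, h2, h3⟩ := h b hbA
      have h7 := ih (b + 1) (by omega)
      have h4 : y (b + 1) ≠ 0 := by
        intro h0
        refine (h (b + 1) hbA').1 ?_
        rw [h7, h0, mul_zero]
      have hk := hκ b hbA
      rw [if_pos hbA'] at hk h3
      rw [hnext b hbA' h7 h4] at h3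
      have h5 := sub_ne_zero.2 h1
      have h6 := hden b hbA
      have h8 : lt b / y (b + 1) + s b / (y (b + 1) - y b) = 0 := by
        rw [hk, ← h3]
        ring
      field_simp at h8 ⊢
      linear_combination h8
  · intro h
    have hne : ∀ b ≤ A, y b ≠ 0 := by
      intro b
      induction b with
      | zero => exact fun _ => hy0
      | succ b ih =>
        intro hb
        rw [h b hb]
        exact mul_ne_zero (div_ne_zero (hlt b hb) (hden b hb)) (ih (by omega))
    intro b hb
    have h0 := hne b hb.le
    have h1 := hne (b + 1) hb
    have h2 := hs b hb
    have h3 := hden b hb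
    have h5 := hlt b hb
    have h4 : y (b + 1) - y b = -(s b * y b / (lt b + s b)) := by
      rw [h b hb]
      field_simp
      ring
    refine ⟨sub_ne_zero.1 (h4 ▸ neg_ne_zero.2 (div_ne_zero (mul_ne_zero h2 h0) h3)),
      fun _ => h1, ?_⟩
    have hif : κ b / y (b + 1) + s b / (y (b + 1) - y b)
        + (if b + 1 < A then s (b + 1) / (y (b + 1) - y (b + 2)) else 0)
        = lt b / y (b + 1) + s b / (y (b + 1) - y b) := by
      rw [hκ b hb]
      split_ifs with hb'
      · rw [hnext b hb' (h (b + 1) hb') h1]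
        ring
      · ring
    rw [hif, h4, h b hb]
    field_simp
    ring

/-- A sum over indices at most one of which satisfies `P`. -/
theorem sum_ite_eq_of_unique {ι : Type*} (S : Finset ι) (P : ι → Prop) [DecidablePred P] (Q : Prop)
    [Decidable Q] (x : ℂ) (hP : ∀ i ∈ S, ∀ j ∈ S, P i → P j → i = j) (hQ : Q ↔ ∃ i ∈ S, P i) :
    (∑ i ∈ S, if P i then x else 0) = if Q then x else 0 := by
  by_cases h : Q
  · obtain ⟨i, hi, hPi⟩ := hQ.1 h
    rw [if_pos h, Finset.sum_eq_single_of_mem i hi, if_pos hPi]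
    intro j hj hji
    rw [if_neg fun hPj => hji (hP j hj i hi hPj hPi)]
  · rw [if_neg h]
    refine Finset.sum_eq_zero fun i hi => if_neg fun hPi => h (hQ.2 ⟨i, hi, hPi⟩)

theorem form_simpleRoot_simpleRoot (p : Fin (k + 1) → ZMod 2) {b b' : Fin k} (h : b ≠ b') :
    form p (simpleRoot b) (simpleRoot b')
      = (if (b' : ℕ) + 1 = b then -sgn (p b.castSucc) else 0)
        + (if (b : ℕ) + 1 = b' then -sgn (p b.succ) else 0) := by
  have h' : (b : ℕ) ≠ b' := fun e => h (Fin.ext e)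
  rw [form_simpleRoot]
  simp only [simpleRoot, eps, Pi.sub_apply, Pi.single_apply, Fin.ext_iff, Fin.val_castSucc,
    Fin.val_succ]
  rw [if_neg h', if_neg (by omega : ¬ (b : ℕ) + 1 = b' + 1)]
  by_cases h1 : (b' : ℕ) + 1 = b
  · rw [if_pos h1, if_pos h1.symm, if_neg (by omega), if_neg (by omega)]
    ring
  · rw [if_neg h1, if_neg (Ne.symm h1)]
    split_ifs <;> ring

theorem form_simpleRoot_eps_zero {p : Fin (k + 1) → ZMod 2} (hp : p 0 = 0) (b : Fin k) :
    form p (simpleRoot b) (eps 0) = if (b : ℕ) = 0 then 1 else 0 := by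
  rw [form_simpleRoot, eps, Pi.single_eq_of_ne (Fin.succ_ne_zero b), mul_zero, sub_zero]
  split_ifs with h
  · have h0 : b.castSucc = 0 := Fin.ext h
    rw [h0, hp, sgn_zero, Pi.single_eq_same, one_mul]
  · have h0 : b.castSucc ≠ 0 := fun e => h (congrArg Fin.val e)
    rw [Pi.single_eq_of_ne h0, mul_zero]

/-- For one variable of each colour `b < a`, the Bethe equations are those of a chain which starts at
the point `T 0 = z₁`. -/
theorem isBetheSolution_iff_chain {p : Fin (k + 1) → ZMod 2} (hp : p 0 = 0) {lam : Weight k}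
    {z₁ z₂ : ℂ} {a : Fin (k + 1)} {l : ℕ} {c : Fin l → Fin k} (hinj : Function.Injective c)
    (hc : ∀ b, (∃ i, c i = b) ↔ b.castSucc < a) {t : Fin l → ℂ} {T : ℕ → ℂ} (hT0 : T 0 = z₁)
    (hT : ∀ i, T (c i + 1) = t i) :
    IsBetheSolution p ![eps 0, lam] ![z₁, z₂] c t ↔ ∀ b : Fin k, b.castSucc < a →
      T (b + 1) ≠ T b ∧ (form p (simpleRoot b) lam ≠ 0 → T (b + 1) ≠ z₂) ∧
      form p (simpleRoot b) lam / (T (b + 1) - z₂) + sgn (p b.castSucc) / (T (b + 1) - T b)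
        + (if (b : ℕ) + 1 < a then sgn (p b.succ) / (T (b + 1) - T (b + 2)) else 0) = 0 := by
  have hca : ∀ i, (c i : ℕ) < a := fun i => (hc (c i)).1 ⟨i, rfl⟩
  have hsurj : ∀ n : ℕ, n < a → ∃ i, (c i : ℕ) = n := by
    intro n hn
    obtain ⟨i, hi⟩ := (hc ⟨n, by omega⟩).2 hn
    exact ⟨i, by rw [hi]⟩
  -- The left hand side of the Bethe equation of `t i`.
  have hsum : ∀ i, -(∑ s, form p (simpleRoot (c i)) ((![eps 0, lam] : Fin 2 → Weight k) s)
        / (t i - (![z₁, z₂] : Fin 2 → ℂ) s))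
      + ∑ j ∈ Finset.univ.erase i,
          form p (simpleRoot (c i)) (simpleRoot (c j)) / (t i - t j)
      = -(form p (simpleRoot (c i)) lam / (T (c i + 1) - z₂)
          + sgn (p (c i).castSucc) / (T (c i + 1) - T (c i))
        + (if (c i : ℕ) + 1 < a then sgn (p (c i).succ) / (T (c i + 1) - T (c i + 2)) else 0)) := by
    intro i
    have h1 : ∀ j ∈ Finset.univ.erase i,
        form p (simpleRoot (c i)) (simpleRoot (c j)) / (t i - t j)
        = (if (c j : ℕ) + 1 = c i then -sgn (p (c i).castSucc) / (T (c i + 1) - T (c i)) else 0)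
        + (if (c i : ℕ) + 1 = c j then -sgn (p (c i).succ) / (T (c i + 1) - T (c i + 2)) else 0) := by
      intro j hj
      rw [form_simpleRoot_simpleRoot p fun h => (Finset.mem_erase.1 hj).1 (hinj h).symm, ← hT, ← hT]
      by_cases hl : (c j : ℕ) + 1 = c i
      · rw [if_pos hl, if_pos hl, if_neg (by omega), if_neg (by omega), hl, add_zero, add_zero]
      · rw [if_neg hl, if_neg hl, zero_add, zero_add]
        split_ifs with hr
        · rw [← hr]
        · rw [zero_div]
    rw [Finset.sum_congr rfl h1, Finset.sum_add_distrib,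
      sum_ite_eq_of_unique _ _ (0 < (c i : ℕ)) _ (fun j _ j' _ h h' => hinj (Fin.ext (by omega))),
      sum_ite_eq_of_unique _ _ ((c i : ℕ) + 1 < a) _
        (fun j _ j' _ h h' => hinj (Fin.ext (by omega))), Fin.sum_univ_two]
    · simp only [Matrix.cons_val_zero, Matrix.cons_val_one, form_simpleRoot_eps_zero hp, ← hT]
      rcases Nat.eq_zero_or_pos (c i : ℕ) with h0 | h0
      · have h0' : (c i).castSucc = 0 := Fin.ext h0
        rw [if_pos h0, if_neg (by omega), h0', hp, sgn_zero, h0, hT0]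
        split_ifs <;> ring
      · rw [if_neg (by omega), if_pos h0]
        split_ifs <;> ring
    · constructor
      · intro h
        obtain ⟨j, hj⟩ := hsurj _ h
        refine ⟨j, Finset.mem_erase.2 ⟨?_, Finset.mem_univ _⟩, hj.symm⟩
        rintro rfl
        omega
      · rintro ⟨j, -, hj⟩
        rw [hj]
        exact hca j
    · constructor
      · intro h
        obtain ⟨j, hj⟩ := hsurj (c i - 1) (by have := hca i; omega)
        refine ⟨j, Finset.mem_erase.2 ⟨?_, Finset.mem_univ _⟩, by omega⟩
        rintro rfl
        omega
      · rintro ⟨j, -, hj⟩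
        omega
  constructor
  · intro h b hb
    obtain ⟨i, rfl⟩ := (hc b).2 hb
    refine ⟨?_, ?_, ?_⟩
    · rcases Nat.eq_zero_or_pos (c i : ℕ) with h0 | h0
      · have := h.ne_site i 0 (by simp [form_simpleRoot_eps_zero hp, h0])
        rw [hT, h0, hT0]
        simpa using this
      · obtain ⟨j, hj⟩ := hsurj (c i - 1) (by have := hca i; omega)
        have hij : i ≠ j := by rintro rfl; omega
        have := h.ne_root i j hij (by
          rw [form_simpleRoot_simpleRoot p fun h => hij (hinj h), if_pos (by omega),
            if_neg (by omega), add_zero]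
          exact neg_ne_zero.2 (sgn_ne_zero _))
        have hj' : (c i : ℕ) = c j + 1 := by omega
        rwa [← hT i, ← hT j, ← hj'] at this
    · intro h0
      have := h.ne_site i 1 (by simpa using h0)
      rw [hT]
      simpa using this
    · have := h.equation i
      rw [hsum i] at this
      exact neg_eq_zero.1 this
  · intro h
    refine ⟨fun i s hs => ?_, fun i j hij hne => ?_, fun i => ?_⟩
    · fin_cases s
      · have h1 : form p (simpleRoot (c i)) (eps 0) ≠ 0 := hs
        rw [form_simpleRoot_eps_zero hp] at h1
        have h0 : (c i : ℕ) = 0 := by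
          by_contra h0
          exact h1 (if_neg h0)
        have := (h (c i) (hca i)).1
        rw [hT, h0, hT0] at this
        exact this
      · have := (h (c i) (hca i)).2.1 hs
        rw [hT] at this
        exact this
    · rw [form_simpleRoot_simpleRoot p fun h => hij (hinj h)] at hne
      rw [← hT i, ← hT j]
      by_cases h1 : (c j : ℕ) + 1 = c i
      · rw [h1]
        exact (h (c i) (hca i)).1
      · by_cases h2 : (c i : ℕ) + 1 = c j
        · rw [h2]
          exact (h (c j) (hca j)).1.symm
        · rw [if_neg h1, if_neg h2, add_zero] at hne
          exact absurd rfl hne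
    · rw [hsum i, (h (c i) (hca i)).2.2, neg_zero]

/-! ### The weight of a Bethe vector determines the number of variables of each colour -/

/-- The sum of the first `b + 1` coordinates of a weight. -/
def partialSum (b : Fin k) : Weight k →ₗ[ℂ] ℂ := ∑ r ∈ Finset.Iic b.castSucc, LinearMap.proj r

theorem partialSum_eps (b : Fin k) (a : Fin (k + 1)) :
    partialSum b (eps a) = if a ≤ b.castSucc then 1 else 0 := by
  simp [partialSum, eps, Pi.single_apply, LinearMap.sum_apply]

theorem partialSum_rootSum (b : Fin k) (l : Fin k → ℕ) : partialSum b (rootSum l) = l b := by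
  rw [rootSum, map_sum, Finset.sum_eq_single b]
  · rw [map_smul, simpleRoot, map_sub, partialSum_eps, partialSum_eps, if_pos le_rfl,
      if_neg (not_le.2 Fin.castSucc_lt_succ)]
    simp
  · intro b' _ hb'
    rw [map_smul, simpleRoot, map_sub, partialSum_eps, partialSum_eps]
    have h' : (b' : ℕ) ≠ b := fun e => hb' (Fin.ext e)
    by_cases h : (b' : ℕ) ≤ b
    · rw [if_pos (by rw [Fin.le_def]; exact h), if_pos (by rw [Fin.le_def]; simp; omega)]
      simp
    · rw [if_neg (by rw [Fin.le_def]; exact h), if_neg (by rw [Fin.le_def]; simp; omega)]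
      simp
  · simp

theorem rootSum_initialColours (a : Fin (k + 1)) : rootSum (initialColours a) = eps 0 - eps a := by
  induction a using Fin.induction with
  | zero => simp [rootSum, initialColours]
  | succ b ih =>
    have h : rootSum (initialColours b.succ) = rootSum (initialColours b.castSucc) + simpleRoot b := by
      have h1 : simpleRoot b = ∑ b', (if b' = b then (1 : ℂ) else 0) • simpleRoot b' := by
        simp [ite_smul]
      rw [rootSum, rootSum, h1, ← Finset.sum_add_distrib]
      refine Finset.sum_congr rfl fun b' _ => ?_
      rw [← add_smul]
      congr 1
      simp only [initialColours, Fin.lt_def, Fin.val_castSucc, Fin.val_succ, Fin.ext_iff]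
      rcases lt_trichotomy (b' : ℕ) b with h' | h' | h'
      · rw [if_pos (by omega), if_pos h', if_neg (by omega)]; simp
      · rw [if_pos (by omega), if_neg (by omega), if_pos h']; simp
      · rw [if_neg (by omega), if_neg (by omega), if_neg (by omega)]; simp
    rw [h, ih, simpleRoot]
    abel

theorem weightAtInfinity_eq_iff (lam : Weight k) (x : BethePoint k) (a : Fin (k + 1)) :
    weightAtInfinity lam x = lam + eps a ↔ x.1 = initialColours a := by
  rw [weightAtInfinity]
  constructor
  · intro h
    have h' : rootSum x.1 = eps 0 - eps a := by
      rw [sub_eq_iff_eq_add] at h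
      rw [eq_sub_iff_add_eq]
      have : lam + eps 0 = lam + (rootSum x.1 + eps a) := by
        rw [add_comm lam (eps 0), h]
        abel
      exact (add_left_cancel this).symm
    funext b
    have h1 := partialSum_rootSum b x.1
    rw [h', map_sub, partialSum_eps, partialSum_eps, if_pos (Fin.zero_le _)] at h1
    rw [initialColours]
    split_ifs at h1 with h2
    · rw [if_neg (not_lt.2 h2)]
      have : ((x.1 b : ℕ) : ℂ) = 0 := by rw [← h1]; ring
      exact_mod_cast this
    · rw [if_pos (not_le.1 h2)]
      have : ((x.1 b : ℕ) : ℂ) = 1 := by rw [← h1]; ring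
      exact_mod_cast this
  · intro h
    rw [h, rootSum_initialColours]
    abel

/-! ### The explicit solution -/

section Explicit

variable (C : Colouring k) (a : Fin (k + 1))

theorem colour_initialColours_injective : Function.Injective (C.colour (initialColours a)) := by
  intro i j hij
  have h := C.card_colour (initialColours a) (C.colour (initialColours a) i)
  have hle : (Finset.univ.filter fun j => C.colour (initialColours a) j
      = C.colour (initialColours a) i).card ≤ 1 := by
    rw [h, initialColours]
    split_ifs <;> omega
  exact Finset.card_le_one.1 hle i (by simp) j (by simp [hij])

theorem exists_colour_initialColours_eq (b : Fin k) :
    (∃ i, C.colour (initialColours a) i = b) ↔ b.castSucc < a := by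
  have h := C.card_colour (initialColours a) b
  constructor
  · rintro ⟨i, hi⟩
    by_contra hb
    rw [initialColours, if_neg hb, Finset.card_eq_zero, Finset.filter_eq_empty_iff] at h
    exact h (Finset.mem_univ i) hi
  · intro hb
    rw [initialColours, if_pos hb] at h
    obtain ⟨i, hi⟩ := Finset.card_pos.1 (h.symm ▸ Nat.one_pos)
    exact ⟨i, (Finset.mem_filter.1 hi).2⟩

variable {C a} {p : Fin (k + 1) → ZMod 2} {lam : Weight k} {z₁ z₂ : ℂ}

/-- The recursion which arises when the chain of Bethe equations is solved from its last variable. -/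
theorem shiftedWeight_rec (b : Fin k) (hb : b.castSucc < a) :
    shiftedWeight p lam a b.castSucc = form p (simpleRoot b) lam
      + if (b : ℕ) + 1 < a then sgn (p b.succ) + shiftedWeight p lam a b.succ else 0 := by
  rw [form_simpleRoot, shiftedWeight]
  have hle : (b : ℕ) < a := hb
  split_ifs with h
  · have hIoo : Finset.Ioo b.castSucc a = insert b.succ (Finset.Ioo b.succ a) := by
      ext c
      simp only [Finset.mem_insert, Finset.mem_Ioo, Fin.lt_def, Fin.val_castSucc, Fin.val_succ,
        Fin.ext_iff]
      omega
    rw [hIoo, Finset.sum_insert (by simp), shiftedWeight]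
    ring
  · have hba : b.succ = a := by
      rw [Fin.ext_iff, Fin.val_succ]
      omega
    have hIoo : Finset.Ioo b.castSucc a = ∅ := by
      ext c
      simp only [Finset.mem_Ioo, Fin.lt_def, Fin.val_castSucc, Finset.notMem_empty, iff_false]
      omega
    rw [hIoo, Finset.sum_empty, ← hba]

/-- The factors of the explicit formula, indexed by natural numbers. -/
def rootFactor (p : Fin (k + 1) → ZMod 2) (lam : Weight k) (a : Fin (k + 1)) (r : ℕ) : ℂ :=
  shiftedWeight p lam a (Fin.ofNat (k + 1) r)
    / (shiftedWeight p lam a (Fin.ofNat (k + 1) r) + sgn (p (Fin.ofNat (k + 1) r)))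

theorem explicitRoot_eq (b : Fin k) : explicitRoot p lam z₁ z₂ a b
    = z₂ + (z₁ - z₂) * ∏ r ∈ Finset.range (b + 1), rootFactor p lam a r := by
  rw [explicitRoot]
  congr 2
  have h := Finset.prod_map (Finset.Iic b.castSucc) Fin.valEmbedding (rootFactor p lam a)
  rw [Fin.map_valEmbedding_Iic, Fin.val_castSucc, ← Nat.range_succ_eq_Iic] at h
  rw [h]
  refine Finset.prod_congr rfl fun r _ => ?_
  rw [rootFactor, Fin.valEmbedding_apply, Fin.ofNat_val_eq_self, add_comm]

theorem shiftedWeight_ne_zero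
    (hpos : ∀ b < a, ∃ N : ℕ, 0 < N ∧ sgn (p b) * shiftedWeight p lam a b = N)
    {b : Fin (k + 1)} (hb : b < a) : shiftedWeight p lam a b ≠ 0 := by
  obtain ⟨N, hN, h⟩ := hpos b hb
  intro h0
  rw [h0, mul_zero] at h
  have : N = 0 := by exact_mod_cast h.symm
  omega

theorem shiftedWeight_add_sgn_ne_zero
    (hpos : ∀ b < a, ∃ N : ℕ, 0 < N ∧ sgn (p b) * shiftedWeight p lam a b = N)
    {b : Fin (k + 1)} (hb : b < a) :
    shiftedWeight p lam a b + sgn (p b) ≠ 0 := by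
  obtain ⟨N, hN, h⟩ := hpos b hb
  intro h0
  have h1 : ((N + 1 : ℕ) : ℂ) = 0 := by
    push_cast
    rw [← h]
    linear_combination sgn (p b) * h0 - sgn_mul_self (p b)
  exact Nat.succ_ne_zero N (by exact_mod_cast h1)

/-- The factors are of the form `N / (N + 1)` with a positive integer `N`. -/
theorem norm_rootFactor_lt_one
    (hpos : ∀ b < a, ∃ N : ℕ, 0 < N ∧ sgn (p b) * shiftedWeight p lam a b = N)
    {r : ℕ} (hr : r < a) :
    rootFactor p lam a r ≠ 0 ∧ ‖rootFactor p lam a r‖ < 1 := by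
  have hlt : Fin.ofNat (k + 1) r < a := by
    rw [Fin.lt_def, Fin.val_ofNat, Nat.mod_eq_of_lt (by omega)]
    exact hr
  have h1 := shiftedWeight_ne_zero hpos hlt
  have h2 := shiftedWeight_add_sgn_ne_zero hpos hlt
  obtain ⟨N, hN, h⟩ := hpos _ hlt
  refine ⟨div_ne_zero h1 h2, ?_⟩
  have h3 : rootFactor p lam a r = (N : ℂ) / ((N + 1 : ℕ) : ℂ) := by
    rw [rootFactor, div_eq_div_iff h2 (Nat.cast_ne_zero.2 (Nat.succ_ne_zero N))]
    push_cast
    rw [← h]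
    linear_combination (-shiftedWeight p lam a (Fin.ofNat (k + 1) r))
      * sgn_mul_self (p (Fin.ofNat (k + 1) r))
  rw [h3, norm_div, Complex.norm_natCast, Complex.norm_natCast, div_lt_one (by positivity)]
  push_cast
  linarith

/-- The Bethe equations with one variable of each colour `b < a` have exactly one solution. -/
theorem solvesBethe_initialColours_iff
    (hpos : ∀ b < a, ∃ N : ℕ, 0 < N ∧ sgn (p b) * shiftedWeight p lam a b = N)
    (hp : p 0 = 0) (hz : z₁ ≠ z₂)
    (t : Fin (∑ b, initialColours a b) → ℂ) :
    SolvesBethe p lam z₁ z₂ C ⟨initialColours a, t⟩ ↔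
      t = fun i => explicitRoot p lam z₁ z₂ a (C.colour (initialColours a) i) := by
  classical
  set c := C.colour (initialColours a) with hcdef
  have hinj : Function.Injective c := colour_initialColours_injective C a
  have hc : ∀ b, (∃ i, c i = b) ↔ b.castSucc < a := exists_colour_initialColours_eq C a
  let T : ℕ → ℂ := fun n => if n = 0 then z₁ else
    if h : ∃ i, (c i : ℕ) + 1 = n then t h.choose else 0
  have hT0 : T 0 = z₁ := if_pos rfl
  have hT : ∀ i, T (c i + 1) = t i := by
    intro i
    have h : ∃ j, (c j : ℕ) + 1 = c i + 1 := ⟨i, rfl⟩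
    simp only [T]
    rw [if_neg (Nat.succ_ne_zero _), dif_pos h]
    congr 1
    exact hinj (Fin.ext (by have := h.choose_spec; omega))
  have hof : ∀ b : Fin k, Fin.ofNat (k + 1) (b : ℕ) = b.castSucc := fun b =>
    Fin.ofNat_val_eq_self b.castSucc
  have hof' : ∀ b : Fin k, Fin.ofNat (k + 1) ((b : ℕ) + 1) = b.succ := fun b =>
    Fin.ofNat_val_eq_self b.succ
  have hlift : ∀ n : ℕ, n < a → ∃ b : Fin k, (b : ℕ) = n := fun n hn => ⟨⟨n, by omega⟩, rfl⟩
  have hchain := chain_equations_iff (A := a) (s := fun n => sgn (p (Fin.ofNat (k + 1) n)))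
    (κ := fun n => shiftedWeight p lam a (Fin.ofNat (k + 1) n) -
      if n + 1 < (a : ℕ) then sgn (p (Fin.ofNat (k + 1) (n + 1)))
        + shiftedWeight p lam a (Fin.ofNat (k + 1) (n + 1)) else 0)
    (lt := fun n => shiftedWeight p lam a (Fin.ofNat (k + 1) n)) (y := fun n => T n - z₂)
    (fun b _ => by ring) (fun b _ => sgn_ne_zero _)
    (fun n hn => by
      obtain ⟨b, rfl⟩ := hlift n hn
      rw [hof]
      exact shiftedWeight_ne_zero hpos hn)
    (fun n hn => by
      obtain ⟨b, rfl⟩ := hlift n hn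
      rw [hof]
      exact shiftedWeight_add_sgn_ne_zero hpos hn) (by simpa [hT0, sub_eq_zero] using hz)
  have hκ : ∀ b : Fin k, b.castSucc < a → shiftedWeight p lam a (Fin.ofNat (k + 1) (b : ℕ)) -
      (if (b : ℕ) + 1 < (a : ℕ) then sgn (p (Fin.ofNat (k + 1) ((b : ℕ) + 1)))
        + shiftedWeight p lam a (Fin.ofNat (k + 1) ((b : ℕ) + 1)) else 0)
      = form p (simpleRoot b) lam := by
    intro b hb
    rw [hof, hof', shiftedWeight_rec b hb]
    ring
  have hstep : SolvesBethe p lam z₁ z₂ C ⟨initialColours a, t⟩ ↔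
      ∀ n < (a : ℕ), T (n + 1) - z₂ = rootFactor p lam a n * (T n - z₂) := by
    refine (isBetheSolution_iff_chain hp hinj hc hT0 hT).trans (Iff.trans ?_ hchain)
    constructor
    · intro h n hn
      obtain ⟨b, rfl⟩ := hlift n hn
      obtain ⟨h1, h2, h3⟩ := h b hn
      refine ⟨fun h => h1 (sub_left_injective h), fun h => ?_, ?_⟩
      · rw [hκ b hn] at h
        exact sub_ne_zero.2 (h2 h)
      · rw [hκ b hn, hof, hof', sub_sub_sub_cancel_right, sub_sub_sub_cancel_right]
        exact h3
    · intro h b hb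
      obtain ⟨h1, h2, h3⟩ := h b hb
      refine ⟨fun h => h1 (by rw [h]), fun h => ?_, ?_⟩
      · rw [hκ b hb] at h2
        exact sub_ne_zero.1 (h2 h)
      · rw [hκ b hb, hof, hof', sub_sub_sub_cancel_right, sub_sub_sub_cancel_right] at h3
        exact h3
  rw [hstep]
  constructor
  · intro h
    have hprod : ∀ n ≤ (a : ℕ), T n
        = z₂ + (z₁ - z₂) * ∏ r ∈ Finset.range n, rootFactor p lam a r := by
      intro n
      induction n with
      | zero => intro _; rw [hT0]; simp
      | succ n ih =>
        intro hn
        rw [Finset.prod_range_succ, ← sub_eq_iff_eq_add', h n hn, ih (by omega)]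
        ring
    funext i
    rw [explicitRoot_eq, ← hT]
    exact hprod _ ((hc (c i)).1 ⟨i, rfl⟩)
  · intro h
    have hprod : ∀ n ≤ (a : ℕ), T n
        = z₂ + (z₁ - z₂) * ∏ r ∈ Finset.range n, rootFactor p lam a r := by
      intro n hn
      rcases Nat.eq_zero_or_pos n with rfl | h0
      · rw [hT0]; simp
      · obtain ⟨b, hb⟩ := hlift (n - 1) (by omega)
        obtain ⟨i, rfl⟩ := (hc b).2 (by rw [Fin.lt_def, Fin.val_castSucc]; omega)
        have hn' : n = c i + 1 := by omega
        rw [hn', hT, congrFun h i, explicitRoot_eq]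
    intro n hn
    rw [hprod _ hn, hprod _ hn.le, Finset.prod_range_succ]
    ring

theorem isRegular_explicitSolution
    (hpos : ∀ b < a, ∃ N : ℕ, 0 < N ∧ sgn (p b) * shiftedWeight p lam a b = N)
    (hz : z₁ ≠ z₂) :
    IsRegular ![z₁, z₂] (explicitSolution p lam z₁ z₂ C a).2 := by
  set c := C.colour (initialColours a) with hcdef
  have hinj : Function.Injective c := colour_initialColours_injective C a
  have hca : ∀ i, (c i : ℕ) < a := fun i =>
    (exists_colour_initialColours_eq C a (c i)).1 ⟨i, rfl⟩
  let y : ℕ → ℂ := fun n => (z₁ - z₂) * ∏ r ∈ Finset.range n, rootFactor p lam a r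
  have hy0 : ∀ n ≤ (a : ℕ), y n ≠ 0 := fun n hn => mul_ne_zero (sub_ne_zero.2 hz)
    (Finset.prod_ne_zero_iff.2 fun r hr =>
      (norm_rootFactor_lt_one hpos ((Finset.mem_range.1 hr).trans_le hn)).1)
  -- The distances of the points of the chain to `z₂` decrease.
  have hdec : ∀ m n : ℕ, n < m → m ≤ (a : ℕ) → ‖y m‖ < ‖y n‖ := by
    intro m n hnm
    induction m, hnm using Nat.le_induction with
    | base =>
      intro hn
      have : y (n + 1) = y n * rootFactor p lam a n := by
        simp only [y, Finset.prod_range_succ]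
        ring
      rw [this, norm_mul]
      exact mul_lt_of_lt_one_right (norm_pos_iff.2 (hy0 n (by omega)))
        (norm_rootFactor_lt_one hpos hn).2
    | succ m _ ih =>
      intro hm
      have : y (m + 1) = y m * rootFactor p lam a m := by
        simp only [y, Finset.prod_range_succ]
        ring
      rw [this, norm_mul]
      exact (mul_lt_of_lt_one_right (norm_pos_iff.2 (hy0 m (by omega)))
        (norm_rootFactor_lt_one hpos hm).2).trans (ih (by omega))
  have hinjy : ∀ m n : ℕ, m ≤ (a : ℕ) → n ≤ (a : ℕ) → y m = y n → m = n := by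
    intro m n hm hn h
    rcases lt_trichotomy m n with h' | h' | h'
    · exact absurd (congrArg norm h) (hdec n m h' hn).ne'
    · exact h'
    · exact absurd (congrArg norm h) (hdec m n h' hm).ne
  have ht : ∀ i, (explicitSolution p lam z₁ z₂ C a).2 i = z₂ + y (c i + 1) := fun i =>
    explicitRoot_eq _
  refine ⟨fun i j hij => ?_, fun i s => ?_⟩
  · rw [ht, ht] at hij
    have := hinjy _ _ (hca i) (hca j) (add_left_cancel hij)
    exact hinj (Fin.ext (by omega))
  · fin_cases s
    · rw [ht]
      intro h
      have h' : y (c i + 1) = y 0 := by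
        have h1 : z₂ + y (c i + 1) = z₁ := h
        simp only [y, Finset.range_zero, Finset.prod_empty, mul_one] at h1 ⊢
        linear_combination h1
      exact Nat.succ_ne_zero _ (hinjy _ _ (hca i) (Nat.zero_le _) h')
    · rw [ht]
      intro h
      have h1 : z₂ + y (c i + 1) = z₂ := h
      exact hy0 _ (hca i) (by linear_combination h1)

end Explicit

/-! ### The Bethe vectors of `ℂ^{m|n} ⊗ V` -/

theorem splitSum_eq_last {α β : Type*} [AddCommMonoid β] :
    ∀ (f : List α → List α → β) (L : List α), (∀ P Q, P ++ Q = L → Q ≠ [] → f P Q = 0) →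
      splitSum f L = f L []
  | _, [], _ => rfl
  | f, a :: L, h => by
    rw [splitSum, h [] (a :: L) rfl (List.cons_ne_nil a L), zero_add]
    exact splitSum_eq_last (fun P Q => f (a :: P) Q) L fun P Q hPQ hQ =>
      h (a :: P) Q (by rw [List.cons_append, hPQ]) hQ

theorem chainFactor_ne_zero (z : ℂ) : ∀ L : List ℂ, L.Nodup → (∀ x ∈ L, x ≠ z) →
    chainFactor z L ≠ 0
  | [], _, _ => one_ne_zero
  | [x], _, hz => one_div_ne_zero (sub_ne_zero.2 (hz x (by simp)))
  | x :: y :: L, hn, hz => by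
    rw [chainFactor]
    refine mul_ne_zero (one_div_ne_zero (sub_ne_zero.2 fun h => ?_))
      (chainFactor_ne_zero z (y :: L) (List.nodup_cons.1 hn).2 fun w hw =>
        hz w (List.mem_cons_of_mem _ hw))
    simp [h] at hn

section

variable {p : Fin (k + 1) → ZMod 2}

theorem single_zero_mem_weightSpace :
    (Pi.single 0 1 : Fin (k + 1) → ℂ) ∈ (definingModule p).weightSpace (eps 0) := by
  rw [GLModule.mem_weightSpace]
  intro a
  rw [definingModule_E_apply]
  by_cases h : a = 0
  · subst h; simp [eps]
  · simp [eps, h]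

theorem single_zero_mem_singular :
    (Pi.single 0 1 : Fin (k + 1) → ℂ) ∈ (definingModule p).singular := by
  rw [GLModule.mem_singular]
  intro a b hab
  rw [definingModule_E_apply, Pi.single_eq_of_ne ((Fin.zero_le a).trans_lt hab).ne', Pi.single_zero]

theorem parity_single_zero (hp : p 0 = 0) :
    (definingModule p).parity (Pi.single 0 1 : Fin (k + 1) → ℂ) = Pi.single 0 1 := by
  funext c
  have h := definingModule_parity_pow_apply (p := p) 1 (Pi.single 0 1) c
  rw [show (1 : ZMod 2).val = 1 from rfl, pow_one, one_mul] at h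
  rw [h]
  by_cases hc : c = 0
  · rw [hc, hp, sgn_zero, one_mul]
  · rw [Pi.single_eq_of_ne hc, mul_zero]

/-- The product `F_{c(1)} ⋯ F_{c(j)}` takes `e_1` to a basis vector if the colours increase by one
from right to left, starting from the first colour, and to `0` otherwise. -/
theorem chainVector_definingModule {l : ℕ} (c : Fin l → Fin k) :
    ∀ (P : List (Fin l)) (a : Fin (k + 1)),
      chainVector (definingModule p) (Pi.single 0 1) c P a
        = if P.map (fun i => (c i : ℕ)) = (List.range a).reverse then 1 else 0
  | [], a => by
    simp only [chainVector, List.map_nil, List.prod_nil, Module.End.one_apply, Pi.single_apply,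
      Fin.ext_iff, Fin.val_zero]
    congr 1
    rw [eq_comm (a := []), List.reverse_eq_nil_iff, List.range_eq_nil]
  | i :: P, a => by
    rw [chainVector_cons, GLModule.F, definingModule_E_apply, chainVector_definingModule c P,
      Pi.single_apply, List.map_cons]
    by_cases h : a = (c i).succ
    · subst h
      rw [if_pos rfl, Fin.val_succ, List.range_succ, List.reverse_append]
      simp
    · rw [if_neg h, if_neg]
      intro h'
      have ha : (a : ℕ) ≠ 0 := by
        intro h0
        rw [h0] at h'
        simp at h'
      obtain ⟨n, hn⟩ := Nat.exists_eq_succ_of_ne_zero ha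
      rw [hn, Nat.succ_eq_add_one, List.range_succ, List.reverse_append] at h'
      simp only [List.reverse_cons, List.reverse_nil, List.nil_append, List.cons_append,
        List.cons.injEq] at h'
      exact h (Fin.ext (by rw [hn, Fin.val_succ, h'.1]))

variable {V : Type*} [AddCommGroup V] [Module ℂ V]

/-- The coefficient of `e_a ⊗ v` in a Bethe vector with one variable of each colour `b < a` comes from
a single term. -/
theorem betheVector_ne_zero (M : GLModule p V) {v : V} (hv : v ≠ 0) {z₁ z₂ : ℂ} (C : Colouring k)
    (a : Fin (k + 1)) {t : Fin (∑ b, initialColours a b) → ℂ} (ht : IsRegular ![z₁, z₂] t) :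
    betheVector M v z₁ z₂ C ⟨initialColours a, t⟩ ≠ 0 := by
  set c := C.colour (initialColours a) with hcdef
  have hinj : Function.Injective c := colour_initialColours_injective C a
  have hc : ∀ b, (∃ i, c i = b) ↔ b.castSucc < a := exists_colour_initialColours_eq C a
  have hinj' : Function.Injective fun i => (c i : ℕ) := Fin.val_injective.comp hinj
  have hca : ∀ i, (c i : ℕ) < a := fun i => (hc (c i)).1 ⟨i, rfl⟩
  have hcomp : ∀ L ∈ orderings (∑ b, initialColours a b),
      component a (orderingVector (definingModule p) M (Pi.single 0 1) v z₁ z₂ c t L)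
        = if L.map (fun i => (c i : ℕ)) = (List.range a).reverse then chainFactor z₁ (L.map t) • v
          else 0 := by
    intro L hL
    have hnd : L.Nodup := (mem_orderings.1 hL).nodup_iff.2 (List.nodup_finRange _)
    rw [orderingVector]
    refine (map_splitSum (component a).toAddMonoidHom _ L).trans ?_
    rw [splitSum_eq_last]
    · simp only [LinearMap.toAddMonoidHom_coe, map_smul, component_tmul, chainVector_definingModule]
      split_ifs
      · simp [chainFactor, chainVector]
      · simp
    · intro P Q hPQ hQ
      simp only [LinearMap.toAddMonoidHom_coe, map_smul, component_tmul, chainVector_definingModule]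
      rw [if_neg, zero_smul, smul_zero]
      intro hP
      obtain ⟨j, hj⟩ := List.exists_mem_of_ne_nil Q hQ
      have hmem : (c j : ℕ) ∈ P.map fun i => (c i : ℕ) := by
        rw [hP, List.mem_reverse, List.mem_range]
        exact hca j
      obtain ⟨i, hi, hij⟩ := List.mem_map.1 hmem
      rw [← hPQ] at hnd
      exact (List.nodup_append.1 hnd).2.2 i hi j hj (hinj' hij)
  obtain ⟨L₀, hL₀⟩ : ∃ L : List (Fin (∑ b, initialColours a b)),
      L.map (fun i => (c i : ℕ)) = (List.range a).reverse := by
    have h : ∀ x ∈ (List.range a).reverse, x ∈ Set.range fun i => (c i : ℕ) := by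
      intro x hx
      rw [List.mem_reverse, List.mem_range] at hx
      obtain ⟨i, hi⟩ := (hc ⟨x, by omega⟩).2 hx
      exact ⟨i, by simp only [hi]⟩
    have h' : (List.range a).reverse ∈ Set.range (List.map fun i => (c i : ℕ)) := by
      rw [Set.range_list_map]
      exact h
    exact h'
  have hnd₀ : L₀.Nodup := by
    refine List.Nodup.of_map (fun i => (c i : ℕ)) ?_
    rw [hL₀, List.nodup_reverse]
    exact List.nodup_range
  have hmem₀ : L₀ ∈ orderings (∑ b, initialColours a b) := by
    rw [mem_orderings]
    refine (List.perm_ext_iff_of_nodup hnd₀ (List.nodup_finRange _)).2 fun i => ?_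
    refine ⟨fun _ => List.mem_finRange i, fun _ => ?_⟩
    have hmem : (c i : ℕ) ∈ L₀.map fun i => (c i : ℕ) := by
      rw [hL₀, List.mem_reverse, List.mem_range]
      exact hca i
    obtain ⟨j, hj, hij⟩ := List.mem_map.1 hmem
    exact hinj' hij ▸ hj
  have hsign : ∀ {l : ℕ} (q : Fin l → ZMod 2) (L : List (Fin l)), listSign q L ≠ 0 := by
    intro l q L
    induction L with
    | nil => exact one_ne_zero
    | cons x L ih =>
      rw [listSign]
      refine mul_ne_zero (List.prod_ne_zero fun h => ?_) ih
      obtain ⟨y, -, hy⟩ := List.mem_map.1 h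
      split_ifs at hy
      · exact sgn_ne_zero _ hy
      · exact one_ne_zero hy
  have hval : component a (betheVector M v z₁ z₂ C ⟨initialColours a, t⟩)
      = listSign (fun i => parityF p (c i)) L₀ • chainFactor z₁ (L₀.map t) • v := by
    rw [betheVector, weightFunction_eq_sum_orderings, map_sum, Finset.sum_eq_single_of_mem L₀ hmem₀]
    · rw [map_smul, hcomp L₀ hmem₀, if_pos hL₀]
    · intro L hL hne
      rw [map_smul, hcomp L hL, if_neg, smul_zero]
      intro h
      exact hne (List.map_injective_iff.2 hinj' (h.trans hL₀.symm))
  intro h0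
  rw [h0, map_zero] at hval
  refine smul_ne_zero (hsign _ _) (smul_ne_zero (chainFactor_ne_zero _ _ (hnd₀.map ht.1) ?_) hv)
    hval.symm
  intro x hx
  obtain ⟨i, -, rfl⟩ := List.mem_map.1 hx
  exact ht.2 i 0

theorem sum_simpleRoot_colour (C : Colouring k) (l : Fin k → ℕ) :
    ∑ i, simpleRoot (C.colour l i) = rootSum l := by
  rw [rootSum, ← Finset.sum_fiberwise (s := Finset.univ) (g := C.colour l)]
  refine Finset.sum_congr rfl fun b _ => ?_
  rw [Finset.sum_congr rfl fun i hi => by rw [(Finset.mem_filter.1 hi).2], Finset.sum_const,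
    C.card_colour, Nat.cast_smul_eq_nsmul]

theorem betheVector_mem_weightSpace {M : GLModule p V} {lam : Weight k} {v : V}
    (hv : v ∈ M.weightSpace lam) (z₁ z₂ : ℂ) (C : Colouring k) (x : BethePoint k) :
    betheVector M v z₁ z₂ C x
      ∈ ((definingModule p).tensor M).weightSpace (weightAtInfinity lam x) := by
  rw [weightAtInfinity, ← sum_simpleRoot_colour C]
  exact weightFunction_mem_weightSpace _ _ single_zero_mem_weightSpace hv _ _ _ _

theorem betheVector_mem_singular {M : GLModule p V} (hp : p 0 = 0) {lam : Weight k} {v : V}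
    (hv : v ∈ M.weightSpace lam) (hs : v ∈ M.singular) {z₁ z₂ : ℂ} {C : Colouring k}
    {x : BethePoint k} (hx : SolvesBethe p lam z₁ z₂ C x) (hreg : IsRegular ![z₁, z₂] x.2) :
    betheVector M v z₁ z₂ C x ∈ ((definingModule p).tensor M).singular :=
  GLModule.mem_singular_of_simple _ fun b => E_weightFunction_eq_zero _ _
    single_zero_mem_weightSpace single_zero_mem_singular (parity_single_zero hp) hv hs hx hreg b

theorem parity_betheVector {M : GLModule p V} (hp : p 0 = 0) {v : V}
    (hv : M.parity v = v ∨ M.parity v = -v) (z₁ z₂ : ℂ) (C : Colouring k) (x : BethePoint k) :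
    ((definingModule p).tensor M).parity (betheVector M v z₁ z₂ C x) = betheVector M v z₁ z₂ C x ∨
      ((definingModule p).tensor M).parity (betheVector M v z₁ z₂ C x)
        = -betheVector M v z₁ z₂ C x := by
  have hp₁ : (definingModule p).parity (Pi.single 0 1 : Fin (k + 1) → ℂ)
      = (1 : ℂ) • Pi.single 0 1 := by rw [parity_single_zero hp, one_smul]
  obtain ⟨s, hs, hsv⟩ : ∃ s : ℂ, (s = 1 ∨ s = -1) ∧ M.parity v = s • v := by
    rcases hv with h | h
    · exact ⟨1, Or.inl rfl, by rw [h, one_smul]⟩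
    · exact ⟨-1, Or.inr rfl, by rw [h, neg_one_smul]⟩
  have h := parity_weightFunction (definingModule p) M hp₁ hsv z₁ z₂ (C.colour x.1) x.2
  have hsign : ∀ y : ZMod 2, sgn y * (1 * s) = 1 ∨ sgn y * (1 * s) = -1 := by
    intro y
    rcases zmod_two_cases y with rfl | rfl <;> rcases hs with rfl | rfl <;>
      simp [sgn_zero, sgn_one]
  rcases hsign (∑ i, parityF p (C.colour x.1 i)) with h1 | h1
  · left
    rw [h1, one_smul] at h
    exact h
  · right
    rw [h1] at h
    have hneg := neg_one_smul ℂ (betheVector M v z₁ z₂ C x)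
    exact h.trans hneg

/-- The Pieri rule for singular vectors: their weights come from adding a box to `μ`. -/
theorem exists_addsBox_of_singular {m n : ℕ} (hm : (Finset.univ.filter fun a => p a = 0).card = m)
    (hn : (Finset.univ.filter fun a => p a = 1).card = n) {μ : YoungDiagram} (hμ : IsHook m n μ)
    {M : GLModule p V} (hirr : M.IsIrreducible) (hpol : M.IsPolynomial) {v : V}
    (hv : M.IsHighestWeightVector (hookWeight p μ) v) {ν : Weight k}
    {u : (Fin (k + 1) → ℂ) ⊗[ℂ] V} (h0 : u ≠ 0)
    (hw : u ∈ ((definingModule p).tensor M).weightSpace ν)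
    (hs : u ∈ ((definingModule p).tensor M).singular) :
    ∃ ρ : YoungDiagram, IsHook m n ρ ∧ AddsBox μ ρ ∧ ν = hookWeight p ρ := by
  obtain ⟨a, rfl, -, -⟩ := exists_weight_eq_add_eps hirr hv h0 hw hs
  have hpol' := isPolynomial_tensor hpol
  choose N hN using fun b => hpol.exists_nat hv.2.2.1 hv.1 b
  have hNa : (hookWeight p μ + eps a) a = (N a + 1 : ℕ) := by
    rw [Pi.add_apply, hN]
    simp [eps]
  have hNb : ∀ b < a, (hookWeight p μ + eps a) b = N b := by
    intro b hb
    rw [Pi.add_apply, hN]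
    simp [eps, hb.ne]
  obtain ⟨ρ, h1, h2, h3⟩ := exists_addsBox hm hn hμ hN
    (fun b hb hpb hrun => hpol'.weight_dominance hw hs h0 hb hpb hrun hNa (hNb b hb)
      (Nat.succ_pos _))
    (fun o ho hpo hrun => hpol'.weight_hook hw hs h0 ho hpo hrun hNa (hNb o ho) (Nat.succ_pos _))
  exact ⟨ρ, h1, h2, h3.symm⟩

end

end GaudinGL
end

theorem theorem4p3 {m n k : ℕ} (p : Fin (k + 1) → ZMod 2)
    (hm : (Finset.univ.filter fun a => p a = 0).card = m)
    (hn : (Finset.univ.filter fun a => p a = 1).card = n) (hp : p 0 = 0)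
    (μ : YoungDiagram) (hμ : IsHook m n μ)
    {V : Type*} [AddCommGroup V] [Module ℂ V] (M : GLModule p V)
    (hirr : M.IsIrreducible) (hpol : M.IsPolynomial)
    (v : V) (hv : M.IsHighestWeightVector (hookWeight p μ) v)
    (z₁ z₂ : ℂ) (hz : z₁ ≠ z₂) (C : Colouring k) :
    (∃ B : Module.Basis (betheSolutions M (hookWeight p μ) v z₁ z₂ C) ℂ
        ((definingModule p).tensor M).singular,
      ∀ x, (B x : (Fin (k + 1) → ℂ) ⊗[ℂ] V) = betheVector M v z₁ z₂ C x) ∧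
    (∀ x ∈ betheSolutions M (hookWeight p μ) v z₁ z₂ C,
      ∃ ρ : YoungDiagram, IsHook m n ρ ∧ AddsBox μ ρ ∧
        weightAtInfinity (hookWeight p μ) x = hookWeight p ρ) ∧
    (∀ ρ : YoungDiagram, IsHook m n ρ → AddsBox μ ρ →
      ∃ a : Fin (k + 1), hookWeight p ρ = hookWeight p μ + eps a ∧
        (∀ x : BethePoint k,
          (SolvesBethe p (hookWeight p μ) z₁ z₂ C x ∧
            weightAtInfinity (hookWeight p μ) x = hookWeight p ρ) ↔
          x = explicitSolution p (hookWeight p μ) z₁ z₂ C a) ∧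
        explicitSolution p (hookWeight p μ) z₁ z₂ C a ∈
          betheSolutions M (hookWeight p μ) v z₁ z₂ C ∧
        ((definingModule p).tensor M).IsHighestWeightVector (hookWeight p ρ)
          (betheVector M v z₁ z₂ C (explicitSolution p (hookWeight p μ) z₁ z₂ C a))) := by
  set lam := hookWeight p μ with hlam
  set W := (definingModule p).tensor M with hW
  set S := betheSolutions M lam v z₁ z₂ C with hS
  have hsing : ∀ x ∈ S, betheVector M v z₁ z₂ C x ∈ W.singular := fun x hx =>
    betheVector_mem_singular hp hv.2.2.1 hv.2.2.2 hx.1 hx.2.1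
  have hweight : ∀ x, betheVector M v z₁ z₂ C x ∈ W.weightSpace (weightAtInfinity lam x) := fun x =>
    betheVector_mem_weightSpace hv.2.2.1 z₁ z₂ C x
  have hpieri : ∀ x ∈ S, ∃ ρ : YoungDiagram, IsHook m n ρ ∧ AddsBox μ ρ ∧
      weightAtInfinity lam x = hookWeight p ρ := fun x hx =>
    exists_addsBox_of_singular hm hn hμ hirr hpol hv hx.2.2 (hweight x) (hsing x hx)
  have hconv : ∀ ρ : YoungDiagram, IsHook m n ρ → AddsBox μ ρ →
      ∃ a : Fin (k + 1), hookWeight p ρ = lam + eps a ∧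
        (∀ x : BethePoint k, (SolvesBethe p lam z₁ z₂ C x ∧
            weightAtInfinity lam x = hookWeight p ρ) ↔ x = explicitSolution p lam z₁ z₂ C a) ∧
        explicitSolution p lam z₁ z₂ C a ∈ S ∧
        W.IsHighestWeightVector (hookWeight p ρ)
          (betheVector M v z₁ z₂ C (explicitSolution p lam z₁ z₂ C a)) := by
    intro ρ hρ hadd
    obtain ⟨a, ha, hpos⟩ := exists_hookWeight_eq_add_eps hm hn hρ hadd
    have hiff : ∀ x : BethePoint k, (SolvesBethe p lam z₁ z₂ C x ∧
        weightAtInfinity lam x = hookWeight p ρ) ↔ x = explicitSolution p lam z₁ z₂ C a := by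
      intro x
      rw [ha, weightAtInfinity_eq_iff]
      constructor
      · obtain ⟨l, t⟩ := x
        rintro ⟨hx, hl⟩
        have hl' : l = initialColours a := hl
        subst hl'
        rw [(solvesBethe_initialColours_iff hpos hp hz t).1 hx]
        rfl
      · rintro rfl
        exact ⟨(solvesBethe_initialColours_iff hpos hp hz _).2 rfl, rfl⟩
    have hreg : IsRegular ![z₁, z₂] (explicitSolution p lam z₁ z₂ C a).2 :=
      isRegular_explicitSolution hpos hz
    have hsol := (hiff _).2 rfl
    have hne : betheVector M v z₁ z₂ C (explicitSolution p lam z₁ z₂ C a) ≠ 0 :=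
      betheVector_ne_zero M hv.1 C a hreg
    have hmem : explicitSolution p lam z₁ z₂ C a ∈ S := ⟨hsol.1, hreg, hne⟩
    exact ⟨a, ha, hiff, hmem, hne, parity_betheVector hp hv.2.1 z₁ z₂ C _,
      hsol.2 ▸ hweight _, hsing _ hmem⟩
  refine ⟨?_, hpieri, hconv⟩
  let g : S → W.singular := fun x => ⟨betheVector M v z₁ z₂ C x, hsing x x.2⟩
  have hindep : LinearIndependent ℂ g := by
    refine LinearIndependent.of_comp W.singular.subtype ?_
    refine Module.End.eigenvectors_linearIndependent' W.depthOperator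
      (fun x : S => GLModule.depth (weightAtInfinity lam x.1)) ?_ _ ?_
    · -- The weight at infinity of a solution determines the added box, hence the solution.
      intro x y hxy
      obtain ⟨ρ, h1, h2, hx⟩ := hpieri x x.2
      obtain ⟨a, ha, hiff, -⟩ := hconv ρ h1 h2
      obtain ⟨ρ', h1', h2', hy⟩ := hpieri y y.2
      obtain ⟨a', ha', hiff', -⟩ := hconv ρ' h1' h2'
      have hx' := (hiff x).1 ⟨x.2.1, hx⟩
      have hy' := (hiff' y).1 ⟨y.2.1, hy⟩
      simp only at hxy
      rw [hx, hy, ha, ha', GLModule.depth_add_eps, GLModule.depth_add_eps] at hxy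
      have haa : a = a' := Fin.ext (by exact_mod_cast add_left_cancel hxy)
      exact Subtype.ext (by rw [hx', hy', haa])
    · intro x
      rw [Module.End.hasEigenvector_iff, Module.End.mem_eigenspace_iff]
      exact ⟨W.depthOperator_apply (hweight x), x.2.2.2⟩
  have hspan : ⊤ ≤ Submodule.span ℂ (Set.range g) := by
    rintro ⟨u, hu⟩ -
    have hu' : u ∈ (Submodule.span ℂ (Set.range g)).map W.singular.subtype := by
      obtain ⟨s, f, hf, rfl⟩ :=
        W.exists_singular_weight_decomposition (isPolynomial_tensor hpol).1 hu
      refine Submodule.sum_mem _ fun ν hν => ?_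
      by_cases h0 : f ν = 0
      · rw [h0]; exact Submodule.zero_mem _
      obtain ⟨ρ, h1, h2, rfl⟩ :=
        exists_addsBox_of_singular hm hn hμ hirr hpol hv h0 (hf ν hν).1 (hf ν hν).2
      obtain ⟨a, -, -, hmem, hhw⟩ := hconv ρ h1 h2
      obtain ⟨r, hr⟩ := Submodule.mem_span_singleton.1 (mem_span_of_same_weight hirr hv hhw.1
        hhw.2.2.1 hhw.2.2.2 (hf _ hν).1 (hf _ hν).2)
      rw [← hr]
      exact Submodule.smul_mem _ _ ⟨g ⟨_, hmem⟩, Submodule.subset_span ⟨_, rfl⟩, rfl⟩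
    obtain ⟨y, hy, hyu⟩ := hu'
    have : y = ⟨u, hu⟩ := Subtype.ext hyu
    exact this ▸ hy
  exact ⟨Module.Basis.mk hindep hspan, fun x => by rw [Module.Basis.mk_apply]⟩
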